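/- Let $N\ge 1$, $\mathbf p=(p_1,\dots,p_N)$ with $p_i>1$ for all $i$, and $\Lambda>0$. For $0<T\le+\infty$ put $S_T=\mathbb R^N\times\,]0,T[$. Let $A:S_T\times\mathbb R\times\mathbb R^N\to\mathbb R^N$ be (Borel) measurable with $$A_i(x,t,s,z)\,z_i\ \ge\ \Lambda^{-1}|z_i|^{p_i},\qquad |A_i(x,t,s,z)|\ \le\ \Lambda\,|z_i|^{p_i-1},\qquad i=1,\dots,N .$$ For $T<+\infty$ and $u_0\in L^2_{\rm loc}(\mathbb R^N)$, we say that $u$ solves the Cauchy problem $$u_t=\operatorname{div}A(x,t,u,Du)\ \text{ in } S_T,\qquad u(\cdot,0)=u_0 ,$$ if $u\in C^0([0,T];L^2_{\rm loc}(\mathbb R^N))\cap L^1(0,T;L^1_{\rm loc}(\mathbb R^N))$, the weak spatial derivatives satisfy $D_iu\in L^{p_i}(0,T;L^{p_i}_{\rm loc}(\mathbb R^N))$ for all $i$, $u(\cdot,0)=u_0$ a.e., and for all $0<t_1<t_2<T$ and all $\varphi\in C^\infty_{\rm loc}(0,T;C^\infty_c(\mathbb R^N))$ $$\int_{\mathbb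 R^N}u\,\varphi\,dx\,\Big|_{t_1}^{t_2}+\int_{t_1}^{t_2}\!\!\int_{\mathbb R^N}\big(-u\,\varphi_t+A(x,t,u,Du)\cdot D\varphi\big)\,dx\,dt=0 .$$ For $T=+\infty$, $u$ solves the problem in $S_\infty$ if it solves it in $S_{T'}$ for every $T'<+\infty$. **Corollary.** There is a constant $C>0$ depending only on $N,\mathbf p,\Lambda$ such that the following holds. Let $0<T\le+\infty$, let $A$ be as above, let $u_0\in L^2(\mathbb R^N)$, and let $u\in\bigcap_{i=1}^N L^{p_i}(S_T)$ solve the Cauchy problem in $S_T$ with initial datum $u_0$. Then $u\in L^\infty(0,T;L^2(\mathbb R^N))$, $$\|u(\cdot,t)\|_2\le\|u_0\|_2\qquad\text{for all } t\in[0,T]\ \ (\text{all } t\ge 0 \text{ if } T=+\infty),$$ and for every $k\in\mathbb R$ the function $(u-k)_+$ has weak spatial derivatives in $L^1_{\rm loc}(S_T)$ and, for all $0<t_1<t_2<T$ and every Lipschitz function $\psi\ge 0$ on $[0,T]$ (on $[0,+\infty[$ if $T=+\infty$), $$\int_{\mathbb R^N}(u-k)_+^2(x,t_2)\,\psi(t_2)\,dx+\frac1C\sum_{i=1}^N\int_{t_1}^{t_2}\!\!\int_{\mathbb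 R^N}|D_i(u-k)_+|^{p_i}\,\psi\,dx\,dt\ \le\ \int_{\mathbb R^N}(u-k)_+^2(x,t_1)\,\psi(t_1)\,dx+\int_{t_1}^{t_2}\!\!\int_{\mathbb R^N}(u-k)_+^2\,|\psi_t|\,dx\,dt .$$ Here all terms are understood in $[0,+\infty]$, with $0\cdot\infty=0$; if $k\ge 0$, the right-hand side, hence every term, is finite. -/

import Mathlib

open MeasureTheory Set Filter Topology
open scoped ENNReal NNReal ContDiff

namespace AnisoCauchy

/-- The space `ℝ^N`. -/
abbrev E (N : ℕ) : Type := EuclideanSpace ℝ (Fin N)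

/-- The open time interval `]0, T[`, where `T` may be `+∞`. -/
def openTimes (T : EReal) : Set ℝ := {t | 0 < t ∧ (t : EReal) < T}

/-- The time interval `[0, T]` (which is `[0, +∞[` if `T = +∞`). -/
def closedTimes (T : EReal) : Set ℝ := {t | 0 ≤ t ∧ (t : EReal) ≤ T}

/-- The strip `S_T = ℝ^N × ]0, T[`. -/
def strip (N : ℕ) (T : EReal) : Set (E N × ℝ) := univ ×ˢ openTimes T

/-- The spatial partial derivative `D_i φ` of a differentiable function `φ = φ(x, t)`. -/
noncomputable def dx {N : ℕ} (φ : E N × ℝ → ℝ) (i : Fin N) (z : E N × ℝ) : ℝ :=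
  fderiv ℝ φ z (EuclideanSpace.single i 1, 0)

/-- The time derivative `φ_t` of a differentiable function `φ = φ(x, t)`. -/
noncomputable def dt {N : ℕ} (φ : E N × ℝ → ℝ) (z : E N × ℝ) : ℝ :=
  fderiv ℝ φ z (0, 1)

/-- `w = (D_1 v, …, D_N v)` is the weak (distributional) spatial gradient of `v` in `S_T`. -/
structure IsWeakSpatialGradient {N : ℕ} (T : EReal) (v : E N × ℝ → ℝ) (w : E N × ℝ → E N) :
    Prop where
  locallyIntegrable : LocallyIntegrableOn v (strip N T)
  gradient_locallyIntegrable : LocallyIntegrableOn w (strip N T)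
  integral_eq : ∀ φ : E N × ℝ → ℝ, ContDiff ℝ ∞ φ → HasCompactSupport φ →
    tsupport φ ⊆ strip N T → ∀ i : Fin N,
      ∫ z in strip N T, v z * dx φ i z = - ∫ z in strip N T, w z i * φ z

/-- `u ∈ C⁰(I; L²_loc(ℝ^N))`. -/
structure ContinuousInL2loc {N : ℕ} (I : Set ℝ) (u : E N × ℝ → ℝ) : Prop where
  memLp : ∀ t ∈ I, ∀ K : Set (E N), IsCompact K →
    MemLp (fun x => u (x, t)) 2 (volume.restrict K)
  tendsto : ∀ t₀ ∈ I, ∀ K : Set (E N), IsCompact K →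
    Tendsto (fun t => eLpNorm (fun x => u (x, t) - u (x, t₀)) 2 (volume.restrict K))
      (𝓝[I] t₀) (𝓝 0)

/-- `u ∈ L^∞(0, T; L²(ℝ^N))`. -/
def MemLinftyL2 {N : ℕ} (T : EReal) (u : E N × ℝ → ℝ) : Prop :=
  AEStronglyMeasurable u (volume.restrict (strip N T)) ∧
  ∃ M : ℝ≥0, ∀ᵐ t ∂(volume.restrict (openTimes T)),
    MemLp (fun x => u (x, t)) 2 volume ∧ eLpNorm (fun x => u (x, t)) 2 volume ≤ M

/-- The vector field `A` on `S_T × ℝ × ℝ^N` is measurable and satisfies the anisotropic growth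
conditions `A_i(x, t, s, z) z_i ≥ Λ⁻¹ |z_i|^{p_i}` and `|A_i(x, t, s, z)| ≤ Λ |z_i|^{p_i - 1}`.
(The values of `A` outside `S_T` play no role.) -/
structure IsAnisotropicField {N : ℕ} (p : Fin N → ℝ) (Λ : ℝ) (T : EReal)
    (A : E N × ℝ → ℝ → E N → E N) : Prop where
  measurable : Measurable fun q : (E N × ℝ) × ℝ × E N => A q.1 q.2.1 q.2.2
  coercive : ∀ y ∈ strip N T, ∀ s z, ∀ i : Fin N, Λ⁻¹ * |z i| ^ p i ≤ A y s z i * z i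
  growth : ∀ y ∈ strip N T, ∀ s z, ∀ i : Fin N, |A y s z i| ≤ Λ * |z i| ^ (p i - 1)

/-- The test functions `φ ∈ C^∞_loc(0, T; C^∞_c(ℝ^N))`: smooth on `S_T` and, on compact subintervals
of `]0, T[`, with spatial support in a common compact set. -/
structure IsTestFunction {N : ℕ} (T : ℝ) (φ : E N × ℝ → ℝ) : Prop where
  smooth : ContDiffOn ℝ ∞ φ (strip N T)
  support : ∀ a b : ℝ, 0 < a → b < T →
    ∃ K : Set (E N), IsCompact K ∧ ∀ x ∉ K, ∀ t ∈ Icc a b, φ (x, t) = 0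

/-- `u`, with weak spatial gradient `Du`, is a local weak solution of `u_t = div A(x, t, u, Du)` in
`S_T`, `T < +∞`: it belongs to
`C⁰_loc(0, T; L²_loc(ℝ^N)) ∩ L^p_loc(0, T; W^{1,p}_loc(ℝ^N))` and satisfies the weak formulation. -/
structure IsLocalWeakSolution {N : ℕ} (p : Fin N → ℝ) (A : E N × ℝ → ℝ → E N → E N) (T : ℝ)
    (u : E N × ℝ → ℝ) (Du : E N × ℝ → E N) : Prop where
  continuous_loc : ContinuousInL2loc (Ioo 0 T) u
  gradient : IsWeakSpatialGradient T u Du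
  memLp_loc : ∀ K : Set (E N), IsCompact K → ∀ a b : ℝ, 0 < a → b < T →
    MemLp u 1 (volume.restrict (K ×ˢ Ioo a b))
  gradient_memLp_loc : ∀ K : Set (E N), IsCompact K → ∀ a b : ℝ, 0 < a → b < T → ∀ i : Fin N,
    MemLp (fun z => Du z i) (ENNReal.ofReal (p i)) (volume.restrict (K ×ˢ Ioo a b))
  weak_formulation : ∀ t₁ t₂ : ℝ, 0 < t₁ → t₁ < t₂ → t₂ < T →
    ∀ φ : E N × ℝ → ℝ, IsTestFunction T φ →
      ((∫ x, u (x, t₂) * φ (x, t₂)) - ∫ x, u (x, t₁) * φ (x, t₁)) +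
        ∫ z in (univ : Set (E N)) ×ˢ Ioo t₁ t₂,
          (-(u z * dt φ z) + ∑ i : Fin N, A z (u z) (Du z) i * dx φ i z) = 0

/-- `u`, with weak spatial gradient `Du`, solves the Cauchy problem with initial datum `u₀` in
`S_T`, `T < +∞`: it is a local weak solution, belongs to
`C⁰([0, T]; L²_loc(ℝ^N)) ∩ L^p(0, T; W^{1,p}_loc(ℝ^N))`, and `u(·, 0) = u₀`. -/
structure SolvesCauchyWith {N : ℕ} (p : Fin N → ℝ) (A : E N × ℝ → ℝ → E N → E N)
    (u₀ : E N → ℝ) (T : ℝ) (u : E N × ℝ → ℝ) (Du : E N × ℝ → E N) : Prop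
    extends IsLocalWeakSolution p A T u Du where
  continuous : ContinuousInL2loc (Icc 0 T) u
  memLp : ∀ K : Set (E N), IsCompact K → MemLp u 1 (volume.restrict (K ×ˢ Ioo 0 T))
  gradient_memLp : ∀ K : Set (E N), IsCompact K → ∀ i : Fin N,
    MemLp (fun z => Du z i) (ENNReal.ofReal (p i)) (volume.restrict (K ×ˢ Ioo 0 T))
  initial : (fun x => u (x, 0)) =ᵐ[volume] u₀

/-- `u` solves the Cauchy problem with initial datum `u₀` in `S_T`. If `T = +∞` this means that it
does so in `S_{T'}` for every finite `T'`. If `T` is finite, a solution in `S_T` is one in every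
`S_{T'}` with `0 < T' ≤ T`, so the quantification over `T'` changes nothing. The gradient, being
unique almost everywhere, may be taken to be the same function for all `T'`. -/
def SolvesCauchy {N : ℕ} (p : Fin N → ℝ) (A : E N × ℝ → ℝ → E N → E N)
    (u₀ : E N → ℝ) (T : EReal) (u : E N × ℝ → ℝ) : Prop :=
  ∃ Du : E N × ℝ → E N, ∀ T' : ℝ, 0 < T' → (T' : EReal) ≤ T → SolvesCauchyWith p A u₀ T' u Du

/-- `∫ (u - k)_+²(x, t) ψ(t) dx ∈ [0, ∞]`. -/
noncomputable def sliceEnergy {N : ℕ} (u : E N × ℝ → ℝ) (k : ℝ) (ψ : ℝ → ℝ) (t : ℝ) : ℝ≥0∞ :=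
  ∫⁻ x, ENNReal.ofReal (max (u (x, t) - k) 0 ^ 2 * ψ t)

/-- `∫_{t₁}^{t₂} ∫ (u - k)_+² |ψ_t| dx dt ∈ [0, ∞]`. -/
noncomputable def cutoffTerm {N : ℕ} (u : E N × ℝ → ℝ) (k : ℝ) (ψ : ℝ → ℝ) (t₁ t₂ : ℝ) : ℝ≥0∞ :=
  ∫⁻ z in (univ : Set (E N)) ×ˢ Ioo t₁ t₂,
    ENNReal.ofReal (max (u z - k) 0 ^ 2 * |deriv ψ z.2|)

/-- `∑_i ∫_{t₁}^{t₂} ∫ |w_i|^{p_i} ψ dx dt ∈ [0, ∞]`. -/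
noncomputable def gradientTerm {N : ℕ} (p : Fin N → ℝ) (w : E N × ℝ → E N) (ψ : ℝ → ℝ)
    (t₁ t₂ : ℝ) : ℝ≥0∞ :=
  ∑ i : Fin N, ∫⁻ z in (univ : Set (E N)) ×ˢ Ioo t₁ t₂, ENNReal.ofReal (|w z i| ^ p i * ψ z.2)

end AnisoCauchy

/-! The formal argument multiplies the equation by `G'(u) ζ`, where `γ = G''` takes values in `[0,
1]` and `ζ` is a cut-off in space. By coercivity the term `γ(u) A · Du ζ` controls `Λ⁻¹ γ(u) |D_i
u|^{p_i} ζ`. The cut-off term `A_i G'(u) D_i ζ` is tamed by two choices. Since `|G'(s)| ≤ γ(s) |s|`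
(`IsEnergyDensity`), it also carries the factor `γ(u)`; since `|D_i ζ| ≤ κ ζ^{(p_i - 1)/p_i}`
(`exists_space_cutoff`), Young's inequality absorbs it into half of the coercive term, up to `C
κ^{p_i} ∫ |u|^{p_i}`. This error vanishes as `κ → 0` because `u ∈ L^{p_i}(S_T)`.

The function `G'(u) ζ` is not an admissible test function, so `u`, `Du` and the flux are mollified
in space-time, where the equation holds pointwise near the support of a given test function and the
computation is classical (`integral_energy_identity`). The limit must be taken in products of
mollifications. Young's inequality at two different points gives `|a(y)| |w(y')| ≤ h(y) + h(y')`
with `h` integrable; hence the product of the mollifications of `a` and `w` is at most twice the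
mollification of `h` (`abs_mollify_mul_abs_mollify_le`). These majorants converge a.e. and have
constant integral, so a generalized dominated convergence theorem applies.

Since `t ↦ ∫ G(u(x, t)) ζ dx` is continuous, smooth time cut-offs can tend to the indicator of an
interval (`SolvesCauchyWith.localEnergy_add_le`); Fatou's lemma then removes `ζ`. With `γ = 1`, and
times tending to `0` and `T`, this is the `L²` bound. With `γ` increasing to the indicator of `]k,
∞[`, `k ≥ 0`, it is the energy inequality for truncations on every subinterval, without weight
(`SolvesCauchyWith.lintegral_truncation_add_le`).

The weight is then inserted abstractly. The gradient integrals define a measure on the time axis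
whose mass on an interval is at most the drop of the energy `e` there. On a partition of mesh `η` an
`L`-Lipschitz weight is almost constant, and the errors telescope to `2 L η (e(t₁) - e(t₂))`
(`weighted_energy_le`). For `k < 0` the truncated energy of any `L²` slice is infinite, so the
right-hand side is infinite unless `ψ` vanishes on `[t₁, t₂]` (`weighted_energy_of_neg`). -/

namespace AnisoCauchy

/-! ### Reflected bump functions -/

section ReflectedBump

variable {F : Type*} [NormedAddCommGroup F] [NormedSpace ℝ F] [FiniteDimensional ℝ F]
  [MeasurableSpace F] {μ : Measure F} (b : ContDiffBump (0 : F))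

theorem fderiv_normed_sub (z y v : F) :
    fderiv ℝ (fun y => b.normed μ (z - y)) y v = - fderiv ℝ (b.normed μ) (z - y) v := by
  have hd : DifferentiableAt ℝ (b.normed μ) (z - y) :=
    (b.contDiff_normed (n := 1)).contDiffAt.differentiableAt (by norm_num)
  have h := hd.hasFDerivAt.comp y ((hasFDerivAt_id y).const_sub z)
  have h' : HasFDerivAt (fun y => b.normed μ (z - y)) _ y := h
  rw [h'.fderiv]
  simp

theorem contDiff_normed_sub (z : F) : ContDiff ℝ ∞ fun y => b.normed μ (z - y) :=
  (b.contDiff_normed (n := ⊤)).comp (contDiff_const.sub contDiff_id)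

end ReflectedBump

/-! ### Mollification and products of mollifications -/

section Mollification

variable {F : Type*} [NormedAddCommGroup F] [NormedSpace ℝ F] [FiniteDimensional ℝ F]
  [MeasurableSpace F] [BorelSpace F] (μ : Measure F) [μ.IsAddHaarMeasure]

/-- The mollification of `f` by the normalized bump function `b`. -/
noncomputable def mollify (b : ContDiffBump (0 : F)) (f : F → ℝ) : F → ℝ :=
  convolution (b.normed μ) f (ContinuousLinearMap.lsmul ℝ ℝ) μ

variable {μ} (b : ContDiffBump (0 : F)) {f g : F → ℝ}

theorem mollify_apply (f : F → ℝ) (z : F) :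
    mollify μ b f z = ∫ y, b.normed μ (z - y) * f y ∂μ := by
  rw [mollify, convolution_eq_swap]
  simp

theorem hasCompactSupport_normed_sub (z : F) :
    HasCompactSupport fun y => b.normed μ (z - y) :=
  (b.hasCompactSupport_normed (μ := μ)).comp_homeomorph (Homeomorph.subLeft z)

theorem integrable_normed_sub_mul (hf : LocallyIntegrable f μ) (z : F) :
    Integrable (fun y => b.normed μ (z - y) * f y) μ := by
  have h := hf.integrable_smul_left_of_hasCompactSupport
    (g := fun y => b.normed μ (z - y))
    (b.continuous_normed.comp (continuous_const.sub continuous_id))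
    (hasCompactSupport_normed_sub b z)
  simpa using h

theorem contDiff_mollify (hf : LocallyIntegrable f μ) : ContDiff ℝ ∞ (mollify μ b f) :=
  b.hasCompactSupport_normed.contDiff_convolution_left _ b.contDiff_normed hf

theorem fderiv_mollify_apply (hf : LocallyIntegrable f μ) (z v : F) :
    fderiv ℝ (mollify μ b f) z v = ∫ y, fderiv ℝ (b.normed μ) (z - y) v * f y ∂μ := by
  have hc : ContDiff ℝ 1 (b.normed μ) := b.contDiff_normed (n := 1)
  have h := (b.hasCompactSupport_normed (μ := μ)).hasFDerivAt_convolution_left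
    (ContinuousLinearMap.lsmul ℝ ℝ) hc hf z
  rw [show mollify μ b f = convolution (b.normed μ) f (ContinuousLinearMap.lsmul ℝ ℝ) μ from rfl,
    h.fderiv, convolution_eq_swap, ContinuousLinearMap.integral_apply]
  · simp [ContinuousLinearMap.precompL_apply]
  · have h1 : HasCompactSupport fun y => fderiv ℝ (b.normed μ) (z - y) :=
      ((b.hasCompactSupport_normed (μ := μ)).fderiv ℝ).comp_homeomorph (Homeomorph.subLeft z)
    have h2 := hf.integrable_smul_right_of_hasCompactSupport
      ((hc.continuous_fderiv one_ne_zero).comp (continuous_const.sub continuous_id)) h1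
    refine h2.congr (Eventually.of_forall fun y => ?_)
    ext v
    simp [mul_comm]

theorem integrable_mollify (hf : Integrable f μ) : Integrable (mollify μ b f) μ :=
  b.integrable_normed.integrable_convolution _ hf

theorem integral_mollify (hf : Integrable f μ) : ∫ z, mollify μ b f z ∂μ = ∫ z, f z ∂μ := by
  unfold mollify
  rw [integral_convolution _ b.integrable_normed hf, b.integral_normed]
  simp

theorem integral_normed_sub (z : F) : ∫ y, b.normed μ (z - y) ∂μ = 1 := by
  rw [integral_sub_left_eq_self (fun y => b.normed μ y) μ z, b.integral_normed]

theorem mollify_nonneg (h : 0 ≤ f) (z : F) : 0 ≤ mollify μ b f z := by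
  rw [mollify_apply]
  exact integral_nonneg fun y => mul_nonneg (b.nonneg_normed _) (h y)

theorem abs_mollify_le (f : F → ℝ) (z : F) :
    |mollify μ b f z| ≤ mollify μ b (fun y => |f y|) z := by
  rw [mollify_apply, mollify_apply]
  refine (abs_integral_le_integral_abs).trans (le_of_eq ?_)
  simp [abs_mul, abs_of_nonneg (b.nonneg_normed _)]

theorem mollify_add (hf : LocallyIntegrable f μ) (hg : LocallyIntegrable g μ) (z : F) :
    mollify μ b (fun y => f y + g y) z = mollify μ b f z + mollify μ b g z := by
  simp only [mollify_apply, mul_add]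
  exact integral_add (integrable_normed_sub_mul b hf z) (integrable_normed_sub_mul b hg z)

/-- A product of mollifications is dominated by a mollification. -/
theorem abs_mollify_mul_abs_mollify_le {H₁ H₂ : F → ℝ} (hf : LocallyIntegrable f μ)
    (hg : LocallyIntegrable g μ) (h₁ : LocallyIntegrable H₁ μ) (h₂ : LocallyIntegrable H₂ μ)
    (h : ∀ y y', |f y| * |g y'| ≤ H₁ y + H₂ y') (z : F) :
    |mollify μ b f z| * |mollify μ b g z| ≤ mollify μ b H₁ z + mollify μ b H₂ z := by
  have habs : ∀ {k : F → ℝ}, LocallyIntegrable k μ → LocallyIntegrable (fun y => |k y|) μ :=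
    fun hk => hk.mono hk.aestronglyMeasurable.norm (Eventually.of_forall fun y => by simp)
  have hone := integral_normed_sub (μ := μ) b z
  have hint : Integrable (fun y => b.normed μ (z - y)) μ := by
    simpa using integrable_normed_sub_mul (f := fun _ => (1 : ℝ)) b (locallyIntegrable_const _) z
  set Mg := mollify μ b (fun y => |g y|) z with hMg
  -- The weight `b.normed μ (z - ·)` is a probability density, so averaging the hypothesis over `y'`
  -- with `y` fixed, and then over `y`, leaves the terms depending on one variable intact.
  have key : ∀ y, |f y| * Mg ≤ H₁ y + mollify μ b H₂ z := by
    intro y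
    have e1 : |f y| * Mg = ∫ y', b.normed μ (z - y') * (|f y| * |g y'|) ∂μ := by
      rw [hMg, mollify_apply, ← integral_const_mul]
      congr 1; ext y'; ring
    have e2 : H₁ y + mollify μ b H₂ z
        = ∫ y', (b.normed μ (z - y') * H₁ y + b.normed μ (z - y') * H₂ y') ∂μ := by
      rw [integral_add (hint.mul_const _) (integrable_normed_sub_mul b h₂ z),
        integral_mul_const, hone, mollify_apply, one_mul]
    rw [e1, e2]
    refine integral_mono ?_ ((hint.mul_const _).add (integrable_normed_sub_mul b h₂ z)) fun y' => ?_
    · refine ((integrable_normed_sub_mul b (habs hg) z).const_mul |f y|).congr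
        (Eventually.of_forall fun y' => ?_)
      simp only; ring
    · simp only [← mul_add]
      exact mul_le_mul_of_nonneg_left (h y y') (b.nonneg_normed _)
  calc |mollify μ b f z| * |mollify μ b g z|
      ≤ mollify μ b (fun y => |f y|) z * Mg :=
        mul_le_mul (abs_mollify_le b f z) (abs_mollify_le b g z) (abs_nonneg _)
          (mollify_nonneg b (fun y => abs_nonneg _) z)
    _ = ∫ y, b.normed μ (z - y) * (|f y| * Mg) ∂μ := by
        rw [mollify_apply, ← integral_mul_const]
        congr 1; ext y; ring
    _ ≤ ∫ y, (b.normed μ (z - y) * H₁ y + b.normed μ (z - y) * mollify μ b H₂ z) ∂μ := by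
        refine integral_mono ?_ ((integrable_normed_sub_mul b h₁ z).add (hint.mul_const _))
          fun y => ?_
        · refine ((integrable_normed_sub_mul b (habs hf) z).mul_const Mg).congr
            (Eventually.of_forall fun y' => ?_)
          simp only; ring
        · simp only [← mul_add]
          exact mul_le_mul_of_nonneg_left (key y) (b.nonneg_normed _)
    _ = mollify μ b H₁ z + mollify μ b H₂ z := by
        rw [integral_add (integrable_normed_sub_mul b h₁ z) (hint.mul_const _),
          integral_mul_const, hone, one_mul, ← mollify_apply]

theorem tsupport_normed_sub_subset (z : F) :
    (tsupport fun y => b.normed μ (z - y)) ⊆ Metric.closedBall z b.rOut := by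
  refine closure_minimal (fun y hy => ?_) Metric.isClosed_closedBall
  have : z - y ∈ Function.support (b.normed μ) := hy
  rw [b.support_normed_eq, mem_ball_zero_iff] at this
  rw [mem_closedBall_iff_norm, norm_sub_rev]
  exact this.le

/-- The reflection `y ↦ z - y` produces the sign. This turns an integral identity tested with a
reflected bump into a pointwise identity between derivatives of mollifications at `z`. -/
theorem integral_mul_fderiv_normed_sub (hf : LocallyIntegrable f μ) (z v : F) :
    ∫ y, f y * fderiv ℝ (fun y => b.normed μ (z - y)) y v ∂μ = - fderiv ℝ (mollify μ b f) z v := by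
  rw [fderiv_mollify_apply b hf, ← integral_neg]
  congr 1; ext y
  rw [fderiv_normed_sub]; ring

end Mollification

/-- A variant of dominated convergence, with convergent dominating functions. -/
theorem tendsto_integral_of_dominated_seq {α : Type*} [MeasurableSpace α] {μ : Measure α}
    {f : ℕ → α → ℝ} {f₀ : α → ℝ} {h : ℕ → α → ℝ} {h₀ : α → ℝ}
    (hfm : ∀ n, AEStronglyMeasurable (f n) μ) (hh : ∀ n, Integrable (h n) μ)
    (hh₀ : Integrable h₀ μ) (hle : ∀ n, ∀ᵐ x ∂μ, |f n x| ≤ h n x)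
    (hf : ∀ᵐ x ∂μ, Tendsto (fun n => f n x) atTop (𝓝 (f₀ x)))
    (hlim : ∀ᵐ x ∂μ, Tendsto (fun n => h n x) atTop (𝓝 (h₀ x)))
    (hint : Tendsto (fun n => ∫ x, h n x ∂μ) atTop (𝓝 (∫ x, h₀ x ∂μ))) :
    Integrable f₀ μ ∧ Tendsto (fun n => ∫ x, f n x ∂μ) atTop (𝓝 (∫ x, f₀ x ∂μ)) := by
  have hle' := ae_all_iff.2 hle
  have hf₀m : AEStronglyMeasurable f₀ μ := aestronglyMeasurable_of_tendsto_ae atTop hfm hf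
  have hf₀le : ∀ᵐ x ∂μ, |f₀ x| ≤ h₀ x := by
    filter_upwards [hle', hf, hlim] with x h1 h2 h3
    exact le_of_tendsto_of_tendsto' h2.abs h3 h1
  have hf₀ : Integrable f₀ μ := hh₀.mono' hf₀m hf₀le
  have hfi : ∀ n, Integrable (f n) μ := fun n => (hh n).mono' (hfm n) (hle n)
  refine ⟨hf₀, ?_⟩
  have hA : Tendsto (fun n => ∫ x, min |f n x - f₀ x| (2 * h₀ x) ∂μ) atTop (𝓝 (∫ _, (0 : ℝ) ∂μ)) := by
    refine tendsto_integral_of_dominated_convergence (fun x => 2 * h₀ x)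
      (fun n => (((hfm n).sub hf₀m).norm).inf (hh₀.aestronglyMeasurable.const_mul 2))
      (hh₀.const_mul 2) (fun n => ?_) ?_
    · filter_upwards [hf₀le] with x hx
      have h0 : 0 ≤ h₀ x := (abs_nonneg _).trans hx
      rw [Real.norm_eq_abs, abs_of_nonneg (le_min (abs_nonneg _) (by positivity))]
      exact min_le_right _ _
    · filter_upwards [hf, hf₀le] with x hx hx'
      have h0 : 0 ≤ h₀ x := (abs_nonneg _).trans hx'
      have := (((hx.sub_const (f₀ x)).abs).min (tendsto_const_nhds (x := 2 * h₀ x)))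
      simpa [h0] using this
  have hB : Tendsto (fun n => ∫ x, max (h₀ x - h n x) 0 ∂μ) atTop (𝓝 (∫ _, (0 : ℝ) ∂μ)) := by
    refine tendsto_integral_of_dominated_convergence h₀
      (fun n => (hh₀.sub (hh n)).aestronglyMeasurable.sup aestronglyMeasurable_const)
      hh₀ (fun n => ?_) ?_
    · filter_upwards [hf₀le, hle n] with x hx hx'
      have h0 : 0 ≤ h₀ x := (abs_nonneg _).trans hx
      have h1 : 0 ≤ h n x := (abs_nonneg _).trans hx'
      rw [Real.norm_eq_abs, abs_of_nonneg (le_max_right _ _)]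
      exact max_le (by linarith) h0
    · filter_upwards [hlim] with x hx
      have := ((tendsto_const_nhds (x := h₀ x)).sub hx).max (tendsto_const_nhds (x := (0 : ℝ)))
      simpa using this
  -- Pointwise, `|f n - f₀|` exceeds its truncation at `2 * h₀` by at most `(h n - h₀)_+`, because
  -- `|f n - f₀| ≤ h n + h₀`. This positive part is written as `(h n - h₀) + (h₀ - h n)_+`: the
  -- first term has integral tending to `0` by hypothesis, the second is dominated by `h₀`.
  have hbound : ∀ n, |∫ x, f n x ∂μ - ∫ x, f₀ x ∂μ| ≤
      (∫ x, min |f n x - f₀ x| (2 * h₀ x) ∂μ) +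
        ((∫ x, h n x ∂μ - ∫ x, h₀ x ∂μ) + ∫ x, max (h₀ x - h n x) 0 ∂μ) := by
    intro n
    have i1 : Integrable (fun x => min |f n x - f₀ x| (2 * h₀ x)) μ :=
      ((hfi n).sub hf₀).abs.inf (hh₀.const_mul 2)
    have i2 : Integrable (fun x => max (h₀ x - h n x) 0) μ :=
      (hh₀.sub (hh n)).sup (integrable_zero _ _ _)
    have i3 : Integrable (fun x => h n x - h₀ x) μ := (hh n).sub hh₀
    have i4 : Integrable (fun x => (h n x - h₀ x) + max (h₀ x - h n x) 0) μ := i3.add i2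
    rw [← integral_sub (hfi n) hf₀, ← integral_sub (hh n) hh₀, ← integral_add i3 i2,
      ← integral_add i1 i4]
    refine abs_integral_le_integral_abs.trans (integral_mono_ae ((hfi n).sub hf₀).abs
      (i1.add i4) ?_)
    filter_upwards [hle n, hf₀le] with x h1 h2
    have h3 : |f n x - f₀ x| ≤ h n x + h₀ x := (abs_sub _ _).trans (add_le_add h1 h2)
    rcases le_total |f n x - f₀ x| (2 * h₀ x) with h4 | h4
    · rw [min_eq_left h4]
      have := le_max_left (h₀ x - h n x) 0
      linarith
    · rw [min_eq_right h4]
      have := le_max_right (h₀ x - h n x) 0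
      linarith
  rw [tendsto_iff_dist_tendsto_zero]
  refine squeeze_zero (fun _ => dist_nonneg) (hbound) ?_
  have := hA.add ((hint.sub_const (∫ x, h₀ x ∂μ)).add hB)
  simpa using this

theorem exists_bound_of_hasCompactSupport {F : Type*} [NormedAddCommGroup F] {φ : F → ℝ} (hφ : Continuous φ)
    (hc : HasCompactSupport φ) : ∃ C, 0 ≤ C ∧ ∀ z, |φ z| ≤ C := by
  obtain ⟨C, hC⟩ := hφ.bounded_above_of_compact_support hc
  exact ⟨C, (norm_nonneg _).trans (hC 0), hC⟩

/-! ### Derivatives of test functions; shrinking bumps -/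

section SmoothFunctions

variable {F : Type*} [NormedAddCommGroup F] [NormedSpace ℝ F]

theorem continuous_fderiv_apply {φ : F → ℝ} (hφ : ContDiff ℝ ∞ φ) (v : F) :
    Continuous fun z => fderiv ℝ φ z v :=
  (hφ.continuous_fderiv (by simp)).clm_apply continuous_const

theorem hasCompactSupport_fderiv_apply {φ : F → ℝ} (hc : HasCompactSupport φ) (v : F) :
    HasCompactSupport fun z => fderiv ℝ φ z v :=
  (hc.fderiv ℝ).comp_left (g := fun L : F →L[ℝ] ℝ => L v) rfl

variable [FiniteDimensional ℝ F]

/-- A sequence of bump functions whose supports shrink to the origin. -/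
noncomputable def bumpSeq (F : Type*) [NormedAddCommGroup F] [NormedSpace ℝ F]
    [FiniteDimensional ℝ F] (n : ℕ) : ContDiffBump (0 : F) where
  rIn := 1 / (n + 1)
  rOut := 2 / (n + 1)
  rIn_pos := by positivity
  rIn_lt_rOut := by gcongr; norm_num

theorem tendsto_bumpSeq_rOut :
    Tendsto (fun n => (bumpSeq F n).rOut) atTop (𝓝 0) := by
  have h := (tendsto_one_div_add_atTop_nhds_zero_nat (𝕜 := ℝ)).const_mul 2
  simp only [mul_zero] at h
  refine h.congr fun n => ?_
  simp only [bumpSeq]; ring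

theorem eventually_closedBall_subset {K U : Set F} (hK : IsCompact K) (hU : IsOpen U)
    (hKU : K ⊆ U) : ∀ᶠ n in atTop, ∀ z ∈ K, Metric.closedBall z (bumpSeq F n).rOut ⊆ U := by
  obtain ⟨δ, hδ, h⟩ := hK.exists_cthickening_subset_open hU hKU
  filter_upwards [(tendsto_bumpSeq_rOut (F := F)).eventually (Iio_mem_nhds hδ)] with n hn z hz
  exact (Metric.closedBall_subset_closedBall (le_of_lt hn)).trans
    ((Metric.closedBall_subset_cthickening hz δ).trans h)

end SmoothFunctions

/-! ### Weak derivatives, the chain rule and the energy identity -/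

section WeakDerivatives

variable {F : Type*} [NormedAddCommGroup F] [NormedSpace ℝ F] [FiniteDimensional ℝ F]
  [MeasurableSpace F] [BorelSpace F] {μ : Measure F} [μ.IsAddHaarMeasure]

/-- Convergence at Lebesgue points: the ratio of the outer to the inner radius stays equal to `2`,
so the bumps are comparable to averages over balls. -/
theorem ae_tendsto_mollify {f : F → ℝ} (hf : LocallyIntegrable f μ) :
    ∀ᵐ z ∂μ, Tendsto (fun n => mollify μ (bumpSeq F n) f z) atTop (𝓝 (f z)) :=
  ContDiffBump.ae_convolution_tendsto_right_of_locallyIntegrable (K := 2) tendsto_bumpSeq_rOut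
    (Eventually.of_forall fun n => le_of_eq (by simp only [bumpSeq]; ring)) hf

/-- The majorants move with `n`, but they converge a.e. to `C * h` and mollification preserves the
integral, which is all that `tendsto_integral_of_dominated_seq` asks of them. -/
theorem tendsto_integral_of_dominated_mollify {f : ℕ → F → ℝ} {f₀ h : F → ℝ} {C : ℝ}
    (hfm : ∀ n, Continuous (f n)) (hh : Integrable h μ)
    (hle : ∀ n z, |f n z| ≤ C * mollify μ (bumpSeq F n) h z)
    (hf : ∀ᵐ z ∂μ, Tendsto (fun n => f n z) atTop (𝓝 (f₀ z))) :
    Integrable f₀ μ ∧ Tendsto (fun n => ∫ z, f n z ∂μ) atTop (𝓝 (∫ z, f₀ z ∂μ)) := by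
  refine tendsto_integral_of_dominated_seq (fun n => (hfm n).aestronglyMeasurable)
    (fun n => (integrable_mollify _ hh).const_mul C) (hh.const_mul C)
    (fun n => Eventually.of_forall (hle n)) hf ?_ ?_
  · filter_upwards [ae_tendsto_mollify hh.locallyIntegrable] with z hz
    exact hz.const_mul C
  · simp only [integral_const_mul, integral_mollify _ hh]
    exact tendsto_const_nhds

/-- Integration by parts against a test function. -/
theorem integral_mul_fderiv_of_hasCompactSupport {f φ : F → ℝ} (hf : ContDiff ℝ 1 f)
    (hφ : ContDiff ℝ 1 φ) (hc : HasCompactSupport φ) (v : F) :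
    ∫ z, f z * fderiv ℝ φ z v ∂μ = - ∫ z, fderiv ℝ f z v * φ z ∂μ := by
  have c1 : ∀ {g : F → ℝ}, ContDiff ℝ 1 g → Continuous fun z => fderiv ℝ g z v :=
    fun hg => (hg.continuous_fderiv one_ne_zero).clm_apply continuous_const
  refine integral_mul_fderiv_eq_neg_fderiv_mul_of_integrable ?_ ?_ ?_
    (fun z _ => (hf.differentiable one_ne_zero) z) (fun z _ => (hφ.differentiable one_ne_zero) z)
  · exact ((c1 hf).mul hφ.continuous).integrable_of_hasCompactSupport hc.mul_left
  · exact (hf.continuous.mul (c1 hφ)).integrable_of_hasCompactSupport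
      (hasCompactSupport_fderiv_apply hc v).mul_left
  · exact (hf.continuous.mul hφ.continuous).integrable_of_hasCompactSupport hc.mul_left

/-- `g` is the weak derivative of `f` in the direction `v`, in the open set `U`. -/
def IsWeakDerivOn (μ : Measure F) (U : Set F) (v : F) (f g : F → ℝ) : Prop :=
  ∀ φ : F → ℝ, ContDiff ℝ ∞ φ → HasCompactSupport φ → tsupport φ ⊆ U →
    ∫ z, f z * fderiv ℝ φ z v ∂μ = - ∫ z, g z * φ z ∂μ

/-- The reflected bump centred at `z` is an admissible test function as soon as the closed ball
carrying its support lies in `U`. -/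
theorem IsWeakDerivOn.fderiv_mollify {U : Set F} {v : F} {f g : F → ℝ}
    (h : IsWeakDerivOn μ U v f g) (hf : LocallyIntegrable f μ) (b : ContDiffBump (0 : F)) {z : F}
    (hz : Metric.closedBall z b.rOut ⊆ U) :
    fderiv ℝ (mollify μ b f) z v = mollify μ b g z := by
  have h1 := h (fun y => b.normed μ (z - y)) (contDiff_normed_sub b z)
    (hasCompactSupport_normed_sub b z) ((tsupport_normed_sub_subset b z).trans hz)
  rw [integral_mul_fderiv_normed_sub b hf] at h1
  rw [mollify_apply, neg_injective h1]
  congr 1; ext y; ring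

/-- The chain rule for weak derivatives. -/
theorem IsWeakDerivOn.comp {U : Set F} {v : F} {f g : F → ℝ} (h : IsWeakDerivOn μ U v f g)
    (hf : Integrable f μ) (hg : Integrable g μ) {H γ : ℝ → ℝ} (hH : ∀ s, HasDerivAt H (γ s) s)
    (hγ : Continuous γ) (hγ1 : ∀ s, |γ s| ≤ 1) (hH1 : ∀ s, |H s| ≤ |s|) (hU : IsOpen U) :
    IsWeakDerivOn μ U v (fun z => H (f z)) (fun z => γ (f z) * g z) := by
  intro φ hφ hc hs
  have hHc : Continuous H := continuous_iff_continuousAt.2 fun s => (hH s).continuousAt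
  have hH1' : ContDiff ℝ 1 H := by
    rw [contDiff_one_iff_deriv]
    refine ⟨fun s => (hH s).differentiableAt, ?_⟩
    rwa [show deriv H = γ from funext fun s => (hH s).deriv]
  obtain ⟨C, hC0, hC⟩ := exists_bound_of_hasCompactSupport hφ.continuous hc
  obtain ⟨D, hD0, hD⟩ := exists_bound_of_hasCompactSupport (continuous_fderiv_apply hφ v)
    (hasCompactSupport_fderiv_apply hc v)
  set u : ℕ → F → ℝ := fun n => mollify μ (bumpSeq F n) f with hu
  set w : ℕ → F → ℝ := fun n => mollify μ (bumpSeq F n) g with hw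
  have hus : ∀ n, ContDiff ℝ ∞ (u n) := fun n => contDiff_mollify _ hf.locallyIntegrable
  have hws : ∀ n, ContDiff ℝ ∞ (w n) := fun n => contDiff_mollify _ hg.locallyIntegrable
  have cφ := hφ.continuous
  have cdφ := continuous_fderiv_apply hφ v
  -- Both sides of the identity are combined in a single integrand. For mollified functions its
  -- integral vanishes by the classical chain rule, once the balls around the support of `φ` fit in
  -- `U`.
  have lim := tendsto_integral_of_dominated_mollify (μ := μ)
    (f := fun n z => H (u n z) * fderiv ℝ φ z v + γ (u n z) * w n z * φ z)
    (f₀ := fun z => H (f z) * fderiv ℝ φ z v + γ (f z) * g z * φ z)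
    (h := fun y => |f y| + |g y|) (C := C + D)
    (fun n => by
      have := (hus n).continuous
      have := (hws n).continuous
      fun_prop)
    (hf.abs.add hg.abs) ?_ ?_
  · have hev : ∀ᶠ n in atTop,
        ∫ z, (H (u n z) * fderiv ℝ φ z v + γ (u n z) * w n z * φ z) ∂μ = 0 := by
      filter_upwards [eventually_closedBall_subset hc hU hs] with n hn
      have c1 := (hus n).continuous
      have c2 := (hws n).continuous
      have hcomp : ContDiff ℝ 1 fun z => H (u n z) := hH1'.comp ((hus n).of_le (by norm_cast))
      have e := integral_mul_fderiv_of_hasCompactSupport (μ := μ) hcomp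
        (hφ.of_le (by norm_cast)) hc v
      rw [integral_add, e, neg_add_eq_zero]
      · refine integral_congr_ae (Eventually.of_forall fun z => ?_)
        by_cases hz : z ∈ tsupport φ
        · have h1 : HasFDerivAt (fun z => H (u n z)) (γ (u n z) • fderiv ℝ (u n) z) z :=
            (hH (u n z)).comp_hasFDerivAt z ((hus n).differentiable (by simp) z).hasFDerivAt
          simp only [h1.fderiv, hw, ← h.fderiv_mollify hf.locallyIntegrable _ (hn z hz)]
          simp [hu]
        · simp [image_eq_zero_of_notMem_tsupport hz]
      · exact Continuous.integrable_of_hasCompactSupport (by fun_prop)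
          (hasCompactSupport_fderiv_apply hc v).mul_left
      · exact Continuous.integrable_of_hasCompactSupport (by fun_prop) hc.mul_left
    have h0 := tendsto_nhds_unique lim.2 (tendsto_const_nhds.congr' (hev.mono fun n hn => hn.symm))
    have i1 : Integrable (fun z => γ (f z) * g z * φ z) μ := by
      have : Integrable (fun z => (γ (f z) * φ z) * g z) μ := by
        refine hg.bdd_mul (c := C) ((hγ.comp_aestronglyMeasurable hf.1).mul
          cφ.aestronglyMeasurable) (Eventually.of_forall fun z => ?_)
        rw [Real.norm_eq_abs, abs_mul]
        nlinarith [hγ1 (f z), hC z, abs_nonneg (γ (f z)), abs_nonneg (φ z)]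
      refine this.congr (Eventually.of_forall fun z => ?_)
      simp only; ring
    have i2 : Integrable (fun z => H (f z) * fderiv ℝ φ z v) μ := by
      refine (lim.1.sub i1).congr (Eventually.of_forall fun z => ?_)
      simp
    rw [integral_add i2 i1] at h0
    linarith
  · intro n z
    have a1 : |u n z| ≤ mollify μ (bumpSeq F n) (fun y => |f y|) z := abs_mollify_le _ _ _
    have a2 : |w n z| ≤ mollify μ (bumpSeq F n) (fun y => |g y|) z := abs_mollify_le _ _ _
    rw [mollify_add _ hf.abs.locallyIntegrable hg.abs.locallyIntegrable]
    have b1 : |H (u n z) * fderiv ℝ φ z v| ≤ D * |u n z| := by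
      rw [abs_mul, mul_comm]
      exact mul_le_mul (hD z) (hH1 _) (abs_nonneg _) hD0
    have b2 : |γ (u n z) * w n z * φ z| ≤ C * |w n z| := by
      rw [abs_mul, abs_mul, mul_comm]
      refine mul_le_mul (hC z) ?_ (by positivity) hC0
      exact mul_le_of_le_one_left (abs_nonneg _) (hγ1 _)
    refine (abs_add_le _ _).trans ((add_le_add b1 b2).trans ?_)
    nlinarith [abs_nonneg (u n z), abs_nonneg (w n z)]
  · filter_upwards [ae_tendsto_mollify hf.locallyIntegrable, ae_tendsto_mollify hg.locallyIntegrable]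
      with z h1 h2
    exact (((hHc.tendsto _).comp h1).mul_const _).add ((((hγ.tendsto _).comp h1).mul h2).mul_const _)

/-- The energy identity of a weak solution of `∂_τ f = ∑ ∂_{e i} (a i)`, tested with `G'(f) φ`. -/
theorem integral_energy_identity {ι : Type*} [Fintype ι] {U : Set F} (hU : IsOpen U) {τ : F}
    {e : ι → F} {f h : F → ℝ} {w a : ι → F → ℝ} (hf : Integrable f μ)
    (hw : ∀ i, Integrable (w i) μ) (ha : ∀ i, Integrable (a i) μ) (hh : Integrable h μ)
    (hff : ∀ y y', |f y| * |f y'| ≤ h y + h y')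
    (haw : ∀ i y y', |a i y| * |w i y'| ≤ h y + h y')
    (haf : ∀ i y y', |a i y| * |f y'| ≤ h y + h y')
    (hgrad : ∀ i, IsWeakDerivOn μ U (e i) f (w i))
    (heq : ∀ φ : F → ℝ, ContDiff ℝ ∞ φ → HasCompactSupport φ → tsupport φ ⊆ U →
      ∫ z, f z * fderiv ℝ φ z τ ∂μ = ∑ i, ∫ z, a i z * fderiv ℝ φ z (e i) ∂μ)
    {G G₁ γ : ℝ → ℝ} (hG : ∀ s, HasDerivAt G (G₁ s) s) (hG₁ : ∀ s, HasDerivAt G₁ (γ s) s)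
    (hγ : Continuous γ) (hγ1 : ∀ s, |γ s| ≤ 1) (hG₁1 : ∀ s, |G₁ s| ≤ |s|)
    (hG1 : ∀ s, |G s| ≤ |s| * |s|) {φ : F → ℝ} (hφ : ContDiff ℝ ∞ φ) (hc : HasCompactSupport φ)
    (hs : tsupport φ ⊆ U) :
    Integrable (fun z => G (f z) * fderiv ℝ φ z τ -
      ∑ i, a i z * (γ (f z) * w i z * φ z + G₁ (f z) * fderiv ℝ φ z (e i))) μ ∧
    ∫ z, (G (f z) * fderiv ℝ φ z τ -
      ∑ i, a i z * (γ (f z) * w i z * φ z + G₁ (f z) * fderiv ℝ φ z (e i))) ∂μ = 0 := by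
  have hGc : Continuous G := continuous_iff_continuousAt.2 fun s => (hG s).continuousAt
  have hG₁c : Continuous G₁ := continuous_iff_continuousAt.2 fun s => (hG₁ s).continuousAt
  have hG₁d : ContDiff ℝ 1 G₁ := by
    rw [contDiff_one_iff_deriv]
    refine ⟨fun s => (hG₁ s).differentiableAt, ?_⟩
    rwa [show deriv G₁ = γ from funext fun s => (hG₁ s).deriv]
  have hGd : ContDiff ℝ 1 G := by
    rw [contDiff_one_iff_deriv]
    refine ⟨fun s => (hG s).differentiableAt, ?_⟩
    rwa [show deriv G = G₁ from funext fun s => (hG s).deriv]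
  obtain ⟨C, hC0, hC⟩ := exists_bound_of_hasCompactSupport hφ.continuous hc
  obtain ⟨Dt, hDt0, hDt⟩ := exists_bound_of_hasCompactSupport (continuous_fderiv_apply hφ τ)
    (hasCompactSupport_fderiv_apply hc τ)
  choose D hD0 hD using fun i => exists_bound_of_hasCompactSupport
    (continuous_fderiv_apply hφ (e i)) (hasCompactSupport_fderiv_apply hc (e i))
  set u : ℕ → F → ℝ := fun n => mollify μ (bumpSeq F n) f with hu
  set v : ι → ℕ → F → ℝ := fun i n => mollify μ (bumpSeq F n) (w i) with hv
  set b : ι → ℕ → F → ℝ := fun i n => mollify μ (bumpSeq F n) (a i) with hb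
  have lf := hf.locallyIntegrable
  have lw := fun i => (hw i).locallyIntegrable
  have la := fun i => (ha i).locallyIntegrable
  have lh := hh.locallyIntegrable
  have hus : ∀ n, ContDiff ℝ ∞ (u n) := fun n => contDiff_mollify _ lf
  have hvs : ∀ i n, ContDiff ℝ ∞ (v i n) := fun i n => contDiff_mollify _ (lw i)
  have hbs : ∀ i n, ContDiff ℝ ∞ (b i n) := fun i n => contDiff_mollify _ (la i)
  have cφ := hφ.continuous
  have cτ := continuous_fderiv_apply hφ τ
  have ce := fun i => continuous_fderiv_apply hφ (e i)
  have lim := tendsto_integral_of_dominated_mollify (μ := μ)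
    (f := fun n z => G (u n z) * fderiv ℝ φ z τ -
      ∑ i, b i n z * (γ (u n z) * v i n z * φ z + G₁ (u n z) * fderiv ℝ φ z (e i)))
    (f₀ := fun z => G (f z) * fderiv ℝ φ z τ -
      ∑ i, a i z * (γ (f z) * w i z * φ z + G₁ (f z) * fderiv ℝ φ z (e i)))
    (h := h) (C := 2 * (Dt + ∑ i, (C + D i)))
    (fun n => by
      have := (hus n).continuous
      have := fun i => (hvs i n).continuous
      have := fun i => (hbs i n).continuous
      fun_prop)
    hh ?_ ?_
  · refine ⟨lim.1, tendsto_nhds_unique lim.2 (tendsto_const_nhds.congr' ?_)⟩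
    filter_upwards [eventually_closedBall_subset hc hU hs] with n hn
    have c1 := (hus n).continuous
    have c2 := fun i => (hvs i n).continuous
    have c3 := fun i => (hbs i n).continuous
    have u1 : ContDiff ℝ 1 (u n) := (hus n).of_le (by norm_cast)
    have φ1 : ContDiff ℝ 1 φ := hφ.of_le (by norm_cast)
    have b1 : ∀ i, ContDiff ℝ 1 (b i n) := fun i => (hbs i n).of_le (by norm_cast)
    have hud : ∀ z, HasFDerivAt (u n) (fderiv ℝ (u n) z) z := fun z =>
      (u1.differentiable one_ne_zero z).hasFDerivAt
    -- The mollified equation holds in the classical sense on the support of `φ`: `heq` is tested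
    -- with the reflected bump at `z`.
    have eqn : ∀ z ∈ tsupport φ, fderiv ℝ (u n) z τ = ∑ i, fderiv ℝ (b i n) z (e i) := by
      intro z hz
      have h1 := heq _ (contDiff_normed_sub (μ := μ) (bumpSeq F n) z)
        (hasCompactSupport_normed_sub (bumpSeq F n) z)
        ((tsupport_normed_sub_subset (bumpSeq F n) z).trans (hn z hz))
      rw [integral_mul_fderiv_normed_sub _ lf] at h1
      simp only [integral_mul_fderiv_normed_sub _ (la _), Finset.sum_neg_distrib] at h1
      exact neg_injective h1
    have hψ1 : ContDiff ℝ 1 fun z => G₁ (u n z) * φ z := (hG₁d.comp u1).mul φ1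
    have hψc : HasCompactSupport fun z => G₁ (u n z) * φ z := hc.mul_left
    have s1 := integral_mul_fderiv_of_hasCompactSupport (μ := μ) (hGd.comp u1) φ1 hc τ
    have s2 := fun i => integral_mul_fderiv_of_hasCompactSupport (μ := μ) (b1 i) hψ1 hψc (e i)
    have d1 : ∀ z, fderiv ℝ (G ∘ u n) z τ = G₁ (u n z) * fderiv ℝ (u n) z τ := fun z => by
      have : HasFDerivAt (G ∘ u n) (G₁ (u n z) • fderiv ℝ (u n) z) z :=
        (hG (u n z)).comp_hasFDerivAt z (hud z)
      simp [this.fderiv]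
    -- Off the support of `φ` the mollified weak gradient need not be the gradient of `u n`, but
    -- there both sides vanish.
    have d2 : ∀ i, ∀ z, b i n z * (γ (u n z) * v i n z * φ z + G₁ (u n z) * fderiv ℝ φ z (e i))
        = b i n z * fderiv ℝ (fun z => G₁ (u n z) * φ z) z (e i) := by
      intro i z
      by_cases hz : z ∈ tsupport φ
      · have h1 : HasFDerivAt (fun z => G₁ (u n z)) (γ (u n z) • fderiv ℝ (u n) z) z :=
          (hG₁ (u n z)).comp_hasFDerivAt z (hud z)
        have h2 := h1.mul (φ1.differentiable one_ne_zero z).hasFDerivAt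
        have h2' : fderiv ℝ (fun z => G₁ (u n z) * φ z) z = _ := h2.fderiv
        rw [h2']
        simp only [hv, ← (hgrad i).fderiv_mollify lf _ (hn z hz)]
        simp [hu]
        left; ring
      · have h2 : z ∉ tsupport fun z => G₁ (u n z) * φ z := fun h => hz (tsupport_mul_subset_right h)
        have h3 := fderiv_of_notMem_tsupport (𝕜 := ℝ) h2
        have h4 := fderiv_of_notMem_tsupport (𝕜 := ℝ) hz
        rw [h3, h4, image_eq_zero_of_notMem_tsupport hz]
        simp
    simp only [d2]
    have cψ : ∀ i, Continuous fun z => fderiv ℝ (fun z => G₁ (u n z) * φ z) z (e i) := fun i =>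
      (hψ1.continuous_fderiv one_ne_zero).clm_apply continuous_const
    have int2 : ∀ i, Integrable
        (fun z => b i n z * fderiv ℝ (fun z => G₁ (u n z) * φ z) z (e i)) μ := fun i =>
      ((c3 i).mul (cψ i)).integrable_of_hasCompactSupport
        (hasCompactSupport_fderiv_apply hψc (e i)).mul_left
    have cb : ∀ i, Continuous fun z => fderiv ℝ (b i n) z (e i) := fun i =>
      ((b1 i).continuous_fderiv one_ne_zero).clm_apply continuous_const
    rw [integral_sub, integral_finsetSum _ fun i _ => int2 i]
    · simp only [Function.comp_apply] at s1
      rw [s1]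
      simp only [s2, Finset.sum_neg_distrib]
      rw [← integral_finsetSum, neg_sub_neg, eq_comm, sub_eq_zero]
      · refine integral_congr_ae (Eventually.of_forall fun z => ?_)
        by_cases hz : z ∈ tsupport φ
        · have := d1 z
          simp only [this, eqn z hz, Finset.mul_sum, Finset.sum_mul]
          refine Finset.sum_congr rfl fun i _ => ?_
          ring
        · simp [image_eq_zero_of_notMem_tsupport hz]
      · intro i _
        exact ((cb i).mul (by fun_prop)).integrable_of_hasCompactSupport hψc.mul_left
    · exact Continuous.integrable_of_hasCompactSupport (by fun_prop)
          (hasCompactSupport_fderiv_apply hc τ).mul_left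
    · exact integrable_finsetSum _ fun i _ => int2 i
  · intro n z
    -- Every product in the integrand pairs two mollifications whose factors satisfy a separated
    -- bound by `h`; the test function and `γ` contribute only bounded factors.
    have m : ∀ f₁ f₂ : F → ℝ, LocallyIntegrable f₁ μ → LocallyIntegrable f₂ μ →
        (∀ y y', |f₁ y| * |f₂ y'| ≤ h y + h y') →
        |mollify μ (bumpSeq F n) f₁ z| * |mollify μ (bumpSeq F n) f₂ z| ≤
          2 * mollify μ (bumpSeq F n) h z := fun f₁ f₂ h1 h2 h3 =>
      (abs_mollify_mul_abs_mollify_le _ h1 h2 lh lh h3 z).trans_eq (by ring)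
    have mf := m f f lf lf hff
    have maw := fun i => m (a i) (w i) (la i) (lw i) (haw i)
    have maf := fun i => m (a i) f (la i) lf (haf i)
    have t1 : |G (u n z) * fderiv ℝ φ z τ| ≤ Dt * (2 * mollify μ (bumpSeq F n) h z) := by
      rw [abs_mul, mul_comm]
      exact mul_le_mul (hDt z) ((hG1 _).trans mf) (abs_nonneg _) hDt0
    have t2 : ∀ i, |b i n z * (γ (u n z) * v i n z * φ z + G₁ (u n z) * fderiv ℝ φ z (e i))| ≤
        (C + D i) * (2 * mollify μ (bumpSeq F n) h z) := by
      intro i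
      rw [mul_add, add_mul]
      refine (abs_add_le _ _).trans (add_le_add ?_ ?_)
      · calc |b i n z * (γ (u n z) * v i n z * φ z)|
            = |φ z| * (|γ (u n z)| * (|b i n z| * |v i n z|)) := by
              simp only [abs_mul]; ring
          _ ≤ C * (2 * mollify μ (bumpSeq F n) h z) :=
              mul_le_mul (hC z) ((mul_le_of_le_one_left (by positivity) (hγ1 _)).trans (maw i))
                (by positivity) hC0
      · calc |b i n z * (G₁ (u n z) * fderiv ℝ φ z (e i))|
            = |fderiv ℝ φ z (e i)| * (|b i n z| * |G₁ (u n z)|) := by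
              simp only [abs_mul]; ring
          _ ≤ D i * (2 * mollify μ (bumpSeq F n) h z) :=
              mul_le_mul (hD i z)
                ((mul_le_mul_of_nonneg_left (hG₁1 _) (abs_nonneg _)).trans (maf i))
                (by positivity) (hD0 i)
    calc |_| ≤ _ := abs_sub _ _
      _ ≤ Dt * (2 * mollify μ (bumpSeq F n) h z) +
          ∑ i, (C + D i) * (2 * mollify μ (bumpSeq F n) h z) :=
        add_le_add t1 ((Finset.abs_sum_le_sum_abs _ _).trans (Finset.sum_le_sum fun i _ => t2 i))
      _ = 2 * (Dt + ∑ i, (C + D i)) * mollify μ (bumpSeq F n) h z := by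
        rw [← Finset.sum_mul]; ring
  · have hwt := ae_all_iff.2 fun i => ae_tendsto_mollify (lw i)
    have hat := ae_all_iff.2 fun i => ae_tendsto_mollify (la i)
    filter_upwards [ae_tendsto_mollify lf, hwt, hat] with z h1 h2 h3
    refine (((hGc.tendsto _).comp h1).mul_const _).sub (tendsto_finsetSum _ fun i _ => ?_)
    exact (h3 i).mul (((((hγ.tendsto _).comp h1).mul (h2 i)).mul_const _).add
      (((hG₁c.tendsto _).comp h1).mul_const _))

end WeakDerivatives

/-! ### Energy densities and their primitives; ramps -/

section Primitives

/-- The primitive of `γ` vanishing at `0`. -/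
noncomputable def prim (γ : ℝ → ℝ) (s : ℝ) : ℝ := ∫ x in (0 : ℝ)..s, γ x

theorem hasDerivAt_prim {γ : ℝ → ℝ} (hγ : Continuous γ) (s : ℝ) : HasDerivAt (prim γ) (γ s) s :=
  intervalIntegral.integral_hasDerivAt_right (hγ.intervalIntegrable _ _)
    (hγ.stronglyMeasurableAtFilter _ _) hγ.continuousAt

theorem continuous_prim {γ : ℝ → ℝ} (hγ : Continuous γ) : Continuous (prim γ) :=
  continuous_iff_continuousAt.2 fun s => (hasDerivAt_prim hγ s).continuousAt

theorem abs_prim_le {γ : ℝ → ℝ} {s C : ℝ} (h : ∀ x, |x| ≤ |s| → |γ x| ≤ C) :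
    |prim γ s| ≤ C * |s| := by
  have := intervalIntegral.norm_integral_le_of_norm_le_const (a := 0) (b := s) (f := γ) (C := C) ?_
  · simpa [prim] using this
  · intro x hx
    refine h x ?_
    rcases le_total 0 s with h0 | h0
    · rw [uIoc_of_le h0] at hx
      rw [abs_of_pos hx.1, abs_of_nonneg h0]; exact hx.2
    · rw [uIoc_of_ge h0] at hx
      rw [abs_of_nonpos hx.2, abs_of_nonpos h0]; linarith [hx.1]

theorem prim_nonneg {γ : ℝ → ℝ} {s : ℝ} (hs : 0 ≤ s) (h : ∀ x, 0 ≤ x → 0 ≤ γ x) :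
    0 ≤ prim γ s :=
  intervalIntegral.integral_nonneg hs fun x hx => h x hx.1

theorem prim_nonpos {γ : ℝ → ℝ} {s : ℝ} (hs : s ≤ 0) (h : ∀ x, x ≤ 0 → 0 ≤ γ x) :
    prim γ s ≤ 0 := by
  rw [prim, intervalIntegral.integral_symm]
  exact neg_nonpos.2 (intervalIntegral.integral_nonneg hs fun x hx => h x hx.2)

theorem tendsto_prim {γ : ℕ → ℝ → ℝ} {γ₀ g : ℝ → ℝ} (hγ : ∀ n, Continuous (γ n))
    (hle : ∀ n x, |γ n x| ≤ g x) (hg : Continuous g)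
    (h : ∀ x, Tendsto (fun n => γ n x) atTop (𝓝 (γ₀ x))) (s : ℝ) :
    Tendsto (fun n => prim (γ n) s) atTop (𝓝 (prim γ₀ s)) :=
  intervalIntegral.tendsto_integral_filter_of_dominated_convergence g
    (Eventually.of_forall fun n => (hγ n).aestronglyMeasurable)
    (Eventually.of_forall fun n => Eventually.of_forall fun x _ => hle n x)
    (hg.intervalIntegrable _ _) (Eventually.of_forall fun x _ => h x)

/-- The functions `γ = G''` for which the energy inequality is tested with `G'(u)`. -/
structure IsEnergyDensity (γ : ℝ → ℝ) : Prop where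
  continuous : Continuous γ
  nonneg : ∀ s, 0 ≤ γ s
  le_one : ∀ s, γ s ≤ 1
  abs_prim_le : ∀ s, |prim γ s| ≤ γ s * |s|

variable {γ : ℝ → ℝ}

theorem IsEnergyDensity.abs_le_one (h : IsEnergyDensity γ) (s : ℝ) : |γ s| ≤ 1 := by
  rw [abs_of_nonneg (h.nonneg s)]; exact h.le_one s

theorem IsEnergyDensity.abs_prim_le_abs (h : IsEnergyDensity γ) (s : ℝ) : |prim γ s| ≤ |s| :=
  (h.abs_prim_le s).trans (mul_le_of_le_one_left (abs_nonneg _) (h.le_one s))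

theorem IsEnergyDensity.abs_prim_prim_le (h : IsEnergyDensity γ) (s : ℝ) :
    |prim (prim γ) s| ≤ |s| * |s| :=
  AnisoCauchy.abs_prim_le fun x hx => (h.abs_prim_le_abs x).trans hx

theorem IsEnergyDensity.prim_prim_nonneg (h : IsEnergyDensity γ) (s : ℝ) :
    0 ≤ prim (prim γ) s := by
  rcases le_total 0 s with hs | hs
  · exact prim_nonneg hs fun x hx => prim_nonneg hx fun y _ => h.nonneg y
  · rw [prim, intervalIntegral.integral_symm, ← intervalIntegral.integral_neg]
    exact intervalIntegral.integral_nonneg hs fun x hx =>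
      neg_nonneg.2 (prim_nonpos hx.2 fun y _ => h.nonneg y)

/-- Mean value inequality on the segment from `b` to `a`, where the derivative is at most `|x| ≤ |a
- b| + |b|`. This form is suited to Hölder's inequality when only `a - b` is small in `L²`. -/
theorem IsEnergyDensity.abs_prim_prim_sub_le (h : IsEnergyDensity γ) (a b : ℝ) :
    |prim (prim γ) a - prim (prim γ) b| ≤ |a - b| * (|a - b| + |b|) := by
  have hc := continuous_prim h.continuous
  have := (convex_uIcc b a).norm_image_sub_le_of_norm_hasDerivWithin_le
    (f := prim (prim γ)) (f' := prim γ) (C := |a - b| + |b|)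
    (fun x _ => (hasDerivAt_prim hc x).hasDerivWithinAt) (fun x hx => ?_)
    left_mem_uIcc right_mem_uIcc
  · rw [mul_comm]; simpa using this
  · refine (h.abs_prim_le_abs x).trans ?_
    have h1 : |x - b| ≤ |a - b| := abs_sub_left_of_mem_uIcc hx
    calc |x| = |x - b + b| := by ring_nf
      _ ≤ |x - b| + |b| := abs_add_le _ _
      _ ≤ _ := by gcongr

theorem isEnergyDensity_one : IsEnergyDensity fun _ => 1 where
  continuous := continuous_const
  nonneg _ := zero_le_one
  le_one _ := le_rfl
  abs_prim_le s := by simp [prim]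

theorem prim_prim_one (s : ℝ) : prim (prim fun _ => 1) s = s ^ 2 / 2 := by
  have : (prim fun _ => 1) = fun s => s := by ext s; simp [prim]
  rw [this, prim, integral_id]; ring

/-- Continuous approximations of the indicator function of `]k, ∞[`. -/
noncomputable def ramp (k : ℝ) (n : ℕ) (s : ℝ) : ℝ := max (min (n * (s - k)) 1) 0

variable {k : ℝ}

theorem continuous_ramp (k : ℝ) (n : ℕ) : Continuous (ramp k n) := by
  unfold ramp; fun_prop

theorem ramp_nonneg (k : ℝ) (n : ℕ) (s : ℝ) : 0 ≤ ramp k n s := le_max_right _ _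

theorem ramp_le_one (k : ℝ) (n : ℕ) (s : ℝ) : ramp k n s ≤ 1 :=
  max_le (min_le_right _ _) zero_le_one

theorem abs_ramp_le_one (k : ℝ) (n : ℕ) (s : ℝ) : |ramp k n s| ≤ 1 := by
  rw [abs_of_nonneg (ramp_nonneg k n s)]; exact ramp_le_one k n s

theorem ramp_of_le {n : ℕ} {s : ℝ} (h : s ≤ k) : ramp k n s = 0 :=
  max_eq_right ((min_le_left _ _).trans
    (mul_nonpos_of_nonneg_of_nonpos (Nat.cast_nonneg _) (sub_nonpos.2 h)))

theorem monotone_ramp (k : ℝ) (n : ℕ) : Monotone (ramp k n) := fun a b hab => by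
  unfold ramp; gcongr

theorem tendsto_ramp (k s : ℝ) :
    Tendsto (fun n => ramp k n s) atTop (𝓝 ((Ioi k).indicator (fun _ => 1) s)) := by
  by_cases hs : k < s
  · rw [indicator_of_mem (mem_Ioi.2 hs)]
    refine tendsto_const_nhds.congr' ?_
    filter_upwards [(tendsto_natCast_atTop_atTop (R := ℝ)).eventually_ge_atTop (1 / (s - k))]
      with n hn
    have : 1 ≤ n * (s - k) := by rwa [div_le_iff₀ (sub_pos.2 hs)] at hn
    rw [ramp, min_eq_right this, max_eq_left zero_le_one]
  · rw [indicator_of_notMem (by simpa using hs)]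
    simp only [ramp_of_le (not_lt.1 hs)]
    exact tendsto_const_nhds

theorem prim_ramp_of_nonpos (hk : 0 ≤ k) (n : ℕ) {s : ℝ} (hs : s ≤ 0) : prim (ramp k n) s = 0 := by
  have : |prim (ramp k n) s| ≤ 0 := by
    rw [prim, intervalIntegral.integral_symm, abs_neg,
      intervalIntegral.integral_congr (g := fun _ => (0 : ℝ))]
    · simp
    · intro x hx
      rw [uIcc_of_le hs] at hx
      exact ramp_of_le (hx.2.trans hk)
  exact abs_nonpos_iff.1 this

/-- This is where `k ≥ 0` enters: the primitive vanishes for `s ≤ 0`, and for `s ≥ 0` monotonicity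
bounds the integral of the ramp over `[0, s]` by its last value times `s`. -/
theorem isEnergyDensity_ramp (hk : 0 ≤ k) (n : ℕ) : IsEnergyDensity (ramp k n) where
  continuous := continuous_ramp k n
  nonneg := ramp_nonneg k n
  le_one := ramp_le_one k n
  abs_prim_le s := by
    rcases le_total s 0 with hs | hs
    · rw [prim_ramp_of_nonpos hk n hs, abs_zero]
      exact mul_nonneg (ramp_nonneg _ _ _) (abs_nonneg _)
    · refine abs_prim_le fun x hx => ?_
      rw [abs_of_nonneg hs] at hx
      rw [abs_of_nonneg (ramp_nonneg _ _ _)]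
      exact monotone_ramp k n ((le_abs_self x).trans hx)

theorem prim_indicator_Ioi (hk : 0 ≤ k) (s : ℝ) :
    prim ((Ioi k).indicator fun _ => 1) s = max (s - k) 0 := by
  rcases le_total s k with h | h
  · rw [max_eq_right (sub_nonpos.2 h), prim, intervalIntegral.integral_congr (g := fun _ => 0)]
    · simp
    · intro x hx
      refine indicator_of_notMem (fun hx' => ?_) _
      have := hx.2
      simp only [mem_Ioi] at hx'
      rcases le_total s 0 with h0 | h0
      · rw [max_eq_left h0] at this; linarith
      · rw [max_eq_right h0] at this; linarith
  · rw [max_eq_left (sub_nonneg.2 h), prim, intervalIntegral.integral_of_le (hk.trans h),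
      setIntegral_indicator measurableSet_Ioi]
    have : Ioc 0 s ∩ Ioi k = Ioc k s := by
      ext x; simp only [mem_inter_iff, mem_Ioc, mem_Ioi]
      constructor
      · rintro ⟨⟨_, h2⟩, h3⟩; exact ⟨h3, h2⟩
      · rintro ⟨h1, h2⟩; exact ⟨⟨hk.trans_lt h1, h2⟩, h1⟩
    rw [this]
    simp [h]

theorem prim_prim_indicator_Ioi (hk : 0 ≤ k) (s : ℝ) :
    prim (fun s => max (s - k) 0) s = max (s - k) 0 ^ 2 / 2 := by
  have hd : ∀ x, HasDerivAt (fun s => max (s - k) 0 ^ 2 / 2) (max (x - k) 0) x := by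
    intro x
    rcases lt_trichotomy x k with h | h | h
    · rw [max_eq_right (by linarith)]
      refine (hasDerivAt_const x (0 : ℝ)).congr_of_eventuallyEq ?_
      filter_upwards [Iio_mem_nhds h] with y hy
      rw [max_eq_right (by simp only [mem_Iio] at hy; linarith)]; simp
    -- At the kink the function is bounded by the square of the increment, so its derivative is `0`.
    · subst h
      rw [sub_self, max_self, hasDerivAt_iff_isLittleO]
      simp only [sub_self, max_self, smul_zero, sub_zero, ne_eq, OfNat.ofNat_ne_zero,
        not_false_eq_true, zero_pow, zero_div]
      have : (fun y : ℝ => (y - x) ^ 2) =o[𝓝 x] fun y => y - x := by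
        have h1 : Tendsto (fun y : ℝ => y - x) (𝓝 x) (𝓝 0) := by
          have := (continuous_id.sub (continuous_const (y := x))).tendsto x
          simpa [Pi.sub_def] using this
        exact (Asymptotics.isLittleO_pow_id one_lt_two).comp_tendsto h1
      refine (Asymptotics.IsBigO.of_bound 1 (Eventually.of_forall fun y => ?_)).trans_isLittleO this
      rw [one_mul, Real.norm_eq_abs, Real.norm_eq_abs, abs_of_nonneg (by positivity),
        abs_of_nonneg (sq_nonneg _)]
      rcases le_total (y - x) 0 with h0 | h0
      · rw [max_eq_right h0]; nlinarith [sq_nonneg (y - x)]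
      · rw [max_eq_left h0]; nlinarith [sq_nonneg (y - x)]
    · rw [max_eq_left (by linarith)]
      have h1 : HasDerivAt (fun s => (s - k) ^ 2 / 2) (x - k) x := by
        have := (((hasDerivAt_id x).sub_const k).pow 2).div_const 2
        convert! this using 1
        simp
      refine h1.congr_of_eventuallyEq ?_
      filter_upwards [Ioi_mem_nhds h] with y hy
      rw [max_eq_left (by simp only [mem_Ioi] at hy; linarith)]
  rw [prim, intervalIntegral.integral_eq_sub_of_hasDerivAt (fun x _ => hd x)
    (by apply Continuous.intervalIntegrable; fun_prop)]
  simp [hk]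

theorem prim_ramp_nonneg (hk : 0 ≤ k) (n : ℕ) (s : ℝ) : 0 ≤ prim (ramp k n) s := by
  rcases le_total s 0 with hs | hs
  · rw [prim_ramp_of_nonpos hk n hs]
  · exact prim_nonneg hs fun x _ => ramp_nonneg k n x

theorem prim_ramp_le (hk : 0 ≤ k) (n : ℕ) (s : ℝ) : prim (ramp k n) s ≤ max (s - k) 0 := by
  rcases le_total s 0 with hs | hs
  · rw [prim_ramp_of_nonpos hk n hs]; exact le_max_right _ _
  · rw [← prim_indicator_Ioi hk]
    refine intervalIntegral.integral_mono_on hs ((continuous_ramp k n).intervalIntegrable _ _) ?_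
      fun x _ => ?_
    · exact (intervalIntegrable_const (c := (1 : ℝ))).mono_fun
        ((measurable_const.indicator measurableSet_Ioi).aestronglyMeasurable)
        (Eventually.of_forall fun x => norm_indicator_le_norm_self (fun _ => (1 : ℝ)) x)
    · by_cases hx : k < x
      · rw [indicator_of_mem (mem_Ioi.2 hx)]; exact ramp_le_one k n x
      · rw [ramp_of_le (not_lt.1 hx)]; exact indicator_nonneg (fun _ _ => zero_le_one) _

/-- The ramps lie below the indicator function, and integrating twice preserves this. The right-hand
side of the energy inequality is thus bounded uniformly in `n`, even where the limit energy might be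
infinite. -/
theorem prim_prim_ramp_le (hk : 0 ≤ k) (n : ℕ) (s : ℝ) :
    prim (prim (ramp k n)) s ≤ max (s - k) 0 ^ 2 / 2 := by
  rw [← prim_prim_indicator_Ioi hk]
  rcases le_total s 0 with hs | hs
  · have : prim (prim (ramp k n)) s = 0 := by
      rw [prim, intervalIntegral.integral_congr (g := fun _ => (0 : ℝ))]
      · simp
      · intro x hx
        rw [uIcc_of_ge hs] at hx
        exact prim_ramp_of_nonpos hk n hx.2
    rw [this, prim_prim_indicator_Ioi hk]; positivity
  · exact intervalIntegral.integral_mono_on hs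
      ((continuous_prim (continuous_ramp k n)).intervalIntegrable _ _)
      (by apply Continuous.intervalIntegrable; fun_prop) fun x _ => prim_ramp_le hk n x

theorem tendsto_prim_ramp (hk : 0 ≤ k) (s : ℝ) :
    Tendsto (fun n => prim (ramp k n) s) atTop (𝓝 (max (s - k) 0)) := by
  rw [← prim_indicator_Ioi hk]
  exact tendsto_prim (continuous_ramp k) (abs_ramp_le_one k) continuous_const (tendsto_ramp k) s

theorem tendsto_prim_prim_ramp (hk : 0 ≤ k) (s : ℝ) :
    Tendsto (fun n => prim (prim (ramp k n)) s) atTop (𝓝 (max (s - k) 0 ^ 2 / 2)) := by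
  rw [← prim_prim_indicator_Ioi hk]
  refine tendsto_prim (g := fun x => max (x - k) 0) (fun n => continuous_prim (continuous_ramp k n))
    (fun n x => ?_) (by fun_prop) (tendsto_prim_ramp hk) s
  rw [abs_of_nonneg (prim_ramp_nonneg hk n x)]
  exact prim_ramp_le hk n x

end Primitives

theorem rpow_eq_rpow_sub_one_mul {p x : ℝ} (hp : 1 < p) (hx : 0 ≤ x) :
    x ^ p = x ^ (p - 1) * x := by
  rcases hx.eq_or_lt with rfl | hx
  · rw [Real.zero_rpow (by linarith)]; simp
  · rw [← Real.rpow_add_one hx.ne']; ring_nf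

/-- Young's inequality with a prescribed constant. -/
theorem exists_rpow_mul_le {p ε M : ℝ} (hp : 1 < p) (hε : 0 < ε) (hM : 0 ≤ M) :
    ∃ C, 0 ≤ C ∧ ∀ a b : ℝ, 0 ≤ a → 0 ≤ b → M * a ^ (p - 1) * b ≤ ε * a ^ p + C * b ^ p := by
  refine ⟨M * (M / ε) ^ (p - 1), by positivity, fun a b ha hb => ?_⟩
  -- Either the product is absorbed directly into `ε * a ^ p`, or `a ≤ (M / ε) * b` and everything
  -- is a multiple of `b ^ p`; this dictates the constant.
  by_cases h : M * b ≤ ε * a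
  · have h1 : M * a ^ (p - 1) * b ≤ ε * a ^ p := by
      rw [rpow_eq_rpow_sub_one_mul hp ha]
      nlinarith [Real.rpow_nonneg ha (p - 1)]
    have : 0 ≤ M * (M / ε) ^ (p - 1) * b ^ p := by positivity
    linarith
  · have h2 : a ≤ M / ε * b := by
      rw [div_mul_eq_mul_div, le_div_iff₀ hε]; linarith
    have h3 : a ^ (p - 1) ≤ (M / ε) ^ (p - 1) * b ^ (p - 1) := by
      rw [← Real.mul_rpow (by positivity) hb]
      exact Real.rpow_le_rpow ha h2 (by linarith)
    have h4 : M * a ^ (p - 1) * b ≤ M * (M / ε) ^ (p - 1) * b ^ p := by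
      rw [rpow_eq_rpow_sub_one_mul hp hb]
      calc M * a ^ (p - 1) * b ≤ M * ((M / ε) ^ (p - 1) * b ^ (p - 1)) * b := by gcongr
        _ = _ := by ring
    have : 0 ≤ ε * a ^ p := by positivity
    linarith

/-! ### Cut-off functions in space -/

section SpaceCutoff

variable {N : ℕ}

/-- Cut-off functions equal to `1` on large balls, whose gradient is small with respect to a power
of the function. -/
theorem exists_space_cutoff (p : Fin N → ℝ) (hp : ∀ i, 1 < p i) :
    ∃ (ζ : ℕ → E N → ℝ) (κ : ℕ → ℝ), (∀ n, ContDiff ℝ ∞ (ζ n)) ∧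
      (∀ n, HasCompactSupport (ζ n)) ∧ (∀ n x, 0 ≤ ζ n x) ∧ (∀ n x, ζ n x ≤ 1) ∧
      (∀ x, Tendsto (fun n => ζ n x) atTop (𝓝 1)) ∧ (∀ n, 0 ≤ κ n) ∧
      Tendsto κ atTop (𝓝 0) ∧
      ∀ n x i, |fderiv ℝ (ζ n) x (EuclideanSpace.single i 1)| ≤
        κ n * ζ n x ^ ((p i - 1) / p i) := by
  -- The cut-off is `η ^ m`, rescaled. Its derivative contains `η ^ (m - 1)`, and `m - 1 ≥ m (p i -
  -- 1) / p i` exactly when `m ≥ p i`; since `0 ≤ η ≤ 1`, this is the bound wanted.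
  obtain ⟨m, hm0, hm⟩ : ∃ m : ℕ, 0 < m ∧ ∀ i, p i ≤ m := by
    obtain ⟨m, hm⟩ := exists_nat_gt (∑ i, |p i|)
    refine ⟨m + 1, m.succ_pos, fun i => ?_⟩
    have h1 : |p i| ≤ ∑ j, |p j| :=
      Finset.single_le_sum (f := fun j => |p j|) (fun j _ => abs_nonneg _) (Finset.mem_univ i)
    push_cast
    linarith [le_abs_self (p i)]
  obtain ⟨η, hη, hηc, hη0, hη1, hηone⟩ : ∃ η : E N → ℝ, ContDiff ℝ ∞ η ∧ HasCompactSupport η ∧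
      (∀ x, 0 ≤ η x) ∧ (∀ x, η x ≤ 1) ∧ ∀ x ∈ Metric.closedBall 0 1, η x = 1 :=
    let b : ContDiffBump (0 : E N) := ⟨1, 2, one_pos, one_lt_two⟩
    ⟨b, b.contDiff (n := ⊤), b.hasCompactSupport, fun _ => b.nonneg, fun _ => b.le_one,
      fun _ => b.one_of_mem_closedBall⟩
  choose D hD0 hD using fun i : Fin N => exists_bound_of_hasCompactSupport
    (continuous_fderiv_apply hη (EuclideanSpace.single i 1))
    (hasCompactSupport_fderiv_apply hηc (EuclideanSpace.single i 1))
  let c : ℕ → ℝ := fun n => 1 / (n + 1)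
  have hc : ∀ n, 0 < c n := fun n => by positivity
  refine ⟨fun n x => η (c n • x) ^ m, fun n => m * c n * ∑ i, D i, fun n => ?_, fun n => ?_,
    fun n x => pow_nonneg (hη0 _) _, fun n x => pow_le_one₀ (hη0 _) (hη1 _), fun x => ?_,
    fun n => ?_, ?_, fun n x i => ?_⟩
  · exact (hη.comp (contDiff_id.const_smul (c n))).pow m
  · have : HasCompactSupport fun x => η (c n • x) :=
      hηc.comp_homeomorph (Homeomorph.smulOfNeZero (c n) (hc n).ne')
    exact this.comp_left (g := fun y : ℝ => y ^ m) (zero_pow hm0.ne')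
  · refine tendsto_const_nhds.congr' ?_
    obtain ⟨n₀, hn₀⟩ := exists_nat_gt ‖x‖
    filter_upwards [eventually_ge_atTop n₀] with n hn
    rw [hηone, one_pow]
    rw [mem_closedBall_zero_iff, norm_smul, Real.norm_of_nonneg (hc n).le]
    have h1 : ‖x‖ ≤ n + 1 := by
      have : (n₀ : ℝ) ≤ n := by exact_mod_cast hn
      linarith
    simp only [c]
    rw [one_div, inv_mul_le_iff₀ (by positivity)]
    linarith
  · have := Finset.sum_nonneg fun i (_ : i ∈ Finset.univ) => hD0 i
    have := hc n
    positivity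
  · have h := (tendsto_one_div_add_atTop_nhds_zero_nat (𝕜 := ℝ)).const_mul (m * ∑ i, D i)
    rw [mul_zero] at h
    refine h.congr fun n => ?_
    simp only [c]; ring
  · have hd : HasFDerivAt (fun x => η (c n • x)) ((fderiv ℝ η (c n • x)).comp
        (c n • ContinuousLinearMap.id ℝ (E N))) x :=
      ((hη.differentiable (by simp) _).hasFDerivAt).comp x ((hasFDerivAt_id x).const_smul (c n))
    have hd2 := hd.pow m
    rw [hd2.fderiv]
    set y := c n • x
    have e1 : |fderiv ℝ η y (EuclideanSpace.single i 1)| ≤ ∑ i, D i :=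
      (hD i y).trans (Finset.single_le_sum (f := D) (fun j _ => hD0 j) (Finset.mem_univ i))
    have hpi := hp i
    have e2 : η y ^ (m - 1) ≤ (η y ^ m) ^ ((p i - 1) / p i) := by
      rcases (hη0 y).eq_or_lt with h0 | h0
      · rw [← h0, zero_pow]
        · positivity
        · have : (1 : ℝ) < m := hpi.trans_le (hm i)
          have : 1 < m := by exact_mod_cast this
          omega
      · rw [← Real.rpow_natCast, ← Real.rpow_natCast, ← Real.rpow_mul h0.le]
        refine Real.rpow_le_rpow_of_exponent_ge h0 (hη1 y) ?_
        rw [Nat.cast_sub (by omega), Nat.cast_one, mul_div_assoc', div_le_iff₀ (by linarith)]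
        nlinarith [hm i]
    simp only [smul_apply, ContinuousLinearMap.comp_apply,
      ContinuousLinearMap.id_apply, map_smul, smul_eq_mul, nsmul_eq_mul]
    rw [abs_mul, abs_mul, abs_mul, abs_of_nonneg (hc n).le, abs_of_nonneg (pow_nonneg (hη0 _) _),
      Nat.abs_cast]
    calc (m : ℝ) * η y ^ (m - 1) * (c n * |fderiv ℝ η y (EuclideanSpace.single i 1)|)
        ≤ m * (η y ^ m) ^ ((p i - 1) / p i) * (c n * ∑ i, D i) := by
          have := hc n
          gcongr
          exact mul_nonneg (Nat.cast_nonneg _) (Real.rpow_nonneg (pow_nonneg (hη0 _) _) _)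
      _ = _ := by ring

end SpaceCutoff

/-! ### Cut-off functions in time -/

section TimeCutoff

/-- The derivative of the transition function is continuous, supported in `[0, 1]` and has integral
`1`, so its rescalings concentrate at `c` whatever the fixed shift `d`. -/
theorem integral_mul_deriv_smoothTransition {e : ℝ → ℝ} (he : Continuous e) {M : ℝ}
    (hM : ∀ x, |e x| ≤ M) (c d : ℝ) :
    Tendsto (fun r : ℝ => ∫ τ, e τ * (r * deriv Real.smoothTransition (r * (τ - c) + d))) atTop
      (𝓝 (e c)) := by
  set S := Real.smoothTransition
  have hS : ContDiff ℝ ∞ S := Real.smoothTransition.contDiff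
  have hSc : Continuous (deriv S) := hS.continuous_deriv (by simp)
  have hsupp : ∀ y, y ∉ Icc (0 : ℝ) 1 → deriv S y = 0 := by
    intro y hy
    rw [mem_Icc, not_and_or, not_le, not_le] at hy
    rcases hy with hy | hy
    · have : S =ᶠ[𝓝 y] fun _ => 0 := by
        filter_upwards [Iio_mem_nhds hy] with x hx
        exact Real.smoothTransition.zero_of_nonpos (le_of_lt hx)
      rw [this.deriv_eq, deriv_const]
    · have : S =ᶠ[𝓝 y] fun _ => 1 := by
        filter_upwards [Ioi_mem_nhds hy] with x hx
        exact Real.smoothTransition.one_of_one_le (le_of_lt hx)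
      rw [this.deriv_eq, deriv_const]
  have hcs : HasCompactSupport (deriv S) := HasCompactSupport.intro isCompact_Icc hsupp
  have hint : Integrable (deriv S) := hSc.integrable_of_hasCompactSupport hcs
  have hone : ∫ y, deriv S y = 1 := by
    rw [integral_of_hasDerivAt_of_tendsto
      (fun x => (hS.differentiable (by simp) x).hasDerivAt) hint (m := 0) (n := 1)]
    · simp
    · exact tendsto_const_nhds.congr' ((eventually_le_atBot 0).mono fun x hx =>
        (Real.smoothTransition.zero_of_nonpos hx).symm)
    · exact tendsto_const_nhds.congr' ((eventually_ge_atTop 1).mono fun x hx =>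
        (Real.smoothTransition.one_of_one_le hx).symm)
  have hcv : ∀ r : ℝ, 0 < r → ∫ τ, e τ * (r * deriv S (r * (τ - c) + d)) =
      ∫ y, e (c + (y - d) / r) * deriv S y := by
    intro r hr
    have h1 := integral_add_right_eq_self (μ := volume)
      (fun τ => e τ * (r * deriv S (r * (τ - c) + d))) (c - d / r)
    have h2 := Measure.integral_comp_mul_left
      (fun y => e (c + (y - d) / r) * deriv S y) r
    rw [← h1]
    have h3 : ∀ x, e (x + (c - d / r)) * (r * deriv S (r * (x + (c - d / r) - c) + d)) =
        r * (e (c + (r * x - d) / r) * deriv S (r * x)) := by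
      intro x
      have e1 : x + (c - d / r) = c + (r * x - d) / r := by field_simp; ring
      have e2 : r * (x + (c - d / r) - c) + d = r * x := by field_simp; ring
      rw [e2, e1]; ring
    simp only [h3, integral_const_mul, h2, abs_inv, abs_of_pos hr, smul_eq_mul]
    field_simp
  have hlim : Tendsto (fun r : ℝ => ∫ y, e (c + (y - d) / r) * deriv S y) atTop
      (𝓝 (∫ y, e c * deriv S y)) := by
    refine tendsto_integral_filter_of_dominated_convergence (fun y => M * |deriv S y|)
      (Eventually.of_forall fun r => ?_) (Eventually.of_forall fun r =>
        Eventually.of_forall fun y => ?_) (hint.abs.const_mul M) (Eventually.of_forall fun y => ?_)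
    · exact Continuous.aestronglyMeasurable (by fun_prop)
    · rw [Real.norm_eq_abs, abs_mul]
      exact mul_le_mul_of_nonneg_right (hM _) (abs_nonneg _)
    · refine Tendsto.mul_const _ ((he.tendsto c).comp ?_)
      have : Tendsto (fun r : ℝ => (y - d) / r) atTop (𝓝 0) := tendsto_const_nhds.div_atTop tendsto_id
      simpa using this.const_add c
  rw [integral_const_mul, hone, mul_one] at hlim
  exact hlim.congr' ((eventually_gt_atTop 0).mono fun r hr => (hcv r hr).symm)

/-- Smooth approximations of the indicator function of a time interval. -/
theorem exists_time_cutoff {s t : ℝ} (hst : s < t) :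
    ∃ ψ : ℕ → ℝ → ℝ, (∀ n, ContDiff ℝ ∞ (ψ n)) ∧ (∀ n τ, 0 ≤ ψ n τ) ∧ (∀ n τ, ψ n τ ≤ 1) ∧
      (∀ n τ, τ ∉ Ioo s t → ψ n τ = 0) ∧
      (∀ τ ∈ Ioo s t, Tendsto (fun n => ψ n τ) atTop (𝓝 1)) ∧
      ∀ e : ℝ → ℝ, ContinuousOn e (Icc s t) →
        Tendsto (fun n => ∫ τ, e τ * deriv (ψ n) τ) atTop (𝓝 (e s - e t)) := by
  set S := Real.smoothTransition
  have hS : ContDiff ℝ ∞ S := Real.smoothTransition.contDiff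
  have hmono : Monotone S := Real.smoothTransition.monotone
  -- The summand `1 / (t - s)` ensures `r n * (t - s) ≥ 1` already for `n = 0`, so that the rise
  -- after `s` and the fall before `t` do not overlap.
  let r : ℕ → ℝ := fun n => n + 1 / (t - s)
  have hts : 0 < t - s := sub_pos.2 hst
  have hr0 : ∀ n, 0 < r n := fun n => by positivity
  have hr1 : ∀ n, 1 ≤ r n * (t - s) := fun n => by
    have : r n * (t - s) = n * (t - s) + 1 := by simp only [r]; field_simp
    rw [this]
    have : 0 ≤ (n : ℝ) * (t - s) := by positivity
    linarith
  have hr : Tendsto r atTop atTop :=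
    tendsto_atTop_add_const_right _ _ tendsto_natCast_atTop_atTop
  -- The shifts `0` and `1` place the transitions in `[s, s + 1 / r n]` and `[t - 1 / r n, t]`, both
  -- inside `[s, t]`.
  let ψ : ℕ → ℝ → ℝ := fun n τ => S (r n * (τ - s) + 0) - S (r n * (τ - t) + 1)
  have hψ : ∀ n, ContDiff ℝ ∞ (ψ n) := fun n => by
    refine (hS.comp ?_).sub (hS.comp ?_) <;> fun_prop
  have hzero : ∀ n τ, τ ∉ Ioo s t → ψ n τ = 0 := by
    intro n τ hτ
    rw [mem_Ioo, not_and_or, not_lt, not_lt] at hτ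
    have h0 := hr0 n
    have h1 := hr1 n
    rcases hτ with hτ | hτ
    · simp only [ψ, S]
      rw [Real.smoothTransition.zero_of_nonpos (by nlinarith),
        Real.smoothTransition.zero_of_nonpos (by nlinarith), sub_zero]
    · simp only [ψ, S]
      rw [Real.smoothTransition.one_of_one_le (by nlinarith),
        Real.smoothTransition.one_of_one_le (by nlinarith), sub_self]
  refine ⟨ψ, hψ, fun n τ => ?_, fun n τ => ?_, hzero, fun τ hτ => ?_, fun e he => ?_⟩
  · refine sub_nonneg.2 (hmono ?_)
    linarith [hr1 n, mul_sub (r n) τ t, mul_sub (r n) τ s, mul_sub (r n) t s]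
  · have h1 : S (r n * (τ - s) + 0) ≤ 1 := Real.smoothTransition.le_one _
    have h2 : 0 ≤ S (r n * (τ - t) + 1) := Real.smoothTransition.nonneg _
    simp only [ψ]; linarith
  · refine tendsto_const_nhds.congr' ?_
    have h1 := (hr.atTop_mul_const (sub_pos.2 hτ.1)).eventually_ge_atTop 1
    have h2 := (hr.atTop_mul_const (sub_pos.2 hτ.2)).eventually_ge_atTop 1
    filter_upwards [h1, h2] with n h1 h2
    simp only [ψ, S]
    rw [Real.smoothTransition.one_of_one_le (by linarith),
      Real.smoothTransition.zero_of_nonpos (by linarith [mul_sub (r n) τ t, mul_sub (r n) t τ]),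
      sub_zero]
  -- The constant extension is bounded and continuous on the whole line, as the approximate
  -- identities at `s` and `t` require; the derivative of `ψ n` vanishes outside `[s, t]`, so the
  -- integral is not affected.
  · set e' : ℝ → ℝ := IccExtend hst.le ((Icc s t).domRestrict e) with he'
    have hc : Continuous e' := (continuousOn_iff_continuous_domRestrict.1 he).Icc_extend'
    have hee : ∀ τ ∈ Icc s t, e' τ = e τ := fun τ hτ => IccExtend_of_mem hst.le _ hτ
    obtain ⟨M, hM⟩ := isCompact_Icc.exists_bound_of_continuousOn he
    have hM' : ∀ x, |e' x| ≤ M := fun x => hM _ (projIcc s t hst.le x).2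
    have h1 := (integral_mul_deriv_smoothTransition hc hM' s 0).comp hr
    have h2 := (integral_mul_deriv_smoothTransition hc hM' t 1).comp hr
    have h3 := h1.sub h2
    rw [hee s (left_mem_Icc.2 hst.le), hee t (right_mem_Icc.2 hst.le)] at h3
    refine h3.congr fun n => ?_
    have hSc : Continuous (deriv S) := hS.continuous_deriv (by simp)
    have hSd : ∀ x, HasDerivAt S (deriv S x) x := fun x =>
      (hS.differentiable (by simp) x).hasDerivAt
    have hcomp : ∀ c d τ, HasDerivAt (fun τ => S (r n * (τ - c) + d))
        (r n * deriv S (r n * (τ - c) + d)) τ := fun c d τ => by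
      have h := (((hasDerivAt_id τ).sub_const c).const_mul (r n)).add_const d
      have := (hSd (r n * (τ - c) + d)).comp τ h
      convert! this using 1
      simp [mul_comm]
    have hder : ∀ τ, deriv (ψ n) τ =
        r n * deriv S (r n * (τ - s) + 0) - r n * deriv S (r n * (τ - t) + 1) := fun τ =>
      ((hcomp s 0 τ).sub (hcomp t 1 τ)).deriv
    have hcsup : ∀ c d, HasCompactSupport fun τ => deriv S (r n * (τ - c) + d) := by
      intro c d
      refine HasCompactSupport.intro (isCompact_Icc (a := c - d / r n) (b := c + (1 - d) / r n))
        fun τ hτ => ?_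
      have h0 := hr0 n
      rw [mem_Icc, not_and_or, not_le, not_le] at hτ
      have hev : (∀ᶠ x in 𝓝 (r n * (τ - c) + d), S x = 0) ∨
          (∀ᶠ x in 𝓝 (r n * (τ - c) + d), S x = 1) := by
        rcases hτ with hτ | hτ
        · left
          have : r n * (τ - c) + d < 0 := by
            have : r n * (τ - c) < r n * (-(d / r n)) := by gcongr; linarith
            rw [mul_neg, mul_div_cancel₀ _ h0.ne'] at this
            linarith
          filter_upwards [Iio_mem_nhds this] with x hx
          exact Real.smoothTransition.zero_of_nonpos (le_of_lt hx)
        · right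
          have : 1 < r n * (τ - c) + d := by
            have : r n * ((1 - d) / r n) < r n * (τ - c) := by gcongr; linarith
            rw [mul_div_cancel₀ _ h0.ne'] at this
            linarith
          filter_upwards [Ioi_mem_nhds this] with x hx
          exact Real.smoothTransition.one_of_one_le (le_of_lt hx)
      rcases hev with hev | hev
      · rw [EventuallyEq.deriv_eq (f := fun _ => (0 : ℝ)) hev, deriv_const]
      · rw [EventuallyEq.deriv_eq (f := fun _ => (1 : ℝ)) hev, deriv_const]
    have hi : ∀ c d, Integrable fun τ => e' τ * (r n * deriv S (r n * (τ - c) + d)) := fun c d =>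
      Continuous.integrable_of_hasCompactSupport (by fun_prop)
        (HasCompactSupport.mul_left (HasCompactSupport.mul_left (hcsup c d)))
    simp only [Function.comp_apply]
    rw [← integral_sub (hi s 0) (hi t 1)]
    refine integral_congr_ae (Eventually.of_forall fun τ => ?_)
    simp only [← mul_sub, ← mul_sub (r n)]
    rw [mul_sub (r n), ← hder τ]
    by_cases hτ : τ ∈ Icc s t
    · rw [hee τ hτ]
    · have : deriv (ψ n) τ = 0 := by
        have : ψ n =ᶠ[𝓝 τ] fun _ => 0 := by
          filter_upwards [isClosed_Icc.isOpen_compl.mem_nhds hτ] with x hx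
          exact hzero n x fun h => hx (Ioo_subset_Icc_self h)
        rw [this.deriv_eq, deriv_const]
      simp [this]

end TimeCutoff

/-! ### Weak spatial gradients and truncation -/

section WeakGradient

variable {N : ℕ}

instance instIsAddHaarMeasureSpaceTime : (volume : Measure (E N × ℝ)).IsAddHaarMeasure :=
  inferInstanceAs ((volume : Measure (E N)).prod (volume : Measure ℝ)).IsAddHaarMeasure

theorem isOpen_openTimes (T : EReal) : IsOpen (openTimes T) :=
  (isOpen_lt continuous_const continuous_id).inter
    (isOpen_lt continuous_coe_real_ereal continuous_const)

theorem isOpen_strip (T : EReal) : IsOpen (strip N T) := isOpen_univ.prod (isOpen_openTimes T)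

theorem measurableSet_strip (T : EReal) : MeasurableSet (strip N T) :=
  (isOpen_strip T).measurableSet

theorem openTimes_coe (T : ℝ) : openTimes (T : EReal) = Ioo 0 T := by
  ext t; simp [openTimes]

theorem strip_coe (T : ℝ) : strip N (T : EReal) = univ ×ˢ Ioo 0 T := by
  rw [strip, openTimes_coe]

theorem openTimes_mono {T T' : EReal} (h : T' ≤ T) : openTimes T' ⊆ openTimes T :=
  fun _ ht => ⟨ht.1, ht.2.trans_le h⟩

theorem strip_mono {T T' : EReal} (h : T' ≤ T) : strip N T' ⊆ strip N T :=
  prod_mono_right (openTimes_mono h)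

/-- Passes between integrals over a strip and integrals over the whole space of functions cut off to
`V`; the latter can be mollified. -/
theorem integral_indicator_mul {V S : Set (E N × ℝ)} (hS : MeasurableSet S) (hVS : V ⊆ S)
    (f : E N × ℝ → ℝ) {g : E N × ℝ → ℝ} (hg : ∀ z ∉ V, g z = 0) :
    ∫ z, V.indicator f z * g z = ∫ z in S, f z * g z := by
  rw [← integral_indicator hS]
  congr 1; ext z
  by_cases hz : z ∈ V
  · rw [indicator_of_mem hz, indicator_of_mem (hVS hz)]
  · rw [indicator_of_notMem hz]
    by_cases hz' : z ∈ S
    · rw [indicator_of_mem hz', hg z hz, zero_mul, mul_zero]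
    · rw [indicator_of_notMem hz', zero_mul]

theorem fderiv_eq_zero_of_tsupport_subset {V : Set (E N × ℝ)} {φ : E N × ℝ → ℝ}
    (h : tsupport φ ⊆ V) (v : E N × ℝ) : ∀ z ∉ V, fderiv ℝ φ z v = 0 := fun z hz => by
  rw [fderiv_of_notMem_tsupport (𝕜 := ℝ) (fun h' => hz (h h'))]; rfl

theorem eq_zero_of_tsupport_subset {V : Set (E N × ℝ)} {φ : E N × ℝ → ℝ}
    (h : tsupport φ ⊆ V) : ∀ z ∉ V, φ z = 0 :=
  fun _ hz => image_eq_zero_of_notMem_tsupport fun h' => hz (h h')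

theorem integral_fderiv_eq_zero {φ : E N × ℝ → ℝ} (hφ : ContDiff ℝ ∞ φ)
    (hc : HasCompactSupport φ) (v : E N × ℝ) : ∫ z, fderiv ℝ φ z v = 0 := by
  have := integral_mul_fderiv_of_hasCompactSupport (μ := volume) (f := fun _ => (1 : ℝ))
    contDiff_const (hφ.of_le (by norm_cast)) hc v
  simpa using this

variable {T : EReal} {u : E N × ℝ → ℝ} {w : E N × ℝ → E N}

theorem IsWeakSpatialGradient.isWeakDerivOn (h : IsWeakSpatialGradient T u w)
    {V : Set (E N × ℝ)} (hV : V ⊆ strip N T) (i : Fin N) :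
    IsWeakDerivOn volume V (EuclideanSpace.single i 1, 0) (V.indicator u)
      (V.indicator fun z => w z i) := by
  intro φ hφ hc hs
  rw [integral_indicator_mul (measurableSet_strip T) hV _
      (fderiv_eq_zero_of_tsupport_subset hs _),
    integral_indicator_mul (measurableSet_strip T) hV _ (eq_zero_of_tsupport_subset hs)]
  exact h.integral_eq φ hφ hc (hs.trans hV) i

theorem IsWeakSpatialGradient.sub_const (h : IsWeakSpatialGradient T u w) (k : ℝ) :
    IsWeakSpatialGradient T (fun z => u z - k) w where
  locallyIntegrable := h.locallyIntegrable.sub (locallyIntegrableOn_const k)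
  gradient_locallyIntegrable := h.gradient_locallyIntegrable
  integral_eq φ hφ hc hs i := by
    rw [← h.integral_eq φ hφ hc hs i]
    have c1 := continuous_fderiv_apply hφ (EuclideanSpace.single i 1, 0)
    have hc1 := hasCompactSupport_fderiv_apply hc (EuclideanSpace.single i 1, 0)
    have i1 : Integrable (fun z => k * dx φ i z) :=
      (c1.integrable_of_hasCompactSupport hc1).const_mul k
    have i2 : IntegrableOn (fun z => u z * dx φ i z) (strip N T) := by
      obtain ⟨C, -, hC⟩ := exists_bound_of_hasCompactSupport c1 hc1
      have h1 : IntegrableOn u (tsupport φ) :=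
        h.locallyIntegrable.integrableOn_compact_subset hs hc
      have h2 : IntegrableOn (fun z => u z * dx φ i z) (tsupport φ) :=
        h1.mul_bdd (c := C) c1.aestronglyMeasurable (Eventually.of_forall hC)
      refine (h2.of_forall_sdiff_eq_zero (measurableSet_strip T) fun z hz => ?_)
      simp only [dx]
      rw [fderiv_eq_zero_of_tsupport_subset Subset.rfl _ z hz.2, mul_zero]
    have i3 : ∫ z in strip N T, k * dx φ i z = 0 := by
      rw [setIntegral_eq_integral_of_forall_compl_eq_zero, integral_const_mul]
      · simp only [dx]
        rw [integral_fderiv_eq_zero hφ hc, mul_zero]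
      · intro z hz
        simp only [dx]
        rw [fderiv_eq_zero_of_tsupport_subset hs _ z hz, mul_zero]
    simp only [sub_mul]
    rw [integral_sub i2 i1.integrableOn, i3, sub_zero]

/-- The chain rule is applied to the `C¹` primitives of the ramps at level `0`, followed by
dominated convergence. The ramps vanish at `0`, hence the strict inequality in the set. -/
theorem IsWeakSpatialGradient.max_zero (h : IsWeakSpatialGradient T u w) :
    IsWeakSpatialGradient T (fun z => max (u z) 0) ({z | 0 < u z}.indicator w) where
  locallyIntegrable z hz := by
    obtain ⟨s, hs, hi⟩ := h.locallyIntegrable z hz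
    exact ⟨s, hs, Integrable.pos_part hi⟩
  gradient_locallyIntegrable z hz := by
    obtain ⟨s, hs, hi⟩ := h.locallyIntegrable z hz
    obtain ⟨s', hs', hi'⟩ := h.gradient_locallyIntegrable z hz
    refine ⟨s ∩ s', inter_mem hs hs', ?_⟩
    refine Integrable.indicator₀ (hi'.mono_set inter_subset_right) ?_
    exact nullMeasurableSet_lt aemeasurable_const
      (hi.mono_set inter_subset_left).aestronglyMeasurable.aemeasurable
  integral_eq φ hφ hc hs i := by
    -- Cutting off to a relatively compact neighbourhood of the support turns local integrability
    -- into the global integrability needed by the chain rule.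
    obtain ⟨V, hVo, hKV, hVS, hVc⟩ := exists_open_between_and_isCompact_closure hc
      (isOpen_strip T) hs
    have hV : V ⊆ strip N T := subset_closure.trans hVS
    set f := V.indicator u with hf
    set g : E N × ℝ → ℝ := V.indicator fun z => w z i with hg
    have fi : Integrable f := by
      rw [hf, integrable_indicator_iff hVo.measurableSet]
      exact (h.locallyIntegrable.integrableOn_compact_subset hVS hVc).mono_set subset_closure
    have gi : Integrable g := by
      rw [hg, integrable_indicator_iff hVo.measurableSet]
      have := (h.gradient_locallyIntegrable.integrableOn_compact_subset hVS hVc).mono_set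
        subset_closure
      exact (EuclideanSpace.proj (𝕜 := ℝ) i).integrable_comp this
    have hd := h.isWeakDerivOn hV i
    have hn : ∀ n, _ := fun n => (hd.comp fi gi (hasDerivAt_prim (continuous_ramp 0 n))
      (continuous_ramp 0 n) (abs_ramp_le_one 0 n)
      (isEnergyDensity_ramp le_rfl n).abs_prim_le_abs hVo) φ hφ hc hKV
    set v : E N × ℝ := (EuclideanSpace.single i 1, 0)
    have c1 := continuous_fderiv_apply hφ v
    have hc1 := hasCompactSupport_fderiv_apply hc v
    obtain ⟨C, hC0, hC⟩ := exists_bound_of_hasCompactSupport c1 hc1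
    obtain ⟨D, hD0, hD⟩ := exists_bound_of_hasCompactSupport hφ.continuous hc
    have l1 : Tendsto (fun n => ∫ z, prim (ramp 0 n) (f z) * fderiv ℝ φ z v) atTop
        (𝓝 (∫ z, max (f z) 0 * fderiv ℝ φ z v)) := by
      refine tendsto_integral_of_dominated_convergence (fun z => |f z| * C) (fun n => ?_)
        (fi.abs.mul_const C) (fun n => Eventually.of_forall fun z => ?_)
        (Eventually.of_forall fun z => ?_)
      · exact ((continuous_prim (continuous_ramp 0 n)).comp_aestronglyMeasurable fi.1).mul
          c1.aestronglyMeasurable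
      · rw [Real.norm_eq_abs, abs_mul]
        exact mul_le_mul ((isEnergyDensity_ramp le_rfl n).abs_prim_le_abs _) (hC z)
          (abs_nonneg _) (abs_nonneg _)
      · simpa using (tendsto_prim_ramp le_rfl (f z)).mul_const (fderiv ℝ φ z v)
    have l2 : Tendsto (fun n => ∫ z, ramp 0 n (f z) * g z * φ z) atTop
        (𝓝 (∫ z, (Ioi 0).indicator (fun _ => 1) (f z) * g z * φ z)) := by
      refine tendsto_integral_of_dominated_convergence (fun z => |g z| * D) (fun n => ?_)
        (gi.abs.mul_const D) (fun n => Eventually.of_forall fun z => ?_)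
        (Eventually.of_forall fun z => ?_)
      · exact (((continuous_ramp 0 n).comp_aestronglyMeasurable fi.1).mul gi.1).mul
          hφ.continuous.aestronglyMeasurable
      · rw [Real.norm_eq_abs, abs_mul, abs_mul]
        exact mul_le_mul (mul_le_of_le_one_left (abs_nonneg _) (abs_ramp_le_one _ _ _)) (hD z)
          (abs_nonneg _) (abs_nonneg _)
      · exact ((tendsto_ramp 0 (f z)).mul_const _).mul_const _
    have l3 := tendsto_nhds_unique (l1.congr hn) l2.neg
    have e1 : ∀ z, max (f z) 0 = V.indicator (fun z => max (u z) 0) z := fun z => by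
      by_cases hz : z ∈ V <;> simp [hf, hz]
    have e2 : ∀ z, (Ioi (0 : ℝ)).indicator (fun _ => 1) (f z) * g z =
        V.indicator (fun z => {z | 0 < u z}.indicator w z i) z := fun z => by
      by_cases hz : z ∈ V
      · by_cases hz' : 0 < u z <;> simp [hf, hg, hz, hz']
      · simp [hf, hg, hz]
    simp only [e1, e2] at l3
    rwa [integral_indicator_mul (measurableSet_strip T) hV _
      (fderiv_eq_zero_of_tsupport_subset hKV _),
      integral_indicator_mul (measurableSet_strip T) hV _ (eq_zero_of_tsupport_subset hKV)] at l3

theorem IsWeakSpatialGradient.truncation (h : IsWeakSpatialGradient T u w) (k : ℝ) :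
    IsWeakSpatialGradient T (fun z => max (u z - k) 0) ({z | k < u z}.indicator w) := by
  simpa only [sub_pos] using (h.sub_const k).max_zero

/-- Only `T = +∞` needs an argument: local integrability is tested near a point, and a compactly
supported test function lives in a strip of finite height. -/
theorem isWeakSpatialGradient_of_forall_lt (hT : 0 < T)
    (h : ∀ T' : ℝ, 0 < T' → (T' : EReal) ≤ T → IsWeakSpatialGradient T' u w) :
    IsWeakSpatialGradient T u w := by
  induction T with
  | bot => simp at hT
  | coe T => exact h T (by exact_mod_cast hT) le_rfl
  | top =>
    have hmem : ∀ z ∈ strip N ⊤, z ∈ strip N ((z.2 + 1 : ℝ) : EReal) := fun z hz => by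
      rw [strip_coe]; exact ⟨trivial, hz.2.1, by simp⟩
    have hnhds : ∀ z ∈ strip N ⊤, 𝓝[strip N ⊤] z = 𝓝[strip N ((z.2 + 1 : ℝ) : EReal)] z :=
      fun z hz => by
        rw [(isOpen_strip _).nhdsWithin_eq hz, (isOpen_strip _).nhdsWithin_eq (hmem z hz)]
    have hpos : ∀ z ∈ strip N ⊤, 0 < z.2 + 1 := fun z hz => by
      have : 0 < z.2 := hz.2.1
      linarith
    refine ⟨fun z hz => ?_, fun z hz => ?_, fun φ hφ hc hs i => ?_⟩
    · rw [hnhds z hz]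
      exact (h _ (hpos z hz) le_top).locallyIntegrable z (hmem z hz)
    · rw [hnhds z hz]
      exact (h _ (hpos z hz) le_top).gradient_locallyIntegrable z (hmem z hz)
    · obtain ⟨b, hb⟩ := (hc.isCompact.image continuous_snd).bddAbove
      have hs' : tsupport φ ⊆ strip N ((max b 0 + 1 : ℝ) : EReal) := fun z hz => by
        rw [strip_coe]
        have h1 : z.2 ≤ b := hb (mem_image_of_mem _ hz)
        exact ⟨trivial, (hs hz).2.1, by linarith [le_max_left b 0]⟩
      have h1 := (h (max b 0 + 1) (by positivity) le_top).integral_eq φ hφ hc hs' i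
      have h2 := fun f : E N × ℝ → ℝ => integral_indicator_mul
        (measurableSet_strip ((max b 0 + 1 : ℝ) : EReal)) hs' f
        (fderiv_eq_zero_of_tsupport_subset Subset.rfl (EuclideanSpace.single i 1, 0))
      have h3 := fun f : E N × ℝ → ℝ => integral_indicator_mul
        (measurableSet_strip ((max b 0 + 1 : ℝ) : EReal)) hs' f
        (eq_zero_of_tsupport_subset (φ := φ) Subset.rfl)
      have h4 := fun f : E N × ℝ → ℝ => integral_indicator_mul (measurableSet_strip ⊤) hs f
        (fderiv_eq_zero_of_tsupport_subset Subset.rfl (EuclideanSpace.single i 1, 0))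
      have h5 := fun f : E N × ℝ → ℝ => integral_indicator_mul (measurableSet_strip ⊤) hs f
        (eq_zero_of_tsupport_subset (φ := φ) Subset.rfl)
      simp only [dx] at h1 ⊢
      rw [← h4, ← h5 fun z => w z i, h2, h3]
      exact h1

end WeakGradient

/-! ### Continuity in time of the localized energy -/

section LocalEnergy

variable {N : ℕ} {u : E N × ℝ → ℝ}

/-- Near each time `t₀` the norm exceeds its value at `t₀` by at most `1`; compactness of `[0, T]`
does the rest. -/
theorem ContinuousInL2loc.exists_bound {T : ℝ} (h : ContinuousInL2loc (Icc 0 T) u)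
    {K : Set (E N)} (hK : IsCompact K) :
    ∃ M : ℝ≥0, ∀ t ∈ Icc 0 T, eLpNorm (fun x => u (x, t)) 2 (volume.restrict K) ≤ M := by
  refine (isCompact_Icc (a := (0 : ℝ)) (b := T)).induction_on
    (p := fun s => ∃ M : ℝ≥0, ∀ t ∈ s ∩ Icc 0 T, eLpNorm (fun x => u (x, t)) 2 (volume.restrict K) ≤ M)
    ⟨0, by simp⟩ (fun s t hst ⟨M, hM⟩ => ⟨M, fun x hx => hM x ⟨hst hx.1, hx.2⟩⟩) ?_ ?_ |>.imp
    fun M hM t ht => hM t ⟨ht, ht⟩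
  · rintro s t ⟨M, hM⟩ ⟨M', hM'⟩
    refine ⟨max M M', fun x hx => ?_⟩
    rcases hx.1 with h1 | h1
    · exact (hM x ⟨h1, hx.2⟩).trans (by exact_mod_cast le_max_left M M')
    · exact (hM' x ⟨h1, hx.2⟩).trans (by exact_mod_cast le_max_right M M')
  · intro t₀ ht₀
    have hfin := (h.memLp t₀ ht₀ K hK).2
    refine ⟨_, (h.tendsto t₀ ht₀ K hK).eventually (gt_mem_nhds (zero_lt_one (α := ℝ≥0∞))),
      (1 + (eLpNorm (fun x => u (x, t₀)) 2 (volume.restrict K)).toNNReal), fun t ht => ?_⟩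
    have h1 : eLpNorm (fun x => u (x, t) - u (x, t₀)) 2 (volume.restrict K) < 1 := ht.1
    have h2 : (fun x => u (x, t)) = (fun x => u (x, t) - u (x, t₀)) + fun x => u (x, t₀) := by
      ext x; simp
    rw [ENNReal.coe_add, ENNReal.coe_toNNReal hfin.ne, h2]
    refine (eLpNorm_add_le ?_ (h.memLp t₀ ht₀ K hK).1 one_le_two).trans ?_
    · exact (h.memLp t ht.2 K hK).1.sub (h.memLp t₀ ht₀ K hK).1
    · gcongr
      exact_mod_cast h1.le

theorem volume_restrict_prod (K : Set (E N)) (I : Set ℝ) :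
    (volume : Measure (E N × ℝ)).restrict (K ×ˢ I) =
      (volume.restrict K).prod (volume.restrict I) :=
  (Measure.prod_restrict K I).symm

theorem ContinuousInL2loc.memLp_two {T : ℝ} (h : ContinuousInL2loc (Icc 0 T) u)
    (hu : AEStronglyMeasurable u (volume.restrict (strip N (T : EReal))))
    {K : Set (E N)} (hK : IsCompact K) : MemLp u 2 (volume.restrict (K ×ˢ Ioo 0 T)) := by
  have hum : AEStronglyMeasurable u (volume.restrict (K ×ˢ Ioo 0 T)) :=
    hu.mono_measure (Measure.restrict_mono (by rw [strip_coe]; exact prod_mono_left (subset_univ _))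
      le_rfl)
  refine ⟨hum, ?_⟩
  obtain ⟨M, hM⟩ := h.exists_bound hK
  have e1 : ∀ {α : Type} [MeasurableSpace α] (μ : Measure α) (f : α → ℝ),
      ∫⁻ x, ‖f x‖ₑ ^ ((2 : ℝ≥0) : ℝ) ∂μ = eLpNorm f 2 μ ^ ((2 : ℝ≥0) : ℝ) := fun μ f =>
    (eLpNorm_nnreal_pow_eq_lintegral (p := 2) two_ne_zero).symm
  have hlt : ∫⁻ z in K ×ˢ Ioo 0 T, ‖u z‖ₑ ^ ((2 : ℝ≥0) : ℝ) < ⊤ := by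
    rw [volume_restrict_prod] at hum ⊢
    rw [lintegral_prod_symm _ (hum.enorm.pow_const _)]
    calc ∫⁻ t in Ioo 0 T, ∫⁻ x in K, ‖u (x, t)‖ₑ ^ ((2 : ℝ≥0) : ℝ)
        ≤ ∫⁻ t in Ioo 0 T, (M : ℝ≥0∞) ^ ((2 : ℝ≥0) : ℝ) := by
          refine setLIntegral_mono measurable_const fun t ht => ?_
          rw [e1]
          exact ENNReal.rpow_le_rpow (hM t (Ioo_subset_Icc_self ht)) (by positivity)
      _ < ⊤ := by
          rw [lintegral_const]
          refine ENNReal.mul_lt_top (ENNReal.rpow_lt_top_of_nonneg (by positivity) (by simp)) ?_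
          simp
  have h2 := eLpNorm_nnreal_pow_eq_lintegral (f := u) (p := 2) (μ := volume.restrict (K ×ˢ Ioo 0 T))
    two_ne_zero
  rw [← h2] at hlt
  by_contra hcon
  rw [not_lt, top_le_iff] at hcon
  rw [show ((2 : ℝ≥0) : ℝ≥0∞) = 2 by norm_num, hcon, ENNReal.top_rpow_of_pos (by simp)] at hlt
  exact lt_irrefl _ hlt

/-- The energy `∫ G(u(x, t)) ζ(x) dx`, where `G'' = γ`. -/
noncomputable def localEnergy (u : E N × ℝ → ℝ) (γ : ℝ → ℝ) (ζ : E N → ℝ) (t : ℝ) : ℝ :=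
  ∫ x, prim (prim γ) (u (x, t)) * ζ x

variable {γ : ℝ → ℝ} {ζ : E N → ℝ}

theorem IsEnergyDensity.continuous_prim_prim (hγ : IsEnergyDensity γ) :
    Continuous (prim (prim γ)) := continuous_prim (continuous_prim hγ.continuous)

theorem integrable_energy {I : Set ℝ} (h : ContinuousInL2loc I u) (hγ : IsEnergyDensity γ)
    (hζ : Continuous ζ) (hζc : HasCompactSupport ζ) {t : ℝ} (ht : t ∈ I) :
    Integrable fun x => prim (prim γ) (u (x, t)) * ζ x := by
  have hm := h.memLp t ht _ hζc
  obtain ⟨C, -, hC⟩ := exists_bound_of_hasCompactSupport hζ hζc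
  have h1 : IntegrableOn (fun x => prim (prim γ) (u (x, t))) (tsupport ζ) := by
    refine ((memLp_two_iff_integrable_sq hm.1).1 hm).mono'
      (hγ.continuous_prim_prim.comp_aestronglyMeasurable hm.1) (Eventually.of_forall fun x => ?_)
    refine (hγ.abs_prim_prim_le _).trans_eq ?_
    rw [abs_mul_abs_self, sq]
  have h2 : IntegrableOn (fun x => prim (prim γ) (u (x, t)) * ζ x) (tsupport ζ) :=
    h1.mul_bdd (c := C) hζ.aestronglyMeasurable (Eventually.of_forall hC)
  rw [← integrableOn_univ]
  refine h2.of_forall_sdiff_eq_zero MeasurableSet.univ fun x hx => ?_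
  rw [image_eq_zero_of_notMem_tsupport hx.2, mul_zero]

/-- With `d = u(·, t) - u(·, s)`, the integrands differ by at most a constant times `|d| (|d| +
|u(·, s)|)` on the support of `ζ`, so Hölder's inequality gives convergence in `L¹`. -/
theorem continuousOn_localEnergy {I : Set ℝ} (h : ContinuousInL2loc I u)
    (hγ : IsEnergyDensity γ) (hζ : Continuous ζ) (hζc : HasCompactSupport ζ) :
    ContinuousOn (localEnergy u γ ζ) I := by
  intro s hs
  set μ : Measure (E N) := volume.restrict (tsupport ζ)
  have hmem := fun t ht => h.memLp t ht _ hζc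
  obtain ⟨C, hC0, hC⟩ := exists_bound_of_hasCompactSupport hζ hζc
  refine tendsto_integral_of_L1' _ (integrable_energy h hγ hζ hζc hs).1
    (eventually_mem_nhdsWithin.mono fun t ht => integrable_energy h hγ hζ hζc ht) ?_
  set d : ℝ → E N → ℝ := fun t x => u (x, t) - u (x, s)
  set b : E N → ℝ := fun x => u (x, s)
  have hd := h.tendsto s hs _ hζc
  have hbound : ∀ t ∈ I, eLpNorm ((fun x => prim (prim γ) (u (x, t)) * ζ x) -
      fun x => prim (prim γ) (u (x, s)) * ζ x) 1 volume ≤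
      ENNReal.ofReal C * (eLpNorm (d t) 2 μ * (eLpNorm (d t) 2 μ + eLpNorm b 2 μ)) := by
    intro t ht
    have hdm : AEStronglyMeasurable (d t) μ := (hmem t ht).1.sub (hmem s hs).1
    have hbm : AEStronglyMeasurable b μ := (hmem s hs).1
    have e1 : ((fun x => prim (prim γ) (u (x, t)) * ζ x) -
        fun x => prim (prim γ) (u (x, s)) * ζ x) = (tsupport ζ).indicator (fun x =>
          (prim (prim γ) (u (x, t)) - prim (prim γ) (u (x, s))) * ζ x) := by
      ext x
      by_cases hx : x ∈ tsupport ζ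
      · rw [indicator_of_mem hx, Pi.sub_apply]; ring
      · rw [indicator_of_notMem hx, Pi.sub_apply, image_eq_zero_of_notMem_tsupport hx]; ring
    rw [e1, eLpNorm_indicator_eq_eLpNorm_restrict (isClosed_tsupport ζ).measurableSet]
    refine (eLpNorm_le_mul_eLpNorm_of_ae_le_mul (c := C)
      (g := (fun x => |d t x|) • fun x => |d t x| + |b x|) (Eventually.of_forall fun x => ?_) 1).trans
      (mul_le_mul_right ?_ _)
    · rw [Real.norm_eq_abs, Real.norm_eq_abs, abs_mul, mul_comm]
      refine mul_le_mul (hC x) ((hγ.abs_prim_prim_sub_le _ _).trans (le_abs_self _))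
        (abs_nonneg _) hC0
    · refine (eLpNorm_smul_le_mul_eLpNorm (p := 2) (q := 2) (hdm.norm.add hbm.norm) hdm.norm).trans ?_
      have n1 : eLpNorm (fun x => ‖d t x‖) 2 μ = eLpNorm (d t) 2 μ := eLpNorm_norm _
      have n2 : eLpNorm (fun x => ‖b x‖) 2 μ = eLpNorm b 2 μ := eLpNorm_norm _
      have n3 := eLpNorm_add_le (p := 2) hdm.norm hbm.norm one_le_two
      rw [n1, n2] at n3
      rw [← n1] at n3 ⊢
      exact mul_le_mul' le_rfl n3
  have hlim : Tendsto (fun t => ENNReal.ofReal C *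
      (eLpNorm (d t) 2 μ * (eLpNorm (d t) 2 μ + eLpNorm b 2 μ))) (𝓝[I] s) (𝓝 0) := by
    have hb : eLpNorm b 2 μ ≠ ⊤ := (hmem s hs).2.ne
    have h1 : Tendsto (fun t => eLpNorm (d t) 2 μ + eLpNorm b 2 μ) (𝓝[I] s)
        (𝓝 (0 + eLpNorm b 2 μ)) := hd.add tendsto_const_nhds
    rw [zero_add] at h1
    have h2 := ENNReal.Tendsto.mul hd (Or.inr hb) h1 (Or.inr ENNReal.zero_ne_top)
    rw [zero_mul] at h2
    have h3 := ENNReal.Tendsto.const_mul h2 (a := ENNReal.ofReal C) (Or.inr ENNReal.ofReal_ne_top)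
    rwa [mul_zero] at h3
  exact tendsto_of_tendsto_of_tendsto_of_le_of_le' tendsto_const_nhds hlim
    (Eventually.of_forall fun _ => zero_le) (eventually_mem_nhdsWithin.mono hbound)

end LocalEnergy

/-- The smaller number is replaced by the larger. The bound separates `a` from `b`, which will be
values at two different points. -/
theorem rpow_sub_one_mul_le_add {p a b : ℝ} (hp : 1 < p) (ha : 0 ≤ a) (hb : 0 ≤ b) :
    a ^ (p - 1) * b ≤ a ^ p + b ^ p := by
  rcases le_total a b with h | h
  · have : a ^ (p - 1) * b ≤ b ^ p := by
      rw [rpow_eq_rpow_sub_one_mul hp hb]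
      exact mul_le_mul_of_nonneg_right (Real.rpow_le_rpow ha h (by linarith)) hb
    linarith [Real.rpow_nonneg ha p]
  · have : a ^ (p - 1) * b ≤ a ^ p := by
      rw [rpow_eq_rpow_sub_one_mul hp ha]
      exact mul_le_mul_of_nonneg_left h (Real.rpow_nonneg ha _)
    linarith [Real.rpow_nonneg hb p]

theorem exists_Ioo_of_isCompact {T : ℝ} (hT : 0 < T) {K : Set ℝ} (hK : IsCompact K)
    (h : K ⊆ Ioo 0 T) : ∃ t₁ t₂, 0 < t₁ ∧ t₁ < t₂ ∧ t₂ < T ∧ K ⊆ Ioo t₁ t₂ := by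
  rcases K.eq_empty_or_nonempty with rfl | hne
  · exact ⟨T / 3, T / 2, by linarith, by linarith, by linarith, empty_subset _⟩
  · obtain ⟨a, ha⟩ := hK.exists_isLeast hne
    obtain ⟨b, hb⟩ := hK.exists_isGreatest hne
    have h1 := h ha.1
    have h2 := h hb.1
    have h3 : a ≤ b := ha.2 hb.1
    simp only [mem_Ioo] at h1 h2
    refine ⟨a / 2, (b + T) / 2, by linarith, by linarith, by linarith, fun x hx => ?_⟩
    have h4 : a ≤ x := ha.2 hx
    have h5 : x ≤ b := hb.2 hx
    exact ⟨by linarith, by linarith⟩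

/-! ### Weak solutions on cylinders: integrability and the energy identity -/

section Solution

variable {N : ℕ} {p : Fin N → ℝ} {Λ T : ℝ} {A : E N × ℝ → ℝ → E N → E N} {u₀ : E N → ℝ}
  {u : E N × ℝ → ℝ} {Du : E N × ℝ → E N}

theorem IsAnisotropicField.mono {T T' : EReal} (hA : IsAnisotropicField p Λ T A) (h : T' ≤ T) :
    IsAnisotropicField p Λ T' A where
  measurable := hA.measurable
  coercive y hy := hA.coercive y (strip_mono h hy)
  growth y hy := hA.growth y (strip_mono h hy)

/-- The cylinder `B_r × ]0, T[`. -/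
def cylinder (N : ℕ) (T r : ℝ) : Set (E N × ℝ) := Metric.ball 0 r ×ˢ Ioo 0 T

theorem isOpen_cylinder (r : ℝ) : IsOpen (cylinder N T r) := Metric.isOpen_ball.prod isOpen_Ioo

theorem measurableSet_cylinder (r : ℝ) : MeasurableSet (cylinder N T r) :=
  (isOpen_cylinder r).measurableSet

theorem cylinder_subset_strip (r : ℝ) : cylinder N T r ⊆ strip N (T : EReal) := by
  rw [strip_coe]; exact prod_mono_left (subset_univ _)

theorem cylinder_subset_closedBall (r : ℝ) :
    cylinder N T r ⊆ Metric.closedBall 0 r ×ˢ Ioo 0 T :=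
  prod_mono_left Metric.ball_subset_closedBall

theorem volume_cylinder_lt_top (r : ℝ) : volume (cylinder N T r) < ⊤ := by
  rw [cylinder, Measure.volume_eq_prod, Measure.prod_prod]
  exact ENNReal.mul_lt_top measure_ball_lt_top (by simp)

/-- The flux `A(x, t, u, Du)`. -/
def flux (A : E N × ℝ → ℝ → E N → E N) (u : E N × ℝ → ℝ) (Du : E N × ℝ → E N) (z : E N × ℝ) :
    E N := A z (u z) (Du z)

theorem integrableOn_rpow_gradient (h : SolvesCauchyWith p A u₀ T u Du) (hp : ∀ i, 1 < p i)
    (r : ℝ) (i : Fin N) : IntegrableOn (fun z => |Du z i| ^ p i) (cylinder N T r) := by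
  have hpi := hp i
  have h1 := (h.gradient_memLp _ (isCompact_closedBall 0 r) i).integrable_norm_rpow
    (by simp; linarith) ENNReal.ofReal_ne_top
  rw [ENNReal.toReal_ofReal (by linarith)] at h1
  exact IntegrableOn.mono_set h1 (cylinder_subset_closedBall r)

theorem integrableOn_rpow_abs (hp : ∀ i, 1 < p i) {i : Fin N}
    (hu : MemLp u (ENNReal.ofReal (p i)) (volume.restrict (strip N (T : EReal)))) :
    IntegrableOn (fun z => |u z| ^ p i) (strip N (T : EReal)) := by
  have hpi := hp i
  have h1 := hu.integrable_norm_rpow (by simp; linarith) ENNReal.ofReal_ne_top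
  rwa [ENNReal.toReal_ofReal (by linarith)] at h1

theorem aestronglyMeasurable_gradient (h : SolvesCauchyWith p A u₀ T u Du) :
    AEStronglyMeasurable Du (volume.restrict (strip N (T : EReal))) :=
  h.gradient.gradient_locallyIntegrable.aestronglyMeasurable

theorem aestronglyMeasurable_gradient_apply (h : SolvesCauchyWith p A u₀ T u Du) (i : Fin N) :
    AEStronglyMeasurable (fun z => Du z i) (volume.restrict (strip N (T : EReal))) :=
  (EuclideanSpace.proj (𝕜 := ℝ) i).continuous.comp_aestronglyMeasurable
    (aestronglyMeasurable_gradient h)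

theorem aestronglyMeasurable_flux (h : SolvesCauchyWith p A u₀ T u Du)
    (hA : IsAnisotropicField p Λ (T : EReal) A) (i : Fin N) :
    AEStronglyMeasurable (fun z => flux A u Du z i) (volume.restrict (strip N (T : EReal))) := by
  have hu := h.gradient.locallyIntegrable.aestronglyMeasurable.aemeasurable
  have h1 : AEMeasurable (fun z => (z, u z, Du z)) (volume.restrict (strip N (T : EReal))) :=
    aemeasurable_id.prodMk (hu.prodMk (aestronglyMeasurable_gradient h).aemeasurable)
  have h2 := hA.measurable.comp_aemeasurable h1
  exact (EuclideanSpace.proj (𝕜 := ℝ) i).continuous.comp_aestronglyMeasurable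
    h2.aestronglyMeasurable

theorem integrableOn_gradient (h : SolvesCauchyWith p A u₀ T u Du) (hp : ∀ i, 1 < p i) (r : ℝ)
    (i : Fin N) : IntegrableOn (fun z => Du z i) (cylinder N T r) := by
  have : IntegrableOn (fun z => 1 + |Du z i| ^ p i) (cylinder N T r) :=
    (integrableOn_const (volume_cylinder_lt_top r).ne).add (integrableOn_rpow_gradient h hp r i)
  refine Integrable.mono' this ((aestronglyMeasurable_gradient_apply h i).mono_measure
    (Measure.restrict_mono (cylinder_subset_strip r) le_rfl)) (Eventually.of_forall fun z => ?_)
  have := rpow_sub_one_mul_le_add (hp i) zero_le_one (abs_nonneg (Du z i))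
  simpa using this

theorem integrableOn_flux (h : SolvesCauchyWith p A u₀ T u Du) (hp : ∀ i, 1 < p i) (hΛ : 0 < Λ)
    (hA : IsAnisotropicField p Λ (T : EReal) A) (r : ℝ) (i : Fin N) :
    IntegrableOn (fun z => flux A u Du z i) (cylinder N T r) := by
  have : IntegrableOn (fun z => Λ * (|Du z i| ^ p i + 1)) (cylinder N T r) :=
    ((integrableOn_rpow_gradient h hp r i).add
      (integrableOn_const (volume_cylinder_lt_top r).ne)).const_mul Λ
  refine Integrable.mono' this ((aestronglyMeasurable_flux h hA i).mono_measure
    (Measure.restrict_mono (cylinder_subset_strip r) le_rfl))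
    ((ae_restrict_mem (measurableSet_cylinder r)).mono fun z hz => ?_)
  refine (hA.growth z (cylinder_subset_strip r hz) _ _ i).trans
    (mul_le_mul_of_nonneg_left ?_ hΛ.le)
  have := rpow_sub_one_mul_le_add (hp i) (abs_nonneg (Du z i)) zero_le_one
  simpa using this

theorem integrableOn_sq (h : SolvesCauchyWith p A u₀ T u Du) (r : ℝ) :
    IntegrableOn (fun z => u z ^ 2) (cylinder N T r) := by
  have h1 := h.continuous.memLp_two h.gradient.locallyIntegrable.aestronglyMeasurable
    (isCompact_closedBall 0 r)
  exact IntegrableOn.mono_set ((memLp_two_iff_integrable_sq h1.1).1 h1)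
    (cylinder_subset_closedBall r)

theorem integrableOn_cylinder (h : SolvesCauchyWith p A u₀ T u Du) (r : ℝ) :
    IntegrableOn u (cylinder N T r) :=
  IntegrableOn.mono_set (memLp_one_iff_integrable.1 (h.memLp _ (isCompact_closedBall 0 r)))
    (cylinder_subset_closedBall r)

/-- The weak formulation, for test functions compactly supported in a cylinder. -/
theorem integral_mul_dt_eq (h : SolvesCauchyWith p A u₀ T u Du) (hT : 0 < T) (hp : ∀ i, 1 < p i)
    (hΛ : 0 < Λ) (hA : IsAnisotropicField p Λ (T : EReal) A) (r : ℝ) {φ : E N × ℝ → ℝ}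
    (hφ : ContDiff ℝ ∞ φ) (hc : HasCompactSupport φ) (hs : tsupport φ ⊆ cylinder N T r) :
    ∫ z, (cylinder N T r).indicator u z * fderiv ℝ φ z (0, 1) =
      ∑ i, ∫ z, (cylinder N T r).indicator (fun z => flux A u Du z i) z *
        fderiv ℝ φ z (EuclideanSpace.single i 1, 0) := by
  -- The weak formulation is used between times that enclose the support of `φ`, so that both slice
  -- integrals drop out.
  obtain ⟨t₁, t₂, h1, h12, h2, hI⟩ := exists_Ioo_of_isCompact hT
    (hc.isCompact.image continuous_snd) (by
      rintro _ ⟨z, hz, rfl⟩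
      exact (hs hz).2)
  have htest : IsTestFunction T φ := by
    refine ⟨hφ.contDiffOn, fun a b _ _ => ⟨Prod.fst '' tsupport φ,
      hc.isCompact.image continuous_fst, fun x hx t _ => ?_⟩⟩
    exact image_eq_zero_of_notMem_tsupport fun hz => hx ⟨_, hz, rfl⟩
  have hout : ∀ x t, t ∉ Ioo t₁ t₂ → (x, t) ∉ tsupport φ := fun x t ht hz =>
    ht (hI ⟨_, hz, rfl⟩)
  have hw := h.weak_formulation t₁ t₂ h1 h12 h2 φ htest
  have z1 : ∀ x, φ (x, t₁) = 0 := fun x =>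
    image_eq_zero_of_notMem_tsupport (hout x t₁ (by simp))
  have z2 : ∀ x, φ (x, t₂) = 0 := fun x =>
    image_eq_zero_of_notMem_tsupport (hout x t₂ (by simp))
  simp only [z1, z2, mul_zero, integral_zero, sub_self, zero_add] at hw
  have hd : ∀ (v : E N × ℝ), ∀ z ∉ tsupport φ, fderiv ℝ φ z v = 0 := fun v =>
    fderiv_eq_zero_of_tsupport_subset Subset.rfl v
  rw [setIntegral_eq_integral_of_forall_compl_eq_zero] at hw
  · have hB := measurableSet_cylinder (N := N) (T := T) r
    have hint : ∀ {f : E N × ℝ → ℝ}, IntegrableOn f (cylinder N T r) → ∀ v,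
        Integrable fun z => (cylinder N T r).indicator f z * fderiv ℝ φ z v := by
      intro f hf v
      obtain ⟨C, -, hC⟩ := exists_bound_of_hasCompactSupport (continuous_fderiv_apply hφ v)
        (hasCompactSupport_fderiv_apply hc v)
      exact (hf.integrable_indicator hB).mul_bdd (c := C)
        (continuous_fderiv_apply hφ v).aestronglyMeasurable (Eventually.of_forall hC)
    have i1 := hint (integrableOn_cylinder h r) (0, 1)
    have i2 := fun i => hint (integrableOn_flux h hp hΛ hA r i) (EuclideanSpace.single i 1, 0)
    have e1 : ∀ z, -(u z * dt φ z) + ∑ i : Fin N, A z (u z) (Du z) i * dx φ i z =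
        -((cylinder N T r).indicator u z * fderiv ℝ φ z (0, 1)) +
        ∑ i, (cylinder N T r).indicator (fun z => flux A u Du z i) z *
        fderiv ℝ φ z (EuclideanSpace.single i 1, 0) := by
      intro z
      by_cases hz : z ∈ cylinder N T r
      · simp only [indicator_of_mem hz, dt, dx, flux]
      · have hz' : z ∉ tsupport φ := fun h' => hz (hs h')
        simp only [indicator_of_notMem hz, dt, dx, hd _ z hz']
        simp
    simp only [e1] at hw
    have i3 : Integrable fun z => -((cylinder N T r).indicator u z * fderiv ℝ φ z (0, 1)) := i1.neg
    rw [integral_add i3 (integrable_finsetSum _ fun i _ => i2 i), integral_neg,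
      integral_finsetSum _ fun i _ => i2 i] at hw
    linarith
  · rintro ⟨x, t⟩ hz
    have hz' := hout x t fun ht => hz ⟨trivial, ht⟩
    simp [dt, dx, hd _ _ hz']

/-- The energy identity of a solution of the Cauchy problem, localized to a cylinder. -/
theorem SolvesCauchyWith.energy_identity (h : SolvesCauchyWith p A u₀ T u Du) (hT : 0 < T)
    (hp : ∀ i, 1 < p i) (hΛ : 0 < Λ) (hA : IsAnisotropicField p Λ (T : EReal) A)
    (hu : ∀ i, MemLp u (ENNReal.ofReal (p i)) (volume.restrict (strip N (T : EReal))))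
    {γ : ℝ → ℝ} (hγ : IsEnergyDensity γ) (r : ℝ) {φ : E N × ℝ → ℝ}
    (hφ : ContDiff ℝ ∞ φ) (hc : HasCompactSupport φ) (hs : tsupport φ ⊆ cylinder N T r) :
    let B := cylinder N T r
    Integrable (fun z => prim (prim γ) (B.indicator u z) * fderiv ℝ φ z (0, 1) -
      ∑ i, B.indicator (fun z => flux A u Du z i) z * (γ (B.indicator u z) *
        B.indicator (fun z => Du z i) z * φ z +
        prim γ (B.indicator u z) * fderiv ℝ φ z (EuclideanSpace.single i 1, 0))) ∧
    ∫ z, (prim (prim γ) (B.indicator u z) * fderiv ℝ φ z (0, 1) -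
      ∑ i, B.indicator (fun z => flux A u Du z i) z * (γ (B.indicator u z) *
        B.indicator (fun z => Du z i) z * φ z +
        prim γ (B.indicator u z) * fderiv ℝ φ z (EuclideanSpace.single i 1, 0))) = 0 := by
  intro B
  have hB : MeasurableSet B := measurableSet_cylinder r
  have hBS : B ⊆ strip N (T : EReal) := cylinder_subset_strip r
  have c0 := continuous_prim hγ.continuous
  -- One majorant for all products: `u²` for `u u`, the gradient powers for flux times gradient, and
  -- additionally `|u| ^ p i` for flux times `u`.
  set H : E N × ℝ → ℝ := fun z => u z ^ 2 + Λ * ∑ i, (|Du z i| ^ p i + |u z| ^ p i) with hH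
  have Hi : IntegrableOn H B := (integrableOn_sq h r).add
    ((integrable_finsetSum _ fun i _ => (integrableOn_rpow_gradient h hp r i).add
      ((integrableOn_rpow_abs hp (hu i)).mono_set hBS)).const_mul Λ)
  have hsum : ∀ z i, 0 ≤ |Du z i| ^ p i + |u z| ^ p i := fun z i => by positivity
  have H1 : ∀ i z, Λ * (|Du z i| ^ p i + |u z| ^ p i) ≤ H z := fun i z => by
    have := Finset.single_le_sum (f := fun i => |Du z i| ^ p i + |u z| ^ p i)
      (fun i _ => hsum z i) (Finset.mem_univ i)
    have := mul_le_mul_of_nonneg_left this hΛ.le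
    simp only [hH]
    linarith [sq_nonneg (u z)]
  have H2 : ∀ z, u z ^ 2 ≤ H z := fun z => by
    have := mul_nonneg hΛ.le (Finset.sum_nonneg fun i (_ : i ∈ Finset.univ) => hsum z i)
    simp only [hH]; linarith
  have H0 : ∀ z, 0 ≤ H z := fun z => (sq_nonneg _).trans (H2 z)
  have key : ∀ f g : E N × ℝ → ℝ, (∀ y ∈ B, ∀ y' ∈ B, |f y| * |g y'| ≤ H y + H y') →
      ∀ y y', |B.indicator f y| * |B.indicator g y'| ≤ B.indicator H y + B.indicator H y' := by
    intro f g hfg y y'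
    by_cases hy : y ∈ B
    · by_cases hy' : y' ∈ B
      · simpa [hy, hy'] using hfg y hy y' hy'
      · simpa [hy, hy'] using H0 y
    · have : 0 ≤ B.indicator H y' := indicator_nonneg (fun z _ => H0 z) y'
      simpa [hy] using this
  refine integral_energy_identity (μ := volume) (isOpen_cylinder r) (h := B.indicator H)
    ((integrableOn_cylinder h r).integrable_indicator hB)
    (fun i => (integrableOn_gradient h hp r i).integrable_indicator hB)
    (fun i => (integrableOn_flux h hp hΛ hA r i).integrable_indicator hB)
    (Hi.integrable_indicator hB) (key u u fun y _ y' _ => ?_)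
    (fun i => key _ _ fun y hy y' _ => ?_) (fun i => key _ _ fun y hy y' _ => ?_)
    (fun i => h.gradient.isWeakDerivOn hBS i)
    (fun φ hφ hc hs => integral_mul_dt_eq h hT hp hΛ hA r hφ hc hs)
    (hasDerivAt_prim c0) (hasDerivAt_prim hγ.continuous) hγ.continuous hγ.abs_le_one
    hγ.abs_prim_le_abs hγ.abs_prim_prim_le hφ hc hs
  · have h1 := H2 y
    have h2 := H2 y'
    rw [← sq_abs] at h1 h2
    nlinarith [sq_nonneg (|u y| - |u y'|)]
  · calc |flux A u Du y i| * |Du y' i| ≤ Λ * |Du y i| ^ (p i - 1) * |Du y' i| :=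
          mul_le_mul_of_nonneg_right (hA.growth y (hBS hy) _ _ i) (abs_nonneg _)
      _ = Λ * (|Du y i| ^ (p i - 1) * |Du y' i|) := by ring
      _ ≤ Λ * (|Du y i| ^ p i + |Du y' i| ^ p i) := mul_le_mul_of_nonneg_left
          (rpow_sub_one_mul_le_add (hp i) (abs_nonneg _) (abs_nonneg _)) hΛ.le
      _ ≤ Λ * (|Du y i| ^ p i + |u y| ^ p i) + Λ * (|Du y' i| ^ p i + |u y'| ^ p i) := by
          have h1 : 0 ≤ Λ * |u y| ^ p i := by positivity
          have h2 : 0 ≤ Λ * |u y'| ^ p i := by positivity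
          linarith
      _ ≤ _ := add_le_add (H1 i y) (H1 i y')
  · calc |flux A u Du y i| * |u y'| ≤ Λ * |Du y i| ^ (p i - 1) * |u y'| :=
          mul_le_mul_of_nonneg_right (hA.growth y (hBS hy) _ _ i) (abs_nonneg _)
      _ = Λ * (|Du y i| ^ (p i - 1) * |u y'|) := by ring
      _ ≤ Λ * (|Du y i| ^ p i + |u y'| ^ p i) := mul_le_mul_of_nonneg_left
          (rpow_sub_one_mul_le_add (hp i) (abs_nonneg _) (abs_nonneg _)) hΛ.le
      _ ≤ Λ * (|Du y i| ^ p i + |u y| ^ p i) + Λ * (|Du y' i| ^ p i + |u y'| ^ p i) := by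
          have h1 : 0 ≤ Λ * |u y| ^ p i := by positivity
          have h2 : 0 ≤ Λ * |Du y' i| ^ p i := by positivity
          linarith
      _ ≤ _ := add_le_add (H1 i y) (H1 i y')

end Solution

/-! ### Test functions with separated variables -/

section Product

variable {N : ℕ} {ζ : E N → ℝ} {ψ : ℝ → ℝ}

theorem fderiv_mul_comp_fst_snd (hζ : ContDiff ℝ ∞ ζ) (hψ : ContDiff ℝ ∞ ψ) (z v : E N × ℝ) :
    fderiv ℝ (fun z : E N × ℝ => ζ z.1 * ψ z.2) z v =
      fderiv ℝ ζ z.1 v.1 * ψ z.2 + ζ z.1 * (deriv ψ z.2 * v.2) := by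
  have h1 : HasFDerivAt (fun z : E N × ℝ => ζ z.1)
      ((fderiv ℝ ζ z.1).comp (ContinuousLinearMap.fst ℝ (E N) ℝ)) z :=
    ((hζ.differentiable (by simp) z.1).hasFDerivAt).comp z hasFDerivAt_fst
  have h2 : HasFDerivAt (fun z : E N × ℝ => ψ z.2)
      (deriv ψ z.2 • ContinuousLinearMap.snd ℝ (E N) ℝ) z :=
    ((hψ.differentiable (by simp) z.2).hasDerivAt).comp_hasFDerivAt z hasFDerivAt_snd
  rw [(h1.fun_mul h2).fderiv]
  simp
  ring

theorem tsupport_mul_subset_prod {s t : ℝ} (hψ : ∀ τ ∉ Icc s t, ψ τ = 0) :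
    (tsupport fun z : E N × ℝ => ζ z.1 * ψ z.2) ⊆ tsupport ζ ×ˢ Icc s t := by
  refine closure_minimal (fun z hz => ?_) ((isClosed_tsupport ζ).prod isClosed_Icc)
  refine ⟨subset_tsupport _ (left_ne_zero_of_mul hz), ?_⟩
  by_contra hcon
  exact right_ne_zero_of_mul hz (hψ _ hcon)

theorem deriv_eq_zero_of_notMem_Icc {s t : ℝ} (hψ : ∀ τ ∉ Icc s t, ψ τ = 0) {τ : ℝ}
    (hτ : τ ∉ Icc s t) : deriv ψ τ = 0 := by
  have : ψ =ᶠ[𝓝 τ] fun _ => 0 := by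
    filter_upwards [isClosed_Icc.isOpen_compl.mem_nhds hτ] with x hx
    exact hψ x hx
  rw [this.deriv_eq, deriv_const]

end Product

/-! ### Local energy inequalities -/

section Solution

variable {N : ℕ} {p : Fin N → ℝ} {Λ T : ℝ} {A : E N × ℝ → ℝ → E N → E N} {u₀ : E N → ℝ}
  {u : E N × ℝ → ℝ} {Du : E N × ℝ → E N} {γ : ℝ → ℝ} {ζ : E N → ℝ}

theorem exists_tsupport_subset_ball (hc : HasCompactSupport ζ) :
    ∃ r, tsupport ζ ⊆ Metric.ball 0 r := by
  obtain ⟨r, -, hr⟩ := hc.isCompact.isBounded.subset_ball_lt 0 0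
  exact ⟨r, hr⟩

/-- The support of `ζ` is compact in space and the gradient is integrable up to times `0` and `T`;
the other two factors are bounded. -/
theorem integrableOn_gradient_energy (h : SolvesCauchyWith p A u₀ T u Du) (hp : ∀ i, 1 < p i)
    (hγ : IsEnergyDensity γ) (hζ : Continuous ζ) (hc : HasCompactSupport ζ) (i : Fin N) :
    IntegrableOn (fun z => γ (u z) * |Du z i| ^ p i * ζ z.1) (strip N (T : EReal)) := by
  obtain ⟨r, hr⟩ := exists_tsupport_subset_ball hc
  obtain ⟨C, -, hC⟩ := exists_bound_of_hasCompactSupport hζ hc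
  have h1 : IntegrableOn (fun z => |Du z i| ^ p i * (γ (u z) * ζ z.1)) (cylinder N T r) := by
    have hum := h.gradient.locallyIntegrable.aestronglyMeasurable.mono_measure
      (Measure.restrict_mono (cylinder_subset_strip (N := N) (T := T) r) le_rfl)
    refine Integrable.mul_bdd (c := C) (integrableOn_rpow_gradient h hp r i)
      ((hγ.continuous.comp_aestronglyMeasurable hum).mul
        (hζ.comp continuous_fst).aestronglyMeasurable) (Eventually.of_forall fun z => ?_)
    rw [Real.norm_eq_abs, abs_mul]
    exact (mul_le_of_le_one_left (abs_nonneg _) (hγ.abs_le_one _)).trans (hC _)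
  refine (h1.of_forall_sdiff_eq_zero (measurableSet_strip _) fun z hz => ?_).congr_fun
    (fun z _ => by ring) (measurableSet_strip _)
  rw [strip_coe] at hz
  have : z.1 ∉ tsupport ζ := fun h' => hz.2 ⟨hr h', hz.1.2⟩
  rw [image_eq_zero_of_notMem_tsupport this, mul_zero, mul_zero]

/-- The energy inequality, tested with a product `ζ(x) ψ(t)`. -/
theorem SolvesCauchyWith.integral_energy_le (h : SolvesCauchyWith p A u₀ T u Du) (hT : 0 < T)
    (hp : ∀ i, 1 < p i) (hΛ : 0 < Λ) (hA : IsAnisotropicField p Λ (T : EReal) A)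
    (hu : ∀ i, MemLp u (ENNReal.ofReal (p i)) (volume.restrict (strip N (T : EReal))))
    (hγ : IsEnergyDensity γ) (hζ : ContDiff ℝ ∞ ζ) (hc : HasCompactSupport ζ)
    (hζ0 : ∀ x, 0 ≤ ζ x) {κ : ℝ} (hκ : 0 ≤ κ)
    (hζκ : ∀ x i, |fderiv ℝ ζ x (EuclideanSpace.single i 1)| ≤ κ * ζ x ^ ((p i - 1) / p i))
    {C : Fin N → ℝ} (hC0 : ∀ i, 0 ≤ C i) (hC : ∀ i (a b : ℝ), 0 ≤ a → 0 ≤ b →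
      Λ * a ^ (p i - 1) * b ≤ Λ⁻¹ / 2 * a ^ p i + C i * b ^ p i)
    {s t : ℝ} (hs : 0 < s) (ht : t < T) {ψ : ℝ → ℝ} (hψ : ContDiff ℝ ∞ ψ) (hψ0 : ∀ τ, 0 ≤ ψ τ)
    (hψst : ∀ τ ∉ Icc s t, ψ τ = 0) :
    ∫ z in strip N (T : EReal), (∑ i, (Λ⁻¹ / 2 * (γ (u z) * |Du z i| ^ p i * ζ z.1) -
      C i * κ ^ p i * |u z| ^ p i)) * ψ z.2 ≤ ∫ τ, localEnergy u γ ζ τ * deriv ψ τ := by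
  obtain ⟨r, hr⟩ := exists_tsupport_subset_ball hc
  set B := cylinder N T r with hBdef
  have hB : MeasurableSet B := measurableSet_cylinder r
  set φ : E N × ℝ → ℝ := fun z => ζ z.1 * ψ z.2 with hφdef
  have hIT : Icc s t ⊆ Ioo 0 T := fun x hx => ⟨hs.trans_le hx.1, hx.2.trans_lt ht⟩
  have hφ : ContDiff ℝ ∞ φ := (hζ.comp contDiff_fst).mul (hψ.comp contDiff_snd)
  have hts := tsupport_mul_subset_prod (ζ := ζ) hψst
  have hφc : HasCompactSupport φ :=
    (hc.isCompact.prod isCompact_Icc).of_isClosed_subset (isClosed_tsupport _) hts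
  have hφB : tsupport φ ⊆ B := hts.trans (prod_mono hr hIT)
  have hd1 : ∀ z, fderiv ℝ φ z (0, 1) = ζ z.1 * deriv ψ z.2 := fun z => by
    rw [fderiv_mul_comp_fst_snd hζ hψ]; simp
  have hd2 : ∀ z i, fderiv ℝ φ z (EuclideanSpace.single i 1, 0) =
      fderiv ℝ ζ z.1 (EuclideanSpace.single i 1) * ψ z.2 := fun z i => by
    rw [fderiv_mul_comp_fst_snd hζ hψ]; simp
  obtain ⟨Fi, F0⟩ := h.energy_identity hT hp hΛ hA hu hγ r hφ hφc hφB
  rw [← hBdef] at Fi F0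
  set f := B.indicator u with hf
  set P : E N × ℝ → ℝ := fun z => prim (prim γ) (f z) * fderiv ℝ φ z (0, 1) with hP
  set Q : E N × ℝ → ℝ := fun z => ∑ i, B.indicator (fun z => flux A u Du z i) z *
    (γ (f z) * B.indicator (fun z => Du z i) z * φ z +
      prim γ (f z) * fderiv ℝ φ z (EuclideanSpace.single i 1, 0)) with hQ
  have hfm : Integrable f := (integrableOn_cylinder h r).integrable_indicator hB
  have Pi : Integrable P := by
    obtain ⟨M, -, hM⟩ := exists_bound_of_hasCompactSupport (continuous_fderiv_apply hφ (0, 1))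
      (hasCompactSupport_fderiv_apply hφc (0, 1))
    have h1 : Integrable (B.indicator fun z => u z ^ 2) :=
      (integrableOn_sq h r).integrable_indicator hB
    have h2 : Integrable fun z => prim (prim γ) (f z) := by
      refine h1.mono' (hγ.continuous_prim_prim.comp_aestronglyMeasurable hfm.1)
        (Eventually.of_forall fun z => (hγ.abs_prim_prim_le _).trans_eq ?_)
      rw [abs_mul_abs_self]
      by_cases hz : z ∈ B <;> simp [hf, hz, sq]
    exact h2.mul_bdd (c := M) (continuous_fderiv_apply hφ (0, 1)).aestronglyMeasurable
      (Eventually.of_forall hM)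
  have Qi : Integrable Q := (Pi.sub Fi).congr (Eventually.of_forall fun z => by simp [hP, hQ])
  have PQ : ∫ z, P z = ∫ z, Q z := by
    rw [integral_sub Pi Qi] at F0
    linarith
  have Pe : ∫ z, P z = ∫ τ, localEnergy u γ ζ τ * deriv ψ τ := by
    rw [Measure.volume_eq_prod, integral_prod_symm P Pi]
    refine integral_congr_ae (Eventually.of_forall fun τ => ?_)
    simp only [localEnergy]
    rw [← integral_mul_const]
    refine integral_congr_ae (Eventually.of_forall fun x => ?_)
    simp only [hP, hd1, ← mul_assoc]
    -- Replacing `u` by its cut-off to the cylinder changes nothing, since outside it either `ζ` or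
    -- the derivative of `ψ` vanishes.
    by_cases hτ : τ ∈ Icc s t
    · by_cases hx : x ∈ Metric.ball 0 r
      · have : ((x, τ) : E N × ℝ) ∈ B := ⟨hx, hIT hτ⟩
        simp only [hf, indicator_of_mem this]
      · have : x ∉ tsupport ζ := fun h' => hx (hr h')
        simp only [image_eq_zero_of_notMem_tsupport this, mul_zero]
    · simp only [deriv_eq_zero_of_notMem_Icc hψst hτ, mul_zero]
  have Qs : ∫ z in strip N (T : EReal), Q z = ∫ z, Q z := by
    refine setIntegral_eq_integral_of_forall_compl_eq_zero fun z hz => ?_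
    have : z ∉ B := fun h' => hz (cylinder_subset_strip r h')
    simp [hQ, this]
  rw [← Pe, PQ, ← Qs]
  refine setIntegral_mono_on ?_ Qi.integrableOn (measurableSet_strip _) fun z hz => ?_
  · obtain ⟨M, -, hM⟩ := exists_bound_of_hasCompactSupport hψ.continuous
      (HasCompactSupport.intro isCompact_Icc hψst)
    exact Integrable.mul_bdd (c := M) (integrable_finsetSum _ fun i _ =>
      ((integrableOn_gradient_energy h hp hγ hζ.continuous hc i).const_mul _).sub
        ((integrableOn_rpow_abs hp (hu i)).const_mul _))
      (hψ.continuous.comp continuous_snd).aestronglyMeasurable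
      (Eventually.of_forall fun z => hM z.2)
  · simp only [hQ, Finset.sum_mul]
    refine Finset.sum_le_sum fun i _ => ?_
    have hpi := hp i
    by_cases hzB : z ∈ B
    · simp only [hf, indicator_of_mem hzB, hd2]
      have hco := hA.coercive z hz (u z) (Du z) i
      have hgr := hA.growth z hz (u z) (Du z) i
      change Λ⁻¹ * |Du z i| ^ p i ≤ flux A u Du z i * Du z i at hco
      change |flux A u Du z i| ≤ Λ * |Du z i| ^ (p i - 1) at hgr
      set a := flux A u Du z i
      set d := Du z i
      set Dζ := fderiv ℝ ζ z.1 (EuclideanSpace.single i 1)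
      have hζz := hζ0 z.1
      have g0 := hγ.nonneg (u z)
      have hDζ : |Dζ| ≤ κ * ζ z.1 ^ ((p i - 1) / p i) := hζκ z.1 i
      -- The weight is distributed so that the power `p i - 1` of the first factor contains exactly
      -- the power of `ζ` that bounds its derivative, and the power `p i` reproduces `ζ`.
      have hyoung := hC i (|d| * ζ z.1 ^ (1 / p i)) (κ * |u z|) (by positivity) (by positivity)
      have r1 : (|d| * ζ z.1 ^ (1 / p i)) ^ (p i - 1) =
          |d| ^ (p i - 1) * ζ z.1 ^ ((p i - 1) / p i) := by
        rw [Real.mul_rpow (abs_nonneg _) (by positivity), ← Real.rpow_mul hζz]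
        congr 2; ring
      have r2 : (|d| * ζ z.1 ^ (1 / p i)) ^ p i = |d| ^ p i * ζ z.1 := by
        rw [Real.mul_rpow (abs_nonneg _) (by positivity), ← Real.rpow_mul hζz,
          one_div_mul_cancel (by linarith), Real.rpow_one]
      rw [r1, r2, Real.mul_rpow hκ (abs_nonneg _)] at hyoung
      -- The bound `|prim γ| ≤ γ |·|` keeps the factor `γ (u z)` in front of the gradient; without
      -- it the term could not be absorbed where `γ (u z) = 0`.
      have hX : -(a * (prim γ (u z) * Dζ)) ≤
          γ (u z) * (Λ⁻¹ / 2 * (|d| ^ p i * ζ z.1) + C i * (κ ^ p i * |u z| ^ p i)) := by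
        calc -(a * (prim γ (u z) * Dζ)) ≤ |a * (prim γ (u z) * Dζ)| := neg_le_abs _
          _ = |a| * (|prim γ (u z)| * |Dζ|) := by rw [abs_mul, abs_mul]
          _ ≤ (Λ * |d| ^ (p i - 1)) * ((γ (u z) * |u z|) * (κ * ζ z.1 ^ ((p i - 1) / p i))) := by
            gcongr
            exact hγ.abs_prim_le _
          _ = γ (u z) * (Λ * (|d| ^ (p i - 1) * ζ z.1 ^ ((p i - 1) / p i)) * (κ * |u z|)) := by
            ring
          _ ≤ _ := mul_le_mul_of_nonneg_left hyoung g0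
      have hY : γ (u z) * (C i * (κ ^ p i * |u z| ^ p i)) ≤ C i * (κ ^ p i * |u z| ^ p i) :=
        mul_le_of_le_one_left (mul_nonneg (hC0 i) (by positivity)) (hγ.le_one _)
      have hZ : Λ⁻¹ * |d| ^ p i * (γ (u z) * ζ z.1) ≤ a * d * (γ (u z) * ζ z.1) :=
        mul_le_mul_of_nonneg_right hco (mul_nonneg g0 hζz)
      calc (Λ⁻¹ / 2 * (γ (u z) * |d| ^ p i * ζ z.1) - C i * κ ^ p i * |u z| ^ p i) * ψ z.2
          ≤ (a * d * (γ (u z) * ζ z.1) + a * (prim γ (u z) * Dζ)) * ψ z.2 :=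
            mul_le_mul_of_nonneg_right (by nlinarith) (hψ0 _)
        _ = _ := by simp only [hφdef]; ring
    -- Outside the cylinder only the nonpositive error term survives on the left.
    · have hz1 : z.1 ∉ tsupport ζ := fun h' => hzB ⟨hr h', by
        rw [strip_coe] at hz; exact hz.2⟩
      simp only [indicator_of_notMem hzB, image_eq_zero_of_notMem_tsupport hz1]
      have := mul_nonneg (mul_nonneg (mul_nonneg (hC0 i) (Real.rpow_nonneg hκ (p i)))
        (Real.rpow_nonneg (abs_nonneg (u z)) (p i))) (hψ0 z.2)
      simp only [mul_zero, zero_mul, zero_sub, neg_mul]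
      linarith

/-- The local energy inequality between two times. -/
theorem SolvesCauchyWith.localEnergy_add_le (h : SolvesCauchyWith p A u₀ T u Du) (hT : 0 < T)
    (hp : ∀ i, 1 < p i) (hΛ : 0 < Λ) (hA : IsAnisotropicField p Λ (T : EReal) A)
    (hu : ∀ i, MemLp u (ENNReal.ofReal (p i)) (volume.restrict (strip N (T : EReal))))
    (hγ : IsEnergyDensity γ) (hζ : ContDiff ℝ ∞ ζ) (hc : HasCompactSupport ζ)
    (hζ0 : ∀ x, 0 ≤ ζ x) {κ : ℝ} (hκ : 0 ≤ κ)
    (hζκ : ∀ x i, |fderiv ℝ ζ x (EuclideanSpace.single i 1)| ≤ κ * ζ x ^ ((p i - 1) / p i))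
    {C : Fin N → ℝ} (hC0 : ∀ i, 0 ≤ C i) (hC : ∀ i (a b : ℝ), 0 ≤ a → 0 ≤ b →
      Λ * a ^ (p i - 1) * b ≤ Λ⁻¹ / 2 * a ^ p i + C i * b ^ p i)
    {s t : ℝ} (hs : 0 < s) (hst : s < t) (ht : t < T) :
    localEnergy u γ ζ t +
      Λ⁻¹ / 2 * ∑ i, ∫ z in univ ×ˢ Ioo s t, γ (u z) * |Du z i| ^ p i * ζ z.1 ≤
      localEnergy u γ ζ s +
        ∑ i, C i * κ ^ p i * ∫ z in strip N (T : EReal), |u z| ^ p i := by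
  obtain ⟨ψ, hψ, hψ0, hψ1, hψz, hψlim, hψe⟩ := exists_time_cutoff hst
  set S := strip N (T : EReal) with hS
  have hI : (univ : Set (E N)) ×ˢ Ioo s t ⊆ S := by
    rw [hS, strip_coe]
    exact prod_mono_right (Ioo_subset_Ioo hs.le ht.le)
  have hIm : MeasurableSet ((univ : Set (E N)) ×ˢ Ioo s t) := MeasurableSet.univ.prod measurableSet_Ioo
  set J : E N × ℝ → ℝ := fun z => ∑ i, (Λ⁻¹ / 2 * (γ (u z) * |Du z i| ^ p i * ζ z.1) -
      C i * κ ^ p i * |u z| ^ p i) with hJ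
  have i1 := integrableOn_gradient_energy h hp hγ hζ.continuous hc
  have i2 := fun i => integrableOn_rpow_abs hp (hu i)
  have Ji : IntegrableOn J S := integrable_finsetSum _ fun i _ =>
      ((i1 i).const_mul _).sub ((i2 i).const_mul _)
  have l1 : Tendsto (fun n => ∫ z in S, J z * ψ n z.2) atTop
      (𝓝 (∫ z in S, (univ ×ˢ Ioo s t).indicator J z)) := by
    refine tendsto_integral_of_dominated_convergence (fun z => |J z|) (fun n => ?_) Ji.abs
      (fun n => Eventually.of_forall fun z => ?_) (Eventually.of_forall fun z => ?_)
    · exact Ji.1.mul ((hψ n).continuous.comp continuous_snd).aestronglyMeasurable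
    · rw [Real.norm_eq_abs, abs_mul, abs_of_nonneg (hψ0 n _)]
      exact mul_le_of_le_one_right (abs_nonneg _) (hψ1 n _)
    · by_cases hz : z.2 ∈ Ioo s t
      · rw [indicator_of_mem (mk_mem_prod (mem_univ z.1) hz)]
        simpa using (hψlim _ hz).const_mul (J z)
      · rw [indicator_of_notMem fun h' : z ∈ univ ×ˢ Ioo s t => hz h'.2]
        simp only [hψz _ _ hz, mul_zero]
        exact tendsto_const_nhds
  have hcont : ContinuousOn (localEnergy u γ ζ) (Icc s t) :=
    (continuousOn_localEnergy h.continuous hγ hζ.continuous hc).mono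
      (Icc_subset_Icc hs.le ht.le)
  have hle := le_of_tendsto_of_tendsto' l1 (hψe _ hcont) fun n =>
    h.integral_energy_le hT hp hΛ hA hu hγ hζ hc hζ0 hκ hζκ hC0 hC hs ht (hψ n) (hψ0 n)
      fun τ hτ => hψz n τ fun h' => hτ (Ioo_subset_Icc_self h')
  have e1 : ∫ z in S, (univ ×ˢ Ioo s t).indicator J z =
      Λ⁻¹ / 2 * (∑ i, ∫ z in univ ×ˢ Ioo s t, γ (u z) * |Du z i| ^ p i * ζ z.1) -
        ∑ i, C i * κ ^ p i * ∫ z in univ ×ˢ Ioo s t, |u z| ^ p i := by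
    rw [setIntegral_indicator hIm, inter_eq_right.2 hI, hJ, integral_finsetSum]
    · rw [Finset.mul_sum, ← Finset.sum_sub_distrib]
      refine Finset.sum_congr rfl fun i _ => ?_
      rw [integral_sub, integral_const_mul, integral_const_mul]
      · exact ((i1 i).mono_set hI).const_mul _
      · exact ((i2 i).mono_set hI).const_mul _
    · intro i _
      exact (((i1 i).mono_set hI).const_mul _).sub (((i2 i).mono_set hI).const_mul _)
  -- Enlarging the domain to the whole strip makes the error independent of `s` and `t`.
  have e2 : ∑ i, C i * κ ^ p i * ∫ z in univ ×ˢ Ioo s t, |u z| ^ p i ≤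
      ∑ i, C i * κ ^ p i * ∫ z in S, |u z| ^ p i := by
    refine Finset.sum_le_sum fun i _ => mul_le_mul_of_nonneg_left ?_
      (mul_nonneg (hC0 i) (Real.rpow_nonneg hκ _))
    exact setIntegral_mono_set (i2 i) (Eventually.of_forall fun z => by positivity)
      hI.eventuallyLE
  rw [e1] at hle
  linarith

end Solution

/-- Tail infima converge to the lower limits and add up to at most `X n + Y n`. No convergence of
`X` or `Y` is needed, so the lemma combines two applications of Fatou's lemma. -/
theorem add_le_of_le_liminf {X Y ε : ℕ → ℝ≥0∞} {x y z : ℝ≥0∞} (hx : x ≤ liminf X atTop)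
    (hy : y ≤ liminf Y atTop) (h : ∀ n, X n + Y n ≤ z + ε n) (hε : Tendsto ε atTop (𝓝 0)) :
    x + y ≤ z := by
  have key : ∀ X : ℕ → ℝ≥0∞, Tendsto (fun n => ⨅ i ≥ n, X i) atTop (𝓝 (liminf X atTop)) := fun X => by
    rw [liminf_eq_iSup_iInf_of_nat]
    exact tendsto_atTop_iSup fun m n hmn => biInf_mono fun i hi => hmn.trans hi
  refine (add_le_add hx hy).trans (le_of_tendsto_of_tendsto' ((key X).add (key Y))
    (by simpa using hε.const_add z) fun n => le_trans ?_ (h n))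
  exact add_le_add (iInf₂_le n (le_refl n)) (iInf₂_le n (le_refl n))

/-! ### Global energy inequality and decay of the L² norm -/

section Solution

variable {N : ℕ} {p : Fin N → ℝ} {Λ T : ℝ} {A : E N × ℝ → ℝ → E N → E N} {u₀ : E N → ℝ}
  {u : E N × ℝ → ℝ} {Du : E N × ℝ → E N}

theorem ofReal_localEnergy {I : Set ℝ} (h : ContinuousInL2loc I u) {γ : ℝ → ℝ}
    (hγ : IsEnergyDensity γ) {ζ : E N → ℝ} (hζ : Continuous ζ) (hc : HasCompactSupport ζ)
    (hζ0 : ∀ x, 0 ≤ ζ x) {t : ℝ} (ht : t ∈ I) :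
    ENNReal.ofReal (localEnergy u γ ζ t) =
      ∫⁻ x, ENNReal.ofReal (prim (prim γ) (u (x, t)) * ζ x) :=
  ofReal_integral_eq_lintegral_ofReal (integrable_energy h hγ hζ hc ht)
    (Eventually.of_forall fun x => mul_nonneg (hγ.prim_prim_nonneg _) (hζ0 x))

theorem aestronglyMeasurable_slice {I : Set ℝ} (h : ContinuousInL2loc I u) {t : ℝ} (ht : t ∈ I) :
    AEStronglyMeasurable (fun x => u (x, t)) := by
  have h1 : ∀ n : ℕ, AEStronglyMeasurable (fun x => u (x, t))
      (volume.restrict (Metric.closedBall (0 : E N) n)) := fun n =>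
    (h.memLp t ht _ (isCompact_closedBall 0 _)).1
  have h2 := aestronglyMeasurable_iUnion_iff.2 h1
  rwa [Metric.iUnion_closedBall_nat, Measure.restrict_univ] at h2

/-- The cut-offs and errors depend neither on `γ` nor on the times, so `γ` may vary with `n` and the
times may tend to the endpoints. -/
theorem exists_energy_cutoff (hp : ∀ i, 1 < p i) (hΛ : 0 < Λ)
    (hA : IsAnisotropicField p Λ (T : EReal) A) (hT : 0 < T)
    (h : SolvesCauchyWith p A u₀ T u Du)
    (hu : ∀ i, MemLp u (ENNReal.ofReal (p i)) (volume.restrict (strip N (T : EReal)))) :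
    ∃ (ζ : ℕ → E N → ℝ) (ε : ℕ → ℝ), (∀ n, Continuous (ζ n)) ∧
      (∀ n, HasCompactSupport (ζ n)) ∧ (∀ n x, 0 ≤ ζ n x) ∧ (∀ n x, ζ n x ≤ 1) ∧
      (∀ x, Tendsto (fun n => ζ n x) atTop (𝓝 1)) ∧ (∀ n, 0 ≤ ε n) ∧
      Tendsto ε atTop (𝓝 0) ∧
      ∀ n γ, IsEnergyDensity γ → ∀ s t, 0 < s → s < t → t < T →
        localEnergy u γ (ζ n) t +
          Λ⁻¹ / 2 * ∑ i, ∫ z in univ ×ˢ Ioo s t, γ (u z) * |Du z i| ^ p i * ζ n z.1 ≤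
        localEnergy u γ (ζ n) s + ε n := by
  choose C hC0 hC using fun i => exists_rpow_mul_le (ε := Λ⁻¹ / 2) (M := Λ) (hp i) (by positivity)
    hΛ.le
  obtain ⟨ζ, κ, hζ, hζc, hζ0, hζ1, hζlim, hκ0, hκ, hζκ⟩ := exists_space_cutoff p hp
  have hε0 : ∀ n, 0 ≤ ∑ i, C i * κ n ^ p i * ∫ z in strip N (T : EReal), |u z| ^ p i :=
    fun n => Finset.sum_nonneg fun i _ => mul_nonneg
      (mul_nonneg (hC0 i) (Real.rpow_nonneg (hκ0 n) _))
      (integral_nonneg fun z => Real.rpow_nonneg (abs_nonneg _) _)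
  refine ⟨ζ, fun n => ∑ i, C i * κ n ^ p i * ∫ z in strip N (T : EReal), |u z| ^ p i,
    fun n => (hζ n).continuous, hζc, hζ0, hζ1, hζlim, hε0, ?_,
    fun n γ hγ s t hs hst ht => h.localEnergy_add_le hT hp hΛ hA hu hγ (hζ n) (hζc n) (hζ0 n)
      (hκ0 n) (hζκ n) hC0 hC hs hst ht⟩
  have h1 : ∀ i, Tendsto (fun n => C i * κ n ^ p i * ∫ z in strip N (T : EReal), |u z| ^ p i)
      atTop (𝓝 0) := fun i => by
    have hpi := hp i
    have h2 := hκ.rpow_const (p := p i) (Or.inr (by linarith))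
    rw [Real.zero_rpow (by linarith)] at h2
    simpa using (h2.const_mul (C i)).mul_const (∫ z in strip N (T : EReal), |u z| ^ p i)
  simpa using tendsto_finsetSum Finset.univ fun i _ => h1 i

/-- The global energy inequality. -/
theorem SolvesCauchyWith.lintegral_energy_add_le (h : SolvesCauchyWith p A u₀ T u Du) (hT : 0 < T)
    (hp : ∀ i, 1 < p i) (hΛ : 0 < Λ) (hA : IsAnisotropicField p Λ (T : EReal) A)
    (hu : ∀ i, MemLp u (ENNReal.ofReal (p i)) (volume.restrict (strip N (T : EReal))))
    {γ : ℕ → ℝ → ℝ} {γ₀ G₀ : ℝ → ℝ} (hγ : ∀ n, IsEnergyDensity (γ n))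
    (hγlim : ∀ x, Tendsto (fun n => γ n x) atTop (𝓝 (γ₀ x)))
    (hGlim : ∀ x, Tendsto (fun n => prim (prim (γ n)) x) atTop (𝓝 (G₀ x)))
    (hGle : ∀ n x, prim (prim (γ n)) x ≤ G₀ x) {s t : ℝ} (hs : 0 < s) (hst : s < t) (ht : t < T) :
    (∫⁻ x, ENNReal.ofReal (G₀ (u (x, t)))) +
      ENNReal.ofReal (Λ⁻¹ / 2) *
        ∫⁻ z in univ ×ˢ Ioo s t, ∑ i, ENNReal.ofReal (γ₀ (u z) * |Du z i| ^ p i) ≤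
      ∫⁻ x, ENNReal.ofReal (G₀ (u (x, s))) := by
  obtain ⟨ζ, ε, hζ, hζc, hζ0, hζ1, hζlim, hε0, hε, hmain⟩ := exists_energy_cutoff hp hΛ hA hT h hu
  have htI : t ∈ Icc 0 T := ⟨(hs.trans hst).le, ht.le⟩
  have hsI : s ∈ Icc 0 T := ⟨hs.le, (hst.trans ht).le⟩
  have hI : (univ : Set (E N)) ×ˢ Ioo s t ⊆ strip N (T : EReal) := by
    rw [strip_coe]
    exact prod_mono_right (Ioo_subset_Ioo hs.le ht.le)
  have hγ0 := fun n => (hγ n).nonneg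
  have i1 := fun n i => (integrableOn_gradient_energy h hp (hγ n) (hζ n) (hζc n) i).mono_set hI
  have p1 : ∀ n i z, 0 ≤ γ n (u z) * |Du z i| ^ p i * ζ n z.1 := fun n i z =>
    mul_nonneg (mul_nonneg (hγ0 n _) (Real.rpow_nonneg (abs_nonneg _) _)) (hζ0 n _)
  -- A single index drives both the cut-off and the energy density. Fatou's lemma bounds the two
  -- terms on the left from below; the right-hand side uses only `ζ n ≤ 1` and `prim (prim (γ n)) ≤
  -- G₀`.
  refine add_le_of_le_liminf
    (X := fun n => ∫⁻ x, ENNReal.ofReal (prim (prim (γ n)) (u (x, t)) * ζ n x))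
    (Y := fun n => ENNReal.ofReal (Λ⁻¹ / 2) * ∫⁻ z in univ ×ˢ Ioo s t,
      ∑ i, ENNReal.ofReal (γ n (u z) * |Du z i| ^ p i * ζ n z.1))
    (ε := fun n => ENNReal.ofReal (ε n)) ?_ ?_ (fun n => ?_) ?_
  · refine (lintegral_mono fun x => ?_).trans (lintegral_liminf_le' fun n => ?_)
    · have := ENNReal.tendsto_ofReal ((hGlim (u (x, t))).mul (hζlim x))
      rw [mul_one] at this
      exact this.liminf_eq.ge
    · exact (integrable_energy h.continuous (hγ n) (hζ n) (hζc n) htI).1.aemeasurable.ennreal_ofReal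
  · have h1 : ∫⁻ z in univ ×ˢ Ioo s t, ∑ i, ENNReal.ofReal (γ₀ (u z) * |Du z i| ^ p i) ≤
        liminf (fun n => ∫⁻ z in univ ×ˢ Ioo s t,
          ∑ i, ENNReal.ofReal (γ n (u z) * |Du z i| ^ p i * ζ n z.1)) atTop := by
      refine (lintegral_mono fun z => ?_).trans (lintegral_liminf_le' fun n => ?_)
      · have := tendsto_finsetSum Finset.univ fun i _ =>
          ENNReal.tendsto_ofReal (((hγlim (u z)).mul_const (|Du z i| ^ p i)).mul (hζlim z.1))
        simp only [mul_one] at this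
        exact this.liminf_eq.ge
      · exact Finset.aemeasurable_fun_sum _ fun i _ => (i1 n i).1.aemeasurable.ennreal_ofReal
    rw [ENNReal.liminf_const_mul_of_ne_top ENNReal.ofReal_ne_top]
    gcongr
  · have hm := hmain n (γ n) (hγ n) s t hs hst ht
    have e1 := ofReal_localEnergy h.continuous (hγ n) (hζ n) (hζc n) (hζ0 n) htI
    have e2 := ofReal_localEnergy h.continuous (hγ n) (hζ n) (hζc n) (hζ0 n) hsI
    have nn : 0 ≤ localEnergy u (γ n) (ζ n) t :=
      integral_nonneg fun x => mul_nonneg ((hγ n).prim_prim_nonneg _) (hζ0 n x)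
    have nn' : 0 ≤ localEnergy u (γ n) (ζ n) s :=
      integral_nonneg fun x => mul_nonneg ((hγ n).prim_prim_nonneg _) (hζ0 n x)
    have e3 : ∫⁻ z in univ ×ˢ Ioo s t, ∑ i, ENNReal.ofReal (γ n (u z) * |Du z i| ^ p i * ζ n z.1) =
        ENNReal.ofReal (∑ i, ∫ z in univ ×ˢ Ioo s t, γ n (u z) * |Du z i| ^ p i * ζ n z.1) := by
      rw [lintegral_finsetSum' _ fun i _ => (i1 n i).1.aemeasurable.ennreal_ofReal,
        ENNReal.ofReal_sum_of_nonneg fun i _ => integral_nonneg (p1 n i)]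
      refine Finset.sum_congr rfl fun i _ => ?_
      rw [ofReal_integral_eq_lintegral_ofReal (i1 n i) (Eventually.of_forall (p1 n i))]
    rw [e3, ← e1, ← ENNReal.ofReal_mul (by positivity), ← ENNReal.ofReal_add nn
      (mul_nonneg (by positivity) (Finset.sum_nonneg fun i _ => integral_nonneg (p1 n i)))]
    refine (ENNReal.ofReal_le_ofReal hm).trans ?_
    rw [ENNReal.ofReal_add nn' (hε0 n), e2]
    refine add_le_add_left (lintegral_mono fun x => ENNReal.ofReal_le_ofReal ?_) _
    exact (mul_le_of_le_one_right ((hγ n).prim_prim_nonneg _) (hζ1 n x)).trans (hGle n _)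
  · simpa using ENNReal.tendsto_ofReal hε

/-- The `L²` norm of a solution does not exceed that of the initial datum. -/
theorem SolvesCauchyWith.lintegral_sq_le (h : SolvesCauchyWith p A u₀ T u Du) (hT : 0 < T)
    (hp : ∀ i, 1 < p i) (hΛ : 0 < Λ) (hA : IsAnisotropicField p Λ (T : EReal) A)
    (hu : ∀ i, MemLp u (ENNReal.ofReal (p i)) (volume.restrict (strip N (T : EReal))))
    {t : ℝ} (ht : t ∈ Icc 0 T) :
    ∫⁻ x, ENNReal.ofReal (u (x, t) ^ 2 / 2) ≤ ∫⁻ x, ENNReal.ofReal (u (x, 0) ^ 2 / 2) := by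
  obtain ⟨ζ, ε, hζ, hζc, hζ0, hζ1, hζlim, hε0, hε, hmain⟩ := exists_energy_cutoff hp hΛ hA hT h hu
  have h0 : (0 : ℝ) ∈ Icc 0 T := ⟨le_rfl, hT.le⟩
  have h1 := isEnergyDensity_one
  have hcont := fun n => continuousOn_localEnergy h.continuous h1 (hζ n) (hζc n)
  have step1 : ∀ n, ∀ s t, 0 < s → s < t → t < T →
      localEnergy u (fun _ => 1) (ζ n) t ≤ localEnergy u (fun _ => 1) (ζ n) s + ε n := by
    intro n s t hs hst ht
    refine le_trans ?_ (hmain n _ h1 s t hs hst ht)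
    refine le_add_of_nonneg_right (mul_nonneg (by positivity) (Finset.sum_nonneg fun i _ =>
      integral_nonneg fun z => mul_nonneg (by positivity) (hζ0 n _)))
  -- The endpoints `0` and `T` are reached while the cut-off is still fixed, because only the
  -- localized energy is known to be continuous there.
  have step2 : ∀ n, ∀ t ∈ Ioo 0 T,
      localEnergy u (fun _ => 1) (ζ n) t ≤ localEnergy u (fun _ => 1) (ζ n) 0 + ε n := by
    intro n t ht
    have hl : Tendsto (localEnergy u (fun _ => 1) (ζ n)) (𝓝[Ioo 0 t] 0)
        (𝓝 (localEnergy u (fun _ => 1) (ζ n) 0)) :=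
      (hcont n 0 h0).mono (fun x hx => ⟨hx.1.le, (hx.2.trans ht.2).le⟩)
    have : (𝓝[Ioo 0 t] (0 : ℝ)).NeBot := left_nhdsWithin_Ioo_neBot ht.1
    exact ge_of_tendsto (hl.add_const (ε n)) (eventually_mem_nhdsWithin.mono fun s hs =>
      step1 n s t hs.1 hs.2 ht.2)
  have step3 : ∀ n, localEnergy u (fun _ => 1) (ζ n) t ≤
      localEnergy u (fun _ => 1) (ζ n) 0 + ε n := by
    intro n
    rcases ht.1.eq_or_lt with rfl | ht0
    · linarith [hε0 n]
    rcases ht.2.eq_or_lt with rfl | htT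
    · have hl : Tendsto (localEnergy u (fun _ => 1) (ζ n)) (𝓝[Ioo 0 t] t)
          (𝓝 (localEnergy u (fun _ => 1) (ζ n) t)) := (hcont n t ht).mono Ioo_subset_Icc_self
      have : (𝓝[Ioo 0 t] t).NeBot := right_nhdsWithin_Ioo_neBot ht0
      exact le_of_tendsto hl (eventually_mem_nhdsWithin.mono fun s hs => step2 n s hs)
    · exact step2 n t ⟨ht0, htT⟩
  have hX : ∫⁻ x, ENNReal.ofReal (u (x, t) ^ 2 / 2) ≤
      liminf (fun n => ∫⁻ x, ENNReal.ofReal (prim (prim fun _ => 1) (u (x, t)) * ζ n x)) atTop := by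
    refine (lintegral_mono fun x => ?_).trans (lintegral_liminf_le' fun n => ?_)
    · have := ENNReal.tendsto_ofReal ((hζlim x).const_mul (prim (prim fun _ => 1) (u (x, t))))
      rw [mul_one] at this
      rw [← prim_prim_one]
      exact this.liminf_eq.ge
    · exact (integrable_energy h.continuous h1 (hζ n) (hζc n) ht).1.aemeasurable.ennreal_ofReal
  have := add_le_of_le_liminf (Y := fun _ => 0) (y := 0) (ε := fun n => ENNReal.ofReal (ε n))
    (z := ∫⁻ x, ENNReal.ofReal (u (x, 0) ^ 2 / 2)) hX zero_le (fun n => ?_)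
    (by simpa using ENNReal.tendsto_ofReal hε)
  · simpa using this
  · rw [add_zero, ← ofReal_localEnergy h.continuous h1 (hζ n) (hζc n) (hζ0 n) ht]
    refine (ENNReal.ofReal_le_ofReal (step3 n)).trans (ENNReal.ofReal_add_le.trans ?_)
    rw [ofReal_localEnergy h.continuous h1 (hζ n) (hζc n) (hζ0 n) h0]
    refine add_le_add_left (lintegral_mono fun x => ENNReal.ofReal_le_ofReal ?_) _
    rw [prim_prim_one]
    exact mul_le_of_le_one_right (by positivity) (hζ1 n x)

end Solution

/-! ### Lipschitz weights in time -/

section Weighted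

variable {ν : Measure ℝ} {e ψ : ℝ → ℝ} {L : ℝ≥0} {t₁ t₂ : ℝ}

theorem abs_deriv_le_of_lipschitzOnWith (hψ : LipschitzOnWith L ψ (Icc t₁ t₂)) {τ : ℝ}
    (hτ : τ ∈ Ioo t₁ t₂) : |deriv ψ τ| ≤ L := by
  have := norm_deriv_le_of_lipschitzOn (Icc_mem_nhds hτ.1 hτ.2) hψ
  simpa using this

/-- A Lipschitz function is absolutely continuous, hence the integral of its a.e. derivative. -/
theorem sub_le_integral_abs_deriv (hψ : LipschitzOnWith L ψ (Icc t₁ t₂)) (h : t₁ ≤ t₂) :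
    |ψ t₂ - ψ t₁| ≤ ∫ τ in t₁..t₂, |deriv ψ τ| := by
  have hac : AbsolutelyContinuousOnInterval ψ t₁ t₂ :=
    LipschitzOnWith.absolutelyContinuousOnInterval (by rwa [uIcc_of_le h])
  rw [← hac.integral_deriv_eq_sub]
  exact intervalIntegral.abs_integral_le_integral_abs h

theorem intervalIntegrable_abs_deriv (hψ : LipschitzOnWith L ψ (Icc t₁ t₂)) (h : t₁ ≤ t₂) :
    IntervalIntegrable (fun τ => |deriv ψ τ|) volume t₁ t₂ := by
  have hac : AbsolutelyContinuousOnInterval ψ t₁ t₂ :=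
    LipschitzOnWith.absolutelyContinuousOnInterval (by rwa [uIcc_of_le h])
  exact hac.intervalIntegrable_deriv.abs

/-- The weighted energy inequality on a short interval, with a small error. -/
theorem weighted_energy_step (hlt : t₁ < t₂) (he0 : ∀ τ ∈ Icc t₁ t₂, 0 ≤ e τ)
    (hν : ∀ a b, t₁ ≤ a → a < b → b ≤ t₂ → ν (Ioo a b) + ENNReal.ofReal (e b) ≤ ENNReal.ofReal (e a))
    (hψ : LipschitzOnWith L ψ (Icc t₁ t₂)) (hψ0 : ∀ τ ∈ Icc t₁ t₂, 0 ≤ ψ τ) :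
    ENNReal.ofReal (e t₂ * ψ t₂) + ∫⁻ τ in Ioo t₁ t₂, ENNReal.ofReal (ψ τ) ∂ν ≤
      ENNReal.ofReal (e t₁ * ψ t₁) + (∫⁻ τ in Ioo t₁ t₂, ENNReal.ofReal (e τ * |deriv ψ τ|)) +
        ENNReal.ofReal (2 * L * (t₂ - t₁) * (e t₁ - e t₂)) := by
  have m1 : t₁ ∈ Icc t₁ t₂ := ⟨le_rfl, hlt.le⟩
  have m2 : t₂ ∈ Icc t₁ t₂ := ⟨hlt.le, le_rfl⟩
  have hδ : 0 ≤ L * (t₂ - t₁) := mul_nonneg L.2 (sub_nonneg.2 hlt.le)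
  have hanti : ∀ τ ∈ Ioo t₁ t₂, e t₂ ≤ e τ := fun τ hτ => by
    have := le_add_self.trans (hν τ t₂ hτ.1.le hτ.2 le_rfl)
    exact (ENNReal.ofReal_le_ofReal_iff (he0 τ (Ioo_subset_Icc_self hτ))).1 this
  have hle : e t₂ ≤ e t₁ := (ENNReal.ofReal_le_ofReal_iff (he0 _ m1)).1
    (le_add_self.trans (hν t₁ t₂ le_rfl hlt le_rfl))
  have hν' : ν (Ioo t₁ t₂) ≤ ENNReal.ofReal (e t₁ - e t₂) := by
    rw [ENNReal.ofReal_sub _ (he0 _ m2)]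
    exact ENNReal.le_sub_of_add_le_right ENNReal.ofReal_ne_top (hν t₁ t₂ le_rfl hlt le_rfl)
  have a1 : ∫⁻ τ in Ioo t₁ t₂, ENNReal.ofReal (ψ τ) ∂ν ≤
      ENNReal.ofReal ((ψ t₂ + L * (t₂ - t₁)) * (e t₁ - e t₂)) := by
    calc ∫⁻ τ in Ioo t₁ t₂, ENNReal.ofReal (ψ τ) ∂ν
        ≤ ∫⁻ τ in Ioo t₁ t₂, ENNReal.ofReal (ψ t₂ + L * (t₂ - t₁)) ∂ν := by
          refine setLIntegral_mono measurable_const fun τ hτ => ENNReal.ofReal_le_ofReal ?_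
          have h1 := hψ.dist_le_mul τ (Ioo_subset_Icc_self hτ) t₂ m2
          rw [Real.dist_eq, Real.dist_eq, abs_sub_comm τ, abs_of_pos (sub_pos.2 hτ.2)] at h1
          have h2 : (L : ℝ) * (t₂ - τ) ≤ L * (t₂ - t₁) :=
            mul_le_mul_of_nonneg_left (by linarith [hτ.1]) L.2
          linarith [le_abs_self (ψ τ - ψ t₂)]
      _ ≤ _ := by
          rw [setLIntegral_const, ENNReal.ofReal_mul (add_nonneg (hψ0 _ m2) hδ)]
          gcongr
  set D := ∫ τ in t₁..t₂, |deriv ψ τ| with hD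
  have hDi := intervalIntegrable_abs_deriv hψ hlt.le
  have hDe : ENNReal.ofReal D = ∫⁻ τ in Ioo t₁ t₂, ENNReal.ofReal |deriv ψ τ| := by
    rw [hD, intervalIntegral.integral_of_le hlt.le, integral_Ioc_eq_integral_Ioo,
      ofReal_integral_eq_lintegral_ofReal]
    · exact ((intervalIntegrable_iff_integrableOn_Ioo_of_le hlt.le).1 hDi)
    · exact Eventually.of_forall fun τ => abs_nonneg _
  have hD0 : 0 ≤ D := intervalIntegral.integral_nonneg hlt.le fun τ _ => abs_nonneg _
  have hDle : D ≤ L * (t₂ - t₁) := by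
    have h1 : ENNReal.ofReal D ≤ ENNReal.ofReal (L * (t₂ - t₁)) := by
      rw [hDe]
      refine (setLIntegral_mono (g := fun _ => ENNReal.ofReal L) measurable_const fun τ hτ =>
        ENNReal.ofReal_le_ofReal (abs_deriv_le_of_lipschitzOnWith hψ hτ)).trans ?_
      rw [setLIntegral_const, Real.volume_Ioo, ENNReal.ofReal_mul L.coe_nonneg]
    exact (ENNReal.ofReal_le_ofReal_iff hδ).1 h1
  have a2 : ENNReal.ofReal (e t₂ * D) ≤
      ∫⁻ τ in Ioo t₁ t₂, ENNReal.ofReal (e τ * |deriv ψ τ|) := by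
    rw [ENNReal.ofReal_mul (he0 _ m2), hDe, ← lintegral_const_mul _ (by fun_prop)]
    refine setLIntegral_mono' measurableSet_Ioo fun τ hτ => ?_
    rw [← ENNReal.ofReal_mul (he0 _ m2)]
    exact ENNReal.ofReal_le_ofReal (mul_le_mul_of_nonneg_right (hanti τ hτ) (abs_nonneg _))
  have hsub := sub_le_integral_abs_deriv hψ hlt.le
  -- The left side is `e t₁ * ψ t₂ + L * (t₂ - t₁) * (e t₁ - e t₂)`. Bounding `ψ t₂` by `ψ t₁ + D`,
  -- and trading `e t₁ * D` for `e t₂ * D`, costs a second error of the same size; hence the factor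
  -- `2`.
  have a3 : e t₂ * ψ t₂ + (ψ t₂ + L * (t₂ - t₁)) * (e t₁ - e t₂) ≤
      e t₁ * ψ t₁ + e t₂ * D + 2 * L * (t₂ - t₁) * (e t₁ - e t₂) := by
    have h1 : ψ t₂ - ψ t₁ ≤ D := (le_abs_self _).trans hsub
    have h2 := mul_le_mul_of_nonneg_left h1 (he0 _ m1)
    have h3 := mul_le_mul_of_nonneg_right hDle (sub_nonneg.2 hle)
    nlinarith
  calc _ ≤ ENNReal.ofReal (e t₂ * ψ t₂) +
        ENNReal.ofReal ((ψ t₂ + L * (t₂ - t₁)) * (e t₁ - e t₂)) := by gcongr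
    _ = ENNReal.ofReal (e t₂ * ψ t₂ + (ψ t₂ + L * (t₂ - t₁)) * (e t₁ - e t₂)) :=
      (ENNReal.ofReal_add (mul_nonneg (he0 _ m2) (hψ0 _ m2))
        (mul_nonneg (add_nonneg (hψ0 _ m2) hδ) (sub_nonneg.2 hle))).symm
    _ ≤ ENNReal.ofReal (e t₁ * ψ t₁ + e t₂ * D + 2 * L * (t₂ - t₁) * (e t₁ - e t₂)) :=
      ENNReal.ofReal_le_ofReal a3
    _ ≤ _ := ENNReal.ofReal_add_le.trans (add_le_add_left (ENNReal.ofReal_add_le.trans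
      (add_le_add_right a2 _)) _)

theorem setLIntegral_Ioo_add_Ioo {μ : Measure ℝ} [NullSingletonClass μ] (f : ℝ → ℝ≥0∞) {a b c : ℝ}
    (hab : a ≤ b) (hbc : b ≤ c) :
    ∫⁻ τ in Ioo a c, f τ ∂μ = ∫⁻ τ in Ioo a b, f τ ∂μ + ∫⁻ τ in Ioo b c, f τ ∂μ := by
  simp only [setLIntegral_congr (Ioo_ae_eq_Ioc (μ := μ))]
  rw [← Ioc_union_Ioc_eq_Ioc hab hbc, lintegral_union measurableSet_Ioc
    (Ioc_disjoint_Ioc_of_le le_rfl)]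

/-- A nonincreasing energy satisfies the energy inequality with Lipschitz weights. -/
theorem weighted_energy_le [NullSingletonClass ν] (hlt : t₁ < t₂) (he0 : ∀ τ ∈ Icc t₁ t₂, 0 ≤ e τ)
    (hν : ∀ a b, t₁ ≤ a → a < b → b ≤ t₂ → ν (Ioo a b) + ENNReal.ofReal (e b) ≤ ENNReal.ofReal (e a))
    (hψ : LipschitzOnWith L ψ (Icc t₁ t₂)) (hψ0 : ∀ τ ∈ Icc t₁ t₂, 0 ≤ ψ τ) :
    ENNReal.ofReal (e t₂ * ψ t₂) + ∫⁻ τ in Ioo t₁ t₂, ENNReal.ofReal (ψ τ) ∂ν ≤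
      ENNReal.ofReal (e t₁ * ψ t₁) + ∫⁻ τ in Ioo t₁ t₂, ENNReal.ofReal (e τ * |deriv ψ τ|) := by
  have hanti : ∀ a b, t₁ ≤ a → a < b → b ≤ t₂ → e b ≤ e a := fun a b h1 h2 h3 =>
    (ENNReal.ofReal_le_ofReal_iff (he0 a ⟨h1, h2.le.trans h3⟩)).1
      (le_add_self.trans (hν a b h1 h2 h3))
  -- On `m` equal pieces the errors carry the drop of `e` over each piece; they telescope, and the
  -- total is of order `1 / m`.
  have key : ∀ m : ℕ, 0 < m →
      ENNReal.ofReal (e t₂ * ψ t₂) + ∫⁻ τ in Ioo t₁ t₂, ENNReal.ofReal (ψ τ) ∂ν ≤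
      ENNReal.ofReal (e t₁ * ψ t₁) + (∫⁻ τ in Ioo t₁ t₂, ENNReal.ofReal (e τ * |deriv ψ τ|)) +
        ENNReal.ofReal (2 * L * ((t₂ - t₁) / m) * (e t₁ - e t₂)) := by
    intro m hm
    have hm' : (0 : ℝ) < m := by exact_mod_cast hm
    set η := (t₂ - t₁) / m with hη
    have hη0 : 0 < η := div_pos (sub_pos.2 hlt) hm'
    set x : ℕ → ℝ := fun j => t₁ + j * η with hx
    have x0 : x 0 = t₁ := by simp [hx]
    have xm : x m = t₂ := by simp only [hx, hη]; field_simp; ring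
    have xs : ∀ j, x (j + 1) = x j + η := fun j => by simp only [hx]; push_cast; ring
    have xmono : Monotone x := monotone_nat_of_le_succ fun j => by rw [xs]; linarith
    have ind : ∀ j, j ≤ m →
        ENNReal.ofReal (e (x j) * ψ (x j)) + ∫⁻ τ in Ioo t₁ (x j), ENNReal.ofReal (ψ τ) ∂ν ≤
        ENNReal.ofReal (e t₁ * ψ t₁) +
          (∫⁻ τ in Ioo t₁ (x j), ENNReal.ofReal (e τ * |deriv ψ τ|)) +
          ENNReal.ofReal (2 * L * η * (e t₁ - e (x j))) := by
      intro j
      induction j with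
      | zero => intro _; simp [x0]
      | succ j ih =>
        intro hj
        have h1 := ih (by omega)
        have g1 : t₁ ≤ x j := x0 ▸ xmono (Nat.zero_le j)
        have g2 : x (j + 1) ≤ t₂ := xm ▸ xmono hj
        have g3 : x j < x (j + 1) := by rw [xs]; linarith
        have hsub : Icc (x j) (x (j + 1)) ⊆ Icc t₁ t₂ := Icc_subset_Icc g1 g2
        have h2 := weighted_energy_step (ν := ν) (e := e) g3 (fun τ hτ => he0 τ (hsub hτ))
          (fun a b ha hab hb => hν a b (g1.trans ha) hab (hb.trans g2)) (hψ.mono hsub)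
          (fun τ hτ => hψ0 τ (hsub hτ))
        have g4 : x (j + 1) - x j = η := by rw [xs]; ring
        have g5 : 0 ≤ e (x j) - e (x (j + 1)) := sub_nonneg.2 (hanti _ _ g1 g3 g2)
        have g6 : 0 ≤ e t₁ - e (x j) := by
          rcases g1.eq_or_lt with h | h
          · rw [← h, sub_self]
          · exact sub_nonneg.2 (hanti _ _ le_rfl h (g3.le.trans g2))
        rw [g4] at h2
        have hc : 0 ≤ 2 * (L : ℝ) * η := by positivity
        have g7 : ENNReal.ofReal (2 * L * η * (e t₁ - e (x (j + 1)))) =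
            ENNReal.ofReal (2 * L * η * (e t₁ - e (x j))) +
              ENNReal.ofReal (2 * L * η * (e (x j) - e (x (j + 1)))) := by
          rw [← ENNReal.ofReal_add (mul_nonneg hc g6) (mul_nonneg hc g5)]
          congr 1; ring
        rw [setLIntegral_Ioo_add_Ioo _ g1 g3.le, setLIntegral_Ioo_add_Ioo _ g1 g3.le, g7]
        set a₀ := ENNReal.ofReal (e t₁ * ψ t₁)
        set a₁ := ENNReal.ofReal (e (x j) * ψ (x j))
        set a₂ := ENNReal.ofReal (e (x (j + 1)) * ψ (x (j + 1)))
        set I₁ := ∫⁻ τ in Ioo t₁ (x j), ENNReal.ofReal (ψ τ) ∂ν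
        set I₂ := ∫⁻ τ in Ioo (x j) (x (j + 1)), ENNReal.ofReal (ψ τ) ∂ν
        set J₁ := ∫⁻ τ in Ioo t₁ (x j), ENNReal.ofReal (e τ * |deriv ψ τ|)
        set J₂ := ∫⁻ τ in Ioo (x j) (x (j + 1)), ENNReal.ofReal (e τ * |deriv ψ τ|)
        set E₁ := ENNReal.ofReal (2 * L * η * (e t₁ - e (x j)))
        set E₂ := ENNReal.ofReal (2 * L * η * (e (x j) - e (x (j + 1))))
        calc a₂ + (I₁ + I₂) = (a₂ + I₂) + I₁ := by ring
          _ ≤ (a₁ + J₂ + E₂) + I₁ := by gcongr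
          _ = (a₁ + I₁) + (J₂ + E₂) := by ring
          _ ≤ (a₀ + J₁ + E₁) + (J₂ + E₂) := by gcongr
          _ = a₀ + (J₁ + J₂) + (E₁ + E₂) := by ring
    have := ind m le_rfl
    rwa [xm] at this
  have hlim : Tendsto (fun m : ℕ => ENNReal.ofReal (e t₁ * ψ t₁) +
      (∫⁻ τ in Ioo t₁ t₂, ENNReal.ofReal (e τ * |deriv ψ τ|)) +
        ENNReal.ofReal (2 * L * ((t₂ - t₁) / m) * (e t₁ - e t₂))) atTop
      (𝓝 (ENNReal.ofReal (e t₁ * ψ t₁) +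
      (∫⁻ τ in Ioo t₁ t₂, ENNReal.ofReal (e τ * |deriv ψ τ|)) + 0)) := by
    refine Tendsto.const_add _ ?_
    have h1 : Tendsto (fun m : ℕ => (t₂ - t₁) / (m : ℝ)) atTop (𝓝 0) :=
      tendsto_const_div_atTop_nhds_zero_nat _
    have h2 := ENNReal.tendsto_ofReal ((h1.const_mul (2 * (L : ℝ))).mul_const (e t₁ - e t₂))
    simpa using h2
  rw [add_zero] at hlim
  exact ge_of_tendsto hlim ((eventually_gt_atTop 0).mono key)

end Weighted

theorem eLpNorm_two_sq {α : Type*} [MeasurableSpace α] (μ : Measure α) (f : α → ℝ) :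
    eLpNorm f 2 μ ^ 2 = ∫⁻ x, ENNReal.ofReal (f x ^ 2) ∂μ := by
  have h := eLpNorm_nnreal_pow_eq_lintegral (f := f) (p := 2) (μ := μ) two_ne_zero
  simp only [NNReal.coe_ofNat, ENNReal.rpow_ofNat, ENNReal.coe_ofNat] at h
  rw [h]
  refine lintegral_congr fun x => ?_
  rw [← sq_abs, ENNReal.ofReal_pow (abs_nonneg _), ← Real.enorm_eq_ofReal_abs]

theorem lintegral_ofReal_eq_two_mul {α : Type*} [MeasurableSpace α] (μ : Measure α) (f : α → ℝ) :
    ∫⁻ x, ENNReal.ofReal (f x) ∂μ = 2 * ∫⁻ x, ENNReal.ofReal (f x / 2) ∂μ := by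
  rw [← lintegral_const_mul' _ _ ENNReal.ofNat_ne_top]
  refine lintegral_congr fun x => ?_
  rw [← ENNReal.ofReal_ofNat 2, ← ENNReal.ofReal_mul zero_le_two]
  congr 1; ring

/-! ### Weighted inequalities for truncations of either sign of the level -/

section Solution

variable {N : ℕ} {p : Fin N → ℝ} {Λ T : ℝ} {A : E N × ℝ → ℝ → E N → E N} {u₀ : E N → ℝ}
  {u : E N × ℝ → ℝ} {Du : E N × ℝ → E N}

theorem SolvesCauchyWith.eLpNorm_le (h : SolvesCauchyWith p A u₀ T u Du) (hT : 0 < T)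
    (hp : ∀ i, 1 < p i) (hΛ : 0 < Λ) (hA : IsAnisotropicField p Λ (T : EReal) A)
    (hu : ∀ i, MemLp u (ENNReal.ofReal (p i)) (volume.restrict (strip N (T : EReal))))
    {t : ℝ} (ht : t ∈ Icc 0 T) :
    eLpNorm (fun x => u (x, t)) 2 volume ≤ eLpNorm u₀ 2 volume := by
  rw [← eLpNorm_congr_ae h.initial, ← ENNReal.pow_le_pow_left_iff two_ne_zero, eLpNorm_two_sq,
    eLpNorm_two_sq, lintegral_ofReal_eq_two_mul,
    lintegral_ofReal_eq_two_mul _ fun x => u (x, 0) ^ 2]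
  exact mul_le_mul_right (h.lintegral_sq_le hT hp hΛ hA hu ht) _

/-- The unweighted energy inequality for truncations. -/
theorem SolvesCauchyWith.lintegral_truncation_add_le (h : SolvesCauchyWith p A u₀ T u Du)
    (hT : 0 < T) (hp : ∀ i, 1 < p i) (hΛ : 0 < Λ) (hA : IsAnisotropicField p Λ (T : EReal) A)
    (hu : ∀ i, MemLp u (ENNReal.ofReal (p i)) (volume.restrict (strip N (T : EReal))))
    {k : ℝ} (hk : 0 ≤ k) {s t : ℝ} (hs : 0 < s) (hst : s < t) (ht : t < T) :
    (ENNReal.ofReal (1 / Λ) * ∫⁻ z in univ ×ˢ Ioo s t,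
      ∑ i, ENNReal.ofReal (|{z | k < u z}.indicator Du z i| ^ p i)) +
      ∫⁻ x, ENNReal.ofReal (max (u (x, t) - k) 0 ^ 2) ≤
      ∫⁻ x, ENNReal.ofReal (max (u (x, s) - k) 0 ^ 2) := by
  have h1 := h.lintegral_energy_add_le hT hp hΛ hA hu (isEnergyDensity_ramp hk) (tendsto_ramp k)
    (tendsto_prim_prim_ramp hk) (prim_prim_ramp_le hk) hs hst ht
  have h2 := mul_le_mul_right h1 2
  -- The energy in the limit is half the square of the truncation; doubling it restores the half of
  -- the coercivity spent on Young's inequality.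
  have hc : (2 : ℝ≥0∞) * ENNReal.ofReal (Λ⁻¹ / 2) = ENNReal.ofReal (1 / Λ) := by
    rw [← ENNReal.ofReal_ofNat 2, ← ENNReal.ofReal_mul zero_le_two]
    congr 1; ring
  rw [mul_add, ← lintegral_ofReal_eq_two_mul, ← lintegral_ofReal_eq_two_mul, add_comm,
    ← mul_assoc, hc] at h2
  refine le_trans (le_of_eq ?_) h2
  congr 2
  refine lintegral_congr fun z => Finset.sum_congr rfl fun i _ => ?_
  have hpi := hp i
  by_cases hz : k < u z
  · simp [hz]
  · simp [hz, Real.zero_rpow (show p i ≠ 0 by linarith)]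

theorem aemeasurable_truncated_gradient (h : SolvesCauchyWith p A u₀ T u Du) (k : ℝ) {s t : ℝ}
    (hs : 0 < s) (ht : t < T) :
    AEMeasurable (fun z => ∑ i, ENNReal.ofReal (|{z | k < u z}.indicator Du z i| ^ p i))
      (volume.restrict (univ ×ˢ Ioo s t)) := by
  have hI : (univ : Set (E N)) ×ˢ Ioo s t ⊆ strip N (T : EReal) := by
    rw [strip_coe]
    exact prod_mono_right (Ioo_subset_Ioo hs.le ht.le)
  have h1 := ((h.gradient.truncation k).gradient_locallyIntegrable.aestronglyMeasurable).mono_measure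
    (Measure.restrict_mono hI le_rfl)
  refine Finset.aemeasurable_fun_sum _ fun i _ => ?_
  exact (((EuclideanSpace.proj (𝕜 := ℝ) i).continuous.comp_aestronglyMeasurable
    h1).aemeasurable.abs.pow_const _).ennreal_ofReal

theorem sliceEnergy_eq (u : E N × ℝ → ℝ) (k : ℝ) (ψ : ℝ → ℝ) (t : ℝ) :
    sliceEnergy u k ψ t =
      (∫⁻ x, ENNReal.ofReal (max (u (x, t) - k) 0 ^ 2)) * ENNReal.ofReal (ψ t) := by
  rw [sliceEnergy, ← lintegral_mul_const' _ _ ENNReal.ofReal_ne_top]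
  exact lintegral_congr fun x => ENNReal.ofReal_mul (sq_nonneg _)

theorem cutoffTerm_eq {k : ℝ} {ψ : ℝ → ℝ} {t₁ t₂ : ℝ}
    (hu : AEStronglyMeasurable u (volume.restrict (univ ×ˢ Ioo t₁ t₂))) :
    cutoffTerm u k ψ t₁ t₂ = ∫⁻ τ in Ioo t₁ t₂,
      (∫⁻ x, ENNReal.ofReal (max (u (x, τ) - k) 0 ^ 2)) * ENNReal.ofReal |deriv ψ τ| := by
  have h1 : AEMeasurable (fun z : E N × ℝ => ENNReal.ofReal (max (u z - k) 0 ^ 2 * |deriv ψ z.2|))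
      (volume.restrict (univ ×ˢ Ioo t₁ t₂)) := by
    have h2 : AEMeasurable (fun z => max (u z - k) 0 ^ 2)
        (volume.restrict ((univ : Set (E N)) ×ˢ Ioo t₁ t₂)) :=
      ((hu.aemeasurable.sub_const k).max aemeasurable_const).pow_const 2
    have h3 : Measurable fun z : E N × ℝ => |deriv ψ z.2| :=
      ((measurable_deriv ψ).comp measurable_snd).abs
    exact (h2.mul h3.aemeasurable).ennreal_ofReal
  rw [cutoffTerm]
  rw [volume_restrict_prod, Measure.restrict_univ] at h1 ⊢
  rw [lintegral_prod_symm _ h1]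
  refine lintegral_congr fun τ => ?_
  rw [← lintegral_mul_const' _ _ ENNReal.ofReal_ne_top]
  exact lintegral_congr fun x => ENNReal.ofReal_mul (sq_nonneg _)

theorem gradientTerm_eq (h : SolvesCauchyWith p A u₀ T u Du) (k : ℝ) {ψ : ℝ → ℝ} {s t : ℝ}
    (hs : 0 < s) (ht : t < T) (hψ : ContinuousOn ψ (Ioo s t)) :
    gradientTerm p ({z | k < u z}.indicator Du) ψ s t = ∫⁻ z in univ ×ˢ Ioo s t,
      (∑ i, ENNReal.ofReal (|{z | k < u z}.indicator Du z i| ^ p i)) * ENNReal.ofReal (ψ z.2) := by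
  have hI : (univ : Set (E N)) ×ˢ Ioo s t ⊆ strip N (T : EReal) := by
    rw [strip_coe]
    exact prod_mono_right (Ioo_subset_Ioo hs.le ht.le)
  have h1 := ((h.gradient.truncation k).gradient_locallyIntegrable.aestronglyMeasurable).mono_measure
    (Measure.restrict_mono hI le_rfl)
  have h2 : AEMeasurable (fun z : E N × ℝ => ψ z.2) (volume.restrict (univ ×ˢ Ioo s t)) :=
    (hψ.comp continuousOn_snd fun z hz => hz.2).aemeasurable
      (MeasurableSet.univ.prod measurableSet_Ioo)
  rw [gradientTerm, ← lintegral_finsetSum']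
  · refine lintegral_congr fun z => ?_
    rw [Finset.sum_mul]
    exact Finset.sum_congr rfl fun i _ => ENNReal.ofReal_mul (Real.rpow_nonneg (abs_nonneg _) _)
  · intro i _
    exact ((((EuclideanSpace.proj (𝕜 := ℝ) i).continuous.comp_aestronglyMeasurable
      h1).aemeasurable.abs.pow_const _).mul h2).ennreal_ofReal

/-- The weighted energy inequality for truncations at a nonnegative level. -/
theorem SolvesCauchyWith.weighted_energy_truncation (h : SolvesCauchyWith p A u₀ T u Du)
    (hT : 0 < T) (hp : ∀ i, 1 < p i) (hΛ : 0 < Λ) (hA : IsAnisotropicField p Λ (T : EReal) A)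
    (hu₀ : MemLp u₀ 2 volume)
    (hu : ∀ i, MemLp u (ENNReal.ofReal (p i)) (volume.restrict (strip N (T : EReal))))
    {k : ℝ} (hk : 0 ≤ k) {t₁ t₂ : ℝ} (h1 : 0 < t₁) (h12 : t₁ < t₂) (h2 : t₂ < T) {ψ : ℝ → ℝ}
    {L : ℝ≥0} (hψ : LipschitzOnWith L ψ (Icc t₁ t₂)) (hψ0 : ∀ t ∈ Icc t₁ t₂, 0 ≤ ψ t) :
    sliceEnergy u k ψ t₂ +
        ENNReal.ofReal (1 / Λ) * gradientTerm p ({z | k < u z}.indicator Du) ψ t₁ t₂ ≤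
      sliceEnergy u k ψ t₁ + cutoffTerm u k ψ t₁ t₂ ∧
    sliceEnergy u k ψ t₁ + cutoffTerm u k ψ t₁ t₂ < ⊤ := by
  have m1 : t₁ ∈ Icc t₁ t₂ := ⟨le_rfl, h12.le⟩
  have m2 : t₂ ∈ Icc t₁ t₂ := ⟨h12.le, le_rfl⟩
  have hsub : Icc t₁ t₂ ⊆ Icc 0 T := Icc_subset_Icc h1.le h2.le
  have hI : (univ : Set (E N)) ×ˢ Ioo t₁ t₂ ⊆ strip N (T : EReal) := by
    rw [strip_coe]
    exact prod_mono_right (Ioo_subset_Ioo h1.le h2.le)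
  set En : ℝ → ℝ≥0∞ := fun t => ∫⁻ x, ENNReal.ofReal (max (u (x, t) - k) 0 ^ 2) with hEn
  have hbd : ∀ t ∈ Icc t₁ t₂, En t ≤ eLpNorm u₀ 2 volume ^ 2 := fun t ht => by
    refine le_trans ?_ (pow_le_pow_left' (h.eLpNorm_le hT hp hΛ hA hu (hsub ht)) 2)
    rw [eLpNorm_two_sq]
    refine lintegral_mono fun x => ENNReal.ofReal_le_ofReal ?_
    rcases le_total (u (x, t) - k) 0 with h' | h'
    · rw [max_eq_right h']; nlinarith [sq_nonneg (u (x, t))]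
    · rw [max_eq_left h']; nlinarith
  have hfin : eLpNorm u₀ 2 volume ^ 2 < ⊤ := ENNReal.pow_lt_top hu₀.2
  set e : ℝ → ℝ := fun t => (En t).toReal with he
  have he0 : ∀ t, 0 ≤ e t := fun t => ENNReal.toReal_nonneg
  have hEe : ∀ t ∈ Icc t₁ t₂, ENNReal.ofReal (e t) = En t := fun t ht =>
    ENNReal.ofReal_toReal ((hbd t ht).trans_lt hfin).ne
  set g : E N × ℝ → ℝ≥0∞ :=
    fun z => ∑ i, ENNReal.ofReal (|{z | k < u z}.indicator Du z i| ^ p i) with hg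
  have hgm : AEMeasurable g (volume.restrict (univ ×ˢ Ioo t₁ t₂)) :=
    aemeasurable_truncated_gradient h k h1 h2
  set c := ENNReal.ofReal (1 / Λ) with hc
  set ν₀ : Measure (E N × ℝ) :=
    (volume.restrict (univ ×ˢ Ioo t₁ t₂)).withDensity (fun z => c * g z) with hν₀
  -- The gradient density is projected onto the time axis, which reduces the problem to a measure
  -- and a function of one variable.
  set ν : Measure ℝ := ν₀.map Prod.snd with hν
  have hνIoo : ∀ a b, t₁ ≤ a → b ≤ t₂ → ν (Ioo a b) = c * ∫⁻ z in univ ×ˢ Ioo a b, g z := by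
    intro a b ha hb
    rw [hν, Measure.map_apply measurable_snd measurableSet_Ioo, hν₀,
      withDensity_apply _ (measurable_snd measurableSet_Ioo),
      Measure.restrict_restrict (measurable_snd measurableSet_Ioo),
      ← lintegral_const_mul' _ _ ENNReal.ofReal_ne_top]
    congr 2
    ext z
    simp only [mem_inter_iff, mem_preimage, mem_prod, mem_univ, true_and, mem_Ioo]
    constructor
    · exact fun hz => hz.1
    · exact fun hz => ⟨hz, ha.trans_lt hz.1, hz.2.trans_le hb⟩
  have hna : NullSingletonClass ν := by
    refine ⟨fun a => ?_⟩
    rw [hν, Measure.map_apply measurable_snd (measurableSet_singleton a)]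
    refine (withDensity_absolutelyContinuous _ _)
      (Measure.absolutelyContinuous_of_le Measure.restrict_le_self ?_)
    rw [show (Prod.snd ⁻¹' {a} : Set (E N × ℝ)) = univ ×ˢ {a} by ext; simp,
      Measure.volume_eq_prod, Measure.prod_prod, Real.volume_singleton, mul_zero]
  have hmain := weighted_energy_le (ν := ν) (e := e) h12 (fun τ _ => he0 τ) (fun a b ha hab hb => by
      rw [hνIoo a b ha hb, hEe a ⟨ha, hab.le.trans hb⟩, hEe b ⟨ha.trans hab.le, hb⟩]
      exact h.lintegral_truncation_add_le hT hp hΛ hA hu hk (h1.trans_le ha) hab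
        (hb.trans_lt h2)) hψ hψ0
  have s1 : ∀ t ∈ Icc t₁ t₂, sliceEnergy u k ψ t = ENNReal.ofReal (e t * ψ t) := fun t ht => by
    rw [sliceEnergy_eq u k, ENNReal.ofReal_mul (he0 t), hEe t ht]
  have s2 : cutoffTerm u k ψ t₁ t₂ =
      ∫⁻ τ in Ioo t₁ t₂, ENNReal.ofReal (e τ * |deriv ψ τ|) := by
    rw [cutoffTerm_eq (h.gradient.locallyIntegrable.aestronglyMeasurable.mono_measure
      (Measure.restrict_mono hI le_rfl))]
    refine setLIntegral_congr_fun measurableSet_Ioo fun τ hτ => ?_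
    rw [ENNReal.ofReal_mul (he0 τ), hEe τ (Ioo_subset_Icc_self hτ)]
  have s3 : c * gradientTerm p ({z | k < u z}.indicator Du) ψ t₁ t₂ =
      ∫⁻ τ in Ioo t₁ t₂, ENNReal.ofReal (ψ τ) ∂ν := by
    -- Nothing is known about `ψ` outside `[t₁, t₂]`; the extension is measurable on the whole line,
    -- as the image measure formula requires.
    set ψ' : ℝ → ℝ := IccExtend h12.le ((Icc t₁ t₂).domRestrict ψ) with hψ'
    have hc' : Continuous ψ' :=
      (continuousOn_iff_continuous_domRestrict.1 hψ.continuousOn).Icc_extend'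
    have hee : ∀ τ ∈ Ioo t₁ t₂, ψ' τ = ψ τ := fun τ hτ =>
      IccExtend_of_mem h12.le _ (Ioo_subset_Icc_self hτ)
    have hmψ : Measurable fun τ => ENNReal.ofReal (ψ' τ) := hc'.measurable.ennreal_ofReal
    rw [gradientTerm_eq h k h1 h2 (hψ.continuousOn.mono Ioo_subset_Icc_self),
      setLIntegral_congr_fun (g := fun τ => ENNReal.ofReal (ψ' τ)) measurableSet_Ioo
        (fun τ hτ => by simp only [hee τ hτ]),
      hν, setLIntegral_map measurableSet_Ioo hmψ measurable_snd, hν₀,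
      restrict_withDensity (measurable_snd measurableSet_Ioo),
      Measure.restrict_restrict (measurable_snd measurableSet_Ioo),
      show (Prod.snd ⁻¹' Ioo t₁ t₂ ∩ univ ×ˢ Ioo t₁ t₂ : Set (E N × ℝ)) = univ ×ˢ Ioo t₁ t₂ by
        ext; simp,
      lintegral_withDensity_eq_lintegral_mul₀ (hgm.const_mul c)
        (g := fun z : E N × ℝ => ENNReal.ofReal (ψ' z.2)) (hmψ.comp measurable_snd).aemeasurable,
      ← lintegral_const_mul' _ _ ENNReal.ofReal_ne_top]
    refine setLIntegral_congr_fun (MeasurableSet.univ.prod measurableSet_Ioo) fun z hz => ?_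
    simp only [Pi.mul_apply, hee z.2 hz.2, mul_assoc, c, g]
  rw [s1 t₁ m1, s1 t₂ m2, s2, s3]
  refine ⟨hmain, ENNReal.add_lt_top.2 ⟨ENNReal.ofReal_lt_top, ?_⟩⟩
  set M := (eLpNorm u₀ 2 volume ^ 2).toReal
  calc ∫⁻ τ in Ioo t₁ t₂, ENNReal.ofReal (e τ * |deriv ψ τ|)
      ≤ ∫⁻ τ in Ioo t₁ t₂, ENNReal.ofReal (M * L) := by
        refine setLIntegral_mono measurable_const fun τ hτ => ENNReal.ofReal_le_ofReal ?_
        exact mul_le_mul (ENNReal.toReal_mono hfin.ne (hbd τ (Ioo_subset_Icc_self hτ)))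
          (abs_deriv_le_of_lipschitzOnWith hψ hτ) (abs_nonneg _) ENNReal.toReal_nonneg
    _ < ⊤ := by
        rw [setLIntegral_const, Real.volume_Ioo]
        exact ENNReal.mul_lt_top ENNReal.ofReal_lt_top ENNReal.ofReal_lt_top

/-- By Chebyshev's inequality `|f| ≥ |k| / 2` only on a set of finite measure. On the complement, of
infinite measure, `f - k` exceeds `|k| / 2`. -/
theorem lintegral_truncation_eq_top [Nontrivial (E N)] {f : E N → ℝ} (hf : MemLp f 2 volume) {k : ℝ}
    (hk : k < 0) : ∫⁻ x, ENNReal.ofReal (max (f x - k) 0 ^ 2) = ⊤ := by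
  have hfin : volume {x | ENNReal.ofReal (k ^ 2 / 4) ≤ ENNReal.ofReal (f x ^ 2)} < ⊤ := by
    have h1 : ∫⁻ x, ENNReal.ofReal (f x ^ 2) ≠ ⊤ := by
      rw [← eLpNorm_two_sq]; exact (ENNReal.pow_lt_top hf.2).ne
    have h2 : ENNReal.ofReal (k ^ 2 / 4) ≠ 0 := (ENNReal.ofReal_pos.2 (by nlinarith)).ne'
    exact (meas_ge_le_lintegral_div (hf.1.aemeasurable.pow_const 2).ennreal_ofReal h2
      ENNReal.ofReal_ne_top).trans_lt (ENNReal.div_lt_top h1 h2)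
  set S := {x | ENNReal.ofReal (k ^ 2 / 4) ≤ ENNReal.ofReal (f x ^ 2)}
  have hinf : volume Sᶜ = ⊤ := by
    by_contra hcon
    have h1 : volume (univ : Set (E N)) ≤ volume S + volume Sᶜ := by
      rw [← union_compl_self S]; exact measure_union_le _ _
    rw [measure_univ_of_isAddLeftInvariant] at h1
    exact (ENNReal.add_lt_top.2 ⟨hfin, lt_top_iff_ne_top.2 hcon⟩).not_ge h1
  have hle : ENNReal.ofReal (k ^ 2 / 4) * volume Sᶜ ≤
      ∫⁻ x, ENNReal.ofReal (max (f x - k) 0 ^ 2) := by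
    rw [← setLIntegral_const]
    refine (lintegral_mono_ae ?_).trans (setLIntegral_le_lintegral Sᶜ _)
    have hS : NullMeasurableSet Sᶜ := (nullMeasurableSet_le aemeasurable_const
      (hf.1.aemeasurable.pow_const 2).ennreal_ofReal).compl
    filter_upwards [ae_restrict_mem₀ hS] with x hx
    · have hx' : ENNReal.ofReal (f x ^ 2) < ENNReal.ofReal (k ^ 2 / 4) := not_le.1 hx
      rw [ENNReal.ofReal_lt_ofReal_iff (by nlinarith)] at hx'
      have h2 : k / 2 < f x := by
        by_contra hcon
        nlinarith
      refine ENNReal.ofReal_le_ofReal ?_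
      rw [max_eq_left (by linarith)]
      nlinarith
  rw [hinf, ENNReal.mul_top (ENNReal.ofReal_pos.2 (by nlinarith)).ne', top_le_iff] at hle
  exact hle

/-- For a negative level, the right-hand side of the energy inequality is infinite unless the
weight vanishes. -/
theorem weighted_energy_of_neg [Nontrivial (E N)] {w : E N × ℝ → E N} {c : ℝ≥0∞} {k : ℝ} (hk : k < 0)
    {t₁ t₂ : ℝ} (h12 : t₁ < t₂)
    (hum : AEStronglyMeasurable u (volume.restrict (univ ×ˢ Ioo t₁ t₂)))
    (hu : ∀ t ∈ Icc t₁ t₂, MemLp (fun x => u (x, t)) 2 volume) {ψ : ℝ → ℝ} {L : ℝ≥0}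
    (hψ : LipschitzOnWith L ψ (Icc t₁ t₂)) (hψ0 : ∀ t ∈ Icc t₁ t₂, 0 ≤ ψ t) :
    sliceEnergy u k ψ t₂ + c * gradientTerm p w ψ t₁ t₂ ≤
      sliceEnergy u k ψ t₁ + cutoffTerm u k ψ t₁ t₂ := by
  have m1 : t₁ ∈ Icc t₁ t₂ := ⟨le_rfl, h12.le⟩
  have m2 : t₂ ∈ Icc t₁ t₂ := ⟨h12.le, le_rfl⟩
  -- If the integral is not zero, the cut-off term is infinite. Otherwise `ψ` is constant: a
  -- positive constant makes the initial energy infinite, and for zero the left side vanishes.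
  by_cases hd : ∫⁻ τ in Ioo t₁ t₂, ENNReal.ofReal |deriv ψ τ| = 0
  · have hconst : ∀ τ ∈ Icc t₁ t₂, ψ τ = ψ t₁ := by
      intro τ hτ
      have hψτ := hψ.mono (Icc_subset_Icc_right hτ.2)
      have h1 := sub_le_integral_abs_deriv hψτ hτ.1
      have h2 : ∫ x in t₁..τ, |deriv ψ x| = 0 := by
        rw [intervalIntegral.integral_of_le hτ.1, integral_Ioc_eq_integral_Ioo,
          integral_eq_lintegral_of_nonneg_ae (Eventually.of_forall fun _ => abs_nonneg _)
            (measurable_deriv ψ).abs.aestronglyMeasurable]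
        have h3 : ∫⁻ x in Ioo t₁ τ, ENNReal.ofReal |deriv ψ x| ≤ 0 :=
          hd ▸ lintegral_mono_set (Ioo_subset_Ioo_right hτ.2)
        rw [nonpos_iff_eq_zero.1 h3, ENNReal.toReal_zero]
      rw [h2] at h1
      linarith [abs_nonpos_iff.1 h1]
    rcases (hψ0 t₁ m1).eq_or_lt with h0 | h0
    · have e1 : sliceEnergy u k ψ t₂ = 0 := by
        rw [sliceEnergy_eq u k, hconst t₂ m2, ← h0]; simp
      have e2 : gradientTerm p w ψ t₁ t₂ = 0 := by
        refine Finset.sum_eq_zero fun i _ => ?_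
        rw [setLIntegral_congr_fun (g := fun _ => 0) (MeasurableSet.univ.prod measurableSet_Ioo),
          lintegral_zero]
        intro z hz
        simp only
        rw [hconst z.2 (Ioo_subset_Icc_self hz.2), ← h0]; simp
      simp [e1, e2]
    · have : sliceEnergy u k ψ t₁ = ⊤ := by
        rw [sliceEnergy_eq u k, lintegral_truncation_eq_top (hu t₁ m1) hk,
          ENNReal.top_mul (ENNReal.ofReal_pos.2 h0).ne']
      rw [this, top_add]; exact le_top
  · have : cutoffTerm u k ψ t₁ t₂ = ⊤ := by
      rw [cutoffTerm_eq hum, setLIntegral_congr_fun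
        (g := fun τ => ⊤ * ENNReal.ofReal |deriv ψ τ|) measurableSet_Ioo fun τ hτ => by
          simp only [lintegral_truncation_eq_top (hu τ (Ioo_subset_Icc_self hτ)) hk],
        lintegral_const_mul _ (by fun_prop), ENNReal.top_mul hd]
    rw [this, add_top]; exact le_top

end Solution

end AnisoCauchy

/-! ### The corollary -/

open AnisoCauchy

theorem mainTheorem8 (N : ℕ) (hN : 1 ≤ N) (p : Fin N → ℝ) (hp : ∀ i, 1 < p i)
    (Λ : ℝ) (hΛ : 0 < Λ) :
    ∃ C : ℝ, 0 < C ∧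
      ∀ (T : EReal), 0 < T →
      ∀ A : AnisoCauchy.E N × ℝ → ℝ → AnisoCauchy.E N → AnisoCauchy.E N,
      AnisoCauchy.IsAnisotropicField p Λ T A →
      ∀ u₀ : AnisoCauchy.E N → ℝ, MemLp u₀ 2 volume →
      ∀ u : AnisoCauchy.E N × ℝ → ℝ, AnisoCauchy.SolvesCauchy p A u₀ T u →
      (∀ i, MemLp u (ENNReal.ofReal (p i)) (volume.restrict (AnisoCauchy.strip N T))) →
        AnisoCauchy.MemLinftyL2 T u ∧
        (∀ t ∈ AnisoCauchy.closedTimes T,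
          MemLp (fun x => u (x, t)) 2 volume ∧
          eLpNorm (fun x => u (x, t)) 2 volume ≤ eLpNorm u₀ 2 volume) ∧
        ∀ k : ℝ, ∃ w : AnisoCauchy.E N × ℝ → AnisoCauchy.E N,
          AnisoCauchy.IsWeakSpatialGradient T (fun z => max (u z - k) 0) w ∧
          ∀ t₁ t₂ : ℝ, 0 < t₁ → t₁ < t₂ → (t₂ : EReal) < T →
          ∀ ψ : ℝ → ℝ, (∃ L : ℝ≥0, LipschitzOnWith L ψ (AnisoCauchy.closedTimes T)) →
          (∀ t ∈ AnisoCauchy.closedTimes T, 0 ≤ ψ t) →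
            AnisoCauchy.sliceEnergy u k ψ t₂ +
                ENNReal.ofReal (1 / C) * AnisoCauchy.gradientTerm p w ψ t₁ t₂ ≤
              AnisoCauchy.sliceEnergy u k ψ t₁ + AnisoCauchy.cutoffTerm u k ψ t₁ t₂ ∧
            (0 ≤ k →
              AnisoCauchy.sliceEnergy u k ψ t₁ + AnisoCauchy.cutoffTerm u k ψ t₁ t₂ < ⊤) := by
  refine ⟨Λ, hΛ, fun T hT A hA u₀ hu₀ u ⟨Du, hsol⟩ hu => ?_⟩
  have : Nonempty (Fin N) := ⟨⟨0, hN⟩⟩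
  have : Nontrivial (E N) := inferInstance
  have hu' : ∀ T' : ℝ, (T' : EReal) ≤ T → ∀ i,
      MemLp u (ENNReal.ofReal (p i)) (volume.restrict (strip N (T' : EReal))) := fun T' hT' i =>
    (hu i).mono_measure (Measure.restrict_mono (strip_mono hT') le_rfl)
  have hslice : ∀ t ∈ closedTimes T, MemLp (fun x => u (x, t)) 2 volume ∧
      eLpNorm (fun x => u (x, t)) 2 volume ≤ eLpNorm u₀ 2 volume := by
    intro t ht
    -- For `t > 0` the height `T' = t` serves, also when `t = T`, because the `L²` bound holds up to
    -- the final time of the strip.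
    obtain ⟨T', hT'0, hT', htT'⟩ : ∃ T' : ℝ, 0 < T' ∧ (T' : EReal) ≤ T ∧ t ≤ T' := by
      rcases ht.1.eq_or_lt with h0 | h0
      · obtain ⟨T', h1, h2⟩ := EReal.lt_iff_exists_real_btwn.1 hT
        have h1 : 0 < T' := by exact_mod_cast h1
        exact ⟨T', h1, h2.le, h0 ▸ h1.le⟩
      · exact ⟨t, h0, ht.2, le_rfl⟩
    have h := hsol T' hT'0 hT'
    have htI : t ∈ Icc 0 T' := ⟨ht.1, htT'⟩
    have hle := h.eLpNorm_le hT'0 hp hΛ (hA.mono hT') (hu' T' hT') htI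
    exact ⟨⟨aestronglyMeasurable_slice h.continuous htI, hle.trans_lt hu₀.2⟩, hle⟩
  have hsub : openTimes T ⊆ closedTimes T := fun t ht => ⟨ht.1.le, ht.2.le⟩
  refine ⟨⟨(hu ⟨0, hN⟩).1, (eLpNorm u₀ 2 volume).toNNReal, ?_⟩, hslice, fun k =>
    ⟨{z | k < u z}.indicator Du, ?_, ?_⟩⟩
  · filter_upwards [ae_restrict_mem (isOpen_openTimes T).measurableSet] with t ht
    rw [ENNReal.coe_toNNReal hu₀.2.ne]
    exact hslice t (hsub ht)
  · exact (isWeakSpatialGradient_of_forall_lt hT fun T' h0 hT' => (hsol T' h0 hT').gradient).truncation k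
  · rintro t₁ t₂ h1 h12 h2 ψ ⟨L, hψ⟩ hψ0
    -- The weighted inequality needs `t₂` strictly below a finite final time.
    obtain ⟨T', hT1, hT2⟩ := EReal.lt_iff_exists_real_btwn.1 h2
    have hT1 : t₂ < T' := by exact_mod_cast hT1
    have hT'0 : 0 < T' := (h1.trans h12).trans hT1
    have h := hsol T' hT'0 hT2.le
    have hI : Icc t₁ t₂ ⊆ closedTimes T := fun t ht =>
      ⟨h1.le.trans ht.1, le_trans (by exact_mod_cast ht.2) h2.le⟩
    have hψ' := hψ.mono hI
    have hψ0' : ∀ t ∈ Icc t₁ t₂, 0 ≤ ψ t := fun t ht => hψ0 t (hI ht)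
    rcases lt_or_ge k 0 with hk | hk
    · refine ⟨weighted_energy_of_neg hk h12 ?_ (fun t ht => (hslice t (hI ht)).1) hψ' hψ0',
        fun hk' => absurd hk hk'.not_gt⟩
      refine (hu ⟨0, hN⟩).1.mono_measure (Measure.restrict_mono ?_ le_rfl)
      exact prod_mono_right fun t ht =>
        ⟨h1.trans ht.1, lt_trans (by exact_mod_cast ht.2) h2⟩
    · have := h.weighted_energy_truncation hT'0 hp hΛ (hA.mono hT2.le) hu₀ (hu' T' hT2.le) hk
        h1 h12 hT1 hψ' hψ0'
      exact ⟨this.1, fun _ => this.2⟩
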